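/- Let $\mathrm{vol}$ be Lebesgue measure on $\mathbb R^3$ and let $B_\varepsilon(x)$ be the ball of radius $\varepsilon$ centered at $x$. A *lattice polytope* is a convex polytope all of whose vertices lie in $\mathbb Z^3$. For such a polytope $P\subset\mathbb R^3$ and $x\in P$, the *solid angle* of $P$ at $x$ is $\omega_P(x)=\mathrm{vol}(B_\varepsilon(x)\cap P)/\mathrm{vol}(B_\varepsilon(x))$ for all sufficiently small $\varepsilon>0$. Call $P$ *concrete* if $\sum_{x\in P\cap\mathbb Z^3}\omega_P(x)=\mathrm{vol}(P)$. Say that $P$ *multitiles* $\mathbb R^3$ if there are an integer $k\ge 1$ and an infinite family $\mathcal P$ (repetitions allowed) of congruent copies of $P$, i.e. images of $P$ under arbitrary isometries of $\mathbb R^3$, reflections included, such that almost every point of $\mathbb R^3$ belongs to exactly $k$ members of $\mathcal P$. A *zonotope* is a translate of a Minkowski sum of finitely many line segments, and a *lattice zonotope* is a zonotope that is a lattice polytope. **Theorem.** There is a full-dimensional concrete lattice polytope $P\subset\mathbb R^3$ that does not multitile $\mathbb R^3$. Moreover, $P$ can be chosen so that for every $N\in\mathbb N$ there is a lattice zonotope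 $Q\subset\mathbb R^3$ for which the Minkowski sum $P+Q$ is again a full-dimensional concrete lattice polytope that does not multitile $\mathbb R^3$, and $P+Q$ has more than $N$ vertices. -/

import Mathlib

open MeasureTheory Filter Topology
open scoped Pointwise

/-- Euclidean space `ℝ^d`, with the Euclidean distance and Lebesgue measure. -/
abbrev Euc (d : ℕ) : Type := EuclideanSpace ℝ (Fin d)

/-- The integer lattice `ℤ^d ⊂ ℝ^d`. -/
def integerLattice (d : ℕ) : Set (Euc d) := {x | ∀ i, ∃ n : ℤ, x i = n}

/-- A convex polytope: the convex hull of finitely many points.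
It need not be full-dimensional. -/
def IsConvexPolytope {d : ℕ} (P : Set (Euc d)) : Prop :=
  ∃ s : Set (Euc d), s.Finite ∧ P = convexHull ℝ s

/-- The vertices of a convex polytope are its extreme points. -/
def polytopeVertices {d : ℕ} (P : Set (Euc d)) : Set (Euc d) := P.extremePoints ℝ

/-- A lattice polytope: a convex polytope all of whose vertices are integer points. -/
def IsLatticePolytope {d : ℕ} (P : Set (Euc d)) : Prop :=
  IsConvexPolytope P ∧ polytopeVertices P ⊆ integerLattice d

/-- The proportion `vol (B_ε(x) ∩ P) / vol (B_ε(x))`. -/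
noncomputable def ballRatio {d : ℕ} (P : Set (Euc d)) (x : Euc d) (ε : ℝ) : ℝ :=
  volume.real (Metric.ball x ε ∩ P) / volume.real (Metric.ball x ε)

/-- The solid angle `ω_P(x)`: the value of `vol (B_ε(x) ∩ P) / vol (B_ε(x))` for all sufficiently
small `ε > 0`, written as the limit for `ε → 0+`. For a polytope the ratio is eventually constant,
so that the limit is this value; that the limit exists for convex `P` and `x ∈ P` is proved
in `tendsto_ballRatio`. -/
noncomputable def solidAngle {d : ℕ} (P : Set (Euc d)) (x : Euc d) : ℝ :=
  limUnder (𝓝[>] (0 : ℝ)) (ballRatio P x)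

/-- The solid angle is the eventual value of the ratio, whenever there is one. -/
theorem solidAngle_eq_of_eventually {d : ℕ} {P : Set (Euc d)} {x : Euc d} {w : ℝ}
    (h : ∀ᶠ ε in 𝓝[>] (0 : ℝ), ballRatio P x ε = w) : solidAngle P x = w :=
  (tendsto_const_nhds.congr' (h.mono fun _ hε => hε.symm)).limUnder_eq

theorem tendsto_ballRatio {d : ℕ} {P : Set (Euc d)} (hP : Convex ℝ P) {x : Euc d} (hx : x ∈ P) :
    Tendsto (ballRatio P x) (𝓝[>] (0 : ℝ)) (𝓝 (solidAngle P x)) := by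
  have hfin : ∀ ε : ℝ, volume (Metric.ball x ε) ≠ ⊤ := fun ε => measure_ball_lt_top.ne
  have hmono : AntitoneOn (ballRatio P x) (Set.Ioi 0) := by
    intro a ha b hb hab
    have ha' : (0 : ℝ) < a := ha
    have hb' : (0 : ℝ) < b := hb
    set c : ℝ := a / b with hc
    have hc0 : 0 < c := div_pos ha' hb'
    have hc1 : c ≤ 1 := (div_le_one hb').2 hab
    have key : ∀ s : Set (Euc d), volume.real (AffineMap.homothety x c '' s)
        = c ^ d * volume.real s := by
      intro s
      simp only [Measure.real, Measure.addHaar_image_homothety, finrank_euclideanSpace_fin,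
        ENNReal.toReal_mul]
      rw [ENNReal.toReal_ofReal (abs_nonneg _), abs_of_pos (pow_pos hc0 d)]
    have hball : volume.real (Metric.ball x a) = c ^ d * volume.real (Metric.ball x b) := by
      rw [← key]
      congr 1
      ext y
      simp only [Set.mem_image, Metric.mem_ball]
      constructor
      · intro hy
        refine ⟨AffineMap.homothety x c⁻¹ y, ?_, ?_⟩
        · rw [dist_homothety_center, norm_inv, Real.norm_of_nonneg hc0.le, dist_comm,
            inv_mul_lt_iff₀ hc0, hc, div_mul_cancel₀ _ hb'.ne']
          exact hy
        · rw [← AffineMap.homothety_mul_apply, mul_inv_cancel₀ hc0.ne']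
          simp
      · rintro ⟨z, hz, rfl⟩
        rw [dist_homothety_center, Real.norm_of_nonneg hc0.le, dist_comm, hc]
        calc a / b * dist z x < a / b * b := by gcongr
          _ = a := div_mul_cancel₀ _ hb'.ne'
    have hsub : AffineMap.homothety x c '' (Metric.ball x b ∩ P) ⊆ Metric.ball x a ∩ P := by
      rintro _ ⟨z, ⟨hz, hzP⟩, rfl⟩
      refine ⟨?_, ?_⟩
      · rw [Metric.mem_ball] at hz ⊢
        rw [dist_homothety_center, Real.norm_of_nonneg hc0.le, dist_comm, hc]
        calc a / b * dist z x < a / b * b := by gcongr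
          _ = a := div_mul_cancel₀ _ hb'.ne'
      · rw [AffineMap.homothety_eq_lineMap]
        exact hP.lineMap_mem hx hzP ⟨hc0.le, hc1⟩
    have hle : c ^ d * volume.real (Metric.ball x b ∩ P) ≤ volume.real (Metric.ball x a ∩ P) := by
      rw [← key]
      exact measureReal_mono hsub (measure_ne_top_of_subset Set.inter_subset_left (hfin a))
    have hpos : 0 < volume.real (Metric.ball x b) :=
      ENNReal.toReal_pos (Metric.measure_ball_pos volume x hb').ne' (hfin b)
    unfold ballRatio
    rw [hball, div_le_div_iff₀ hpos (mul_pos (pow_pos hc0 d) hpos)]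
    nlinarith
  have hbdd : BddAbove (ballRatio P x '' Set.Ioi 0) := by
    refine ⟨1, ?_⟩
    rintro _ ⟨ε, -, rfl⟩
    exact div_le_one_of_le₀ (measureReal_mono Set.inter_subset_left (hfin ε)) measureReal_nonneg
  exact tendsto_nhds_limUnder ⟨_, hmono.tendsto_nhdsGT hbdd⟩

/-- The discrete volume `χ(P)`: the sum of the solid angles over the integer points of `P`
(finitely many when `P` is a polytope). -/
noncomputable def discreteVolume {d : ℕ} (P : Set (Euc d)) : ℝ :=
  ∑ᶠ x ∈ P ∩ integerLattice d, solidAngle P x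

/-- A set, in practice a lattice polytope, is concrete if `χ(P) = vol(P)`. -/
def IsConcrete {d : ℕ} (P : Set (Euc d)) : Prop := discreteVolume P = volume.real P

/-- `Q` is a congruent copy of `P`: its image under an isometry of `ℝ^d` onto itself
(reflections are allowed). -/
def IsCongruentCopy {d : ℕ} (P Q : Set (Euc d)) : Prop :=
  ∃ g : Euc d ≃ᵢ Euc d, Q = g '' P

/-- `P` multitiles `ℝ^d`: for some integer `k ≥ 1` there is an infinite family of congruent copies
of `P`, in which a copy may occur more than once, such that every generic point of `ℝ^d`,
that is, almost every point, belongs to exactly `k` members of the family. For a countable family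
of copies of a polytope this is the same as asking it of every point which is on no boundary
of a member, and such a family of full-dimensional copies is automatically countable. -/
def Multitiles {d : ℕ} (P : Set (Euc d)) : Prop :=
  ∃ k : ℕ, 1 ≤ k ∧ ∃ (ι : Type) (F : ι → Set (Euc d)), Infinite ι ∧
    (∀ i, IsCongruentCopy P (F i)) ∧
    ∀ᵐ x : Euc d, {i | x ∈ F i}.encard = k

/-- A zonotope: a translate of the Minkowski sum of finitely many segments `[0, v i]`. -/
def IsZonotope {d : ℕ} (Q : Set (Euc d)) : Prop :=
  ∃ (n : ℕ) (a : Euc d) (v : Fin n → Euc d),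
    Q = {a} + ∑ i, segment ℝ (0 : Euc d) (v i)

/-- A lattice zonotope: a zonotope which is a lattice polytope. -/
def IsLatticeZonotope {d : ℕ} (Q : Set (Euc d)) : Prop :=
  IsZonotope Q ∧ IsLatticePolytope Q

/-- A counterexample to the claim that concrete lattice polytopes multitile: a full-dimensional
concrete lattice polytope which does not multitile `ℝ^d`. -/
def IsConcreteNonMultitiler {d : ℕ} (P : Set (Euc d)) : Prop :=
  IsLatticePolytope P ∧ (interior P).Nonempty ∧ IsConcrete P ∧ ¬ Multitiles P

/-! Write ω_A(x) for the solid angle and, for a ℚ-linear f : ℝ → ℚ with f 1 = 0, put D_f(A) = ∫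
f(ω_A(x)) dℋ¹(x). For a bounded polyhedron only the edges contribute, so D_f is the Dehn invariant
paired with f. In a multitiling the angles of the copies at any point add up to the integer k, so
their values under f cancel. Averaging over a large ball, where boundary effects are of lower order,
gives D_f(A) = 0 (`integral_angle_eq_zero_of_tiling`). It suffices to find concrete polytopes with
D_f ≠ 0.

P is a large lattice tetrahedron minus a small one with the same corner and the same apex. Modulo ℚ
each dihedral angle, as a fraction of a full turn, is 0, ±A or B. The vertex angles of a tetrahedron
enter only through their sum, which the dihedral angles determine (`sum_solidAngle_tetrahedron`).
Both discrete volumes contain the same irrational part 2A + 2B, so it cancels, and what remains is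
vol P = 13/2. In D_f, however, the angles are weighted by edge lengths, and D_f(P) = 2√6 f(B) - 8
f(A). As √6 is irrational and f has rational values, this is nonzero once f(A) ≠ 0. Such an f exists
because A is irrational, by Niven's theorem (`exists_linearMap_ne_zero`).

For the zonotopes, segments parallel to the base of P are added one at a time. If S is the current
polytope and v the next edge, let E = (S + [0, v]) ∖ S. A line parallel to v which meets S meets E
in a half-open segment of length |v|, and the shadow of E along v is a trapezoid or triangle, which
together with its point reflection fills a parallelogram. Hence E and a reflected copy tile space by
translations from a sublattice of ℤ³ (`existsUnique_tiling`). Thus E has equal volume and angle sum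
(`tsum_angle_eq_volume`), and D_f(E) = 0. Concreteness and D_f therefore survive the addition
(`add_segment_of_tiling`), while the number of vertices grows with the number of directions. -/

open scoped RealInnerProductSpace ENNReal

/-! ### Solid angles of measurable sets -/

/-- `A` has the solid angle `w` at `x`. -/
def HasAngle {d : ℕ} (A : Set (Euc d)) (x : Euc d) (w : ℝ) : Prop :=
  Tendsto (ballRatio A x) (𝓝[>] (0 : ℝ)) (𝓝 w)

namespace HasAngle

variable {d : ℕ} {A B : Set (Euc d)} {x : Euc d} {w w' : ℝ}

theorem solidAngle_eq (h : HasAngle A x w) : solidAngle A x = w := h.limUnder_eq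

theorem unique (h : HasAngle A x w) (h' : HasAngle A x w') : w = w' :=
  tendsto_nhds_unique h h'

/-- Only the germ at `x` up to null sets matters, so boundary pieces can be added or dropped when
sets are subtracted. -/
theorem congr_ae {δ : ℝ} (hδ : 0 < δ)
    (hAB : ∀ᵐ y : Euc d, y ∈ Metric.ball x δ → (y ∈ A ↔ y ∈ B)) (h : HasAngle A x w) :
    HasAngle B x w := by
  refine Tendsto.congr' ?_ h
  filter_upwards [Ioo_mem_nhdsGT hδ] with ε hε
  unfold ballRatio
  congr 1
  refine measureReal_congr ?_
  filter_upwards [hAB] with y hy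
  refine propext (and_congr_right fun hyε => hy (Metric.ball_subset_ball hε.2.le hyε))

theorem congr_ball {δ : ℝ} (hδ : 0 < δ) (hAB : ∀ y ∈ Metric.ball x δ, (y ∈ A ↔ y ∈ B))
    (h : HasAngle A x w) : HasAngle B x w :=
  h.congr_ae hδ (Eventually.of_forall hAB)

theorem of_eventually (h : ∀ᶠ ε in 𝓝[>] (0 : ℝ), ballRatio A x ε = w) : HasAngle A x w :=
  tendsto_const_nhds.congr' (h.mono fun _ hε => hε.symm)

end HasAngle

section Basic

variable {d : ℕ} {A B : Set (Euc d)} {x : Euc d} {w w' : ℝ}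

theorem hasAngle_empty (x : Euc d) : HasAngle (∅ : Set (Euc d)) x 0 :=
  HasAngle.of_eventually (Eventually.of_forall fun ε => by simp [ballRatio])

theorem hasAngle_of_notMem_closure (h : x ∉ closure A) : HasAngle A x 0 := by
  obtain ⟨δ, hδ, hb⟩ := Metric.mem_nhds_iff.1 (isClosed_closure.isOpen_compl.mem_nhds h)
  exact (hasAngle_empty x).congr_ball hδ fun y hy =>
    ⟨fun h => h.elim, fun hyA => (hb hy (subset_closure hyA)).elim⟩

theorem volume_real_ball_pos (x : Euc d) {ε : ℝ} (hε : 0 < ε) :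
    0 < volume.real (Metric.ball x ε) :=
  ENNReal.toReal_pos (Metric.measure_ball_pos volume x hε).ne' measure_ball_lt_top.ne

theorem Convex.hasAngle_solidAngle (hA : Convex ℝ A) (hc : IsClosed A) (x : Euc d) :
    HasAngle A x (solidAngle A x) := by
  by_cases hx : x ∈ A
  · exact tendsto_ballRatio hA hx
  · have := hasAngle_of_notMem_closure (hc.closure_eq.symm ▸ hx : x ∉ closure A)
    rwa [this.solidAngle_eq]

/-- A linear relation between indicator functions near `x` holds between the solid angles. -/
theorem sum_mul_hasAngle_eq {ι : Type*} (s : Finset ι) (A : ι → Set (Euc d)) (c w : ι → ℝ)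
    (C : ℝ) {δ : ℝ} (hδ : 0 < δ) (hA : ∀ i ∈ s, MeasurableSet (A i))
    (hw : ∀ i ∈ s, HasAngle (A i) x (w i))
    (h : ∀ᵐ y : Euc d, y ∈ Metric.ball x δ → ∑ i ∈ s, c i * (A i).indicator 1 y = C) :
    ∑ i ∈ s, c i * w i = C := by
  have h1 : Tendsto (fun ε => ∑ i ∈ s, c i * ballRatio (A i) x ε) (𝓝[>] (0 : ℝ))
      (𝓝 (∑ i ∈ s, c i * w i)) :=
    tendsto_finsetSum _ fun i hi => (hw i hi).const_mul _
  refine tendsto_nhds_unique h1 (tendsto_const_nhds.congr' ?_)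
  filter_upwards [Ioo_mem_nhdsGT hδ] with ε hε
  have hpos := volume_real_ball_pos x hε.1
  -- The ratio is the mean of the indicator over the ball, so the pointwise relation can be
  -- integrated.
  have h2 : ∀ i ∈ s, c i * ballRatio (A i) x ε =
      (∫ y in Metric.ball x ε, c i * (A i).indicator 1 y) / volume.real (Metric.ball x ε) := by
    intro i hi
    rw [integral_const_mul, integral_indicator_one (hA i hi), ballRatio, mul_div_assoc,
      measureReal_restrict_apply (hA i hi), Set.inter_comm]
  rw [Finset.sum_congr rfl h2, ← Finset.sum_div, ← integral_finsetSum]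
  · rw [eq_div_iff hpos.ne', setIntegral_congr_ae (g := fun _ => C) measurableSet_ball]
    · simp [mul_comm]
    · filter_upwards [h] with y hy hyε
      exact hy (Metric.ball_subset_ball hε.2.le hyε)
  · intro i hi
    refine Integrable.const_mul ?_ _
    have : IntegrableOn (fun _ : Euc d => (1 : ℝ)) (Metric.ball x ε) volume :=
      integrableOn_const measure_ball_lt_top.ne
    exact Integrable.indicator (f := fun _ => (1 : ℝ)) this (hA i hi)

theorem hasAngle_diff (hA : MeasurableSet A) (hAB : A ⊆ B)
    (hw : HasAngle A x w) (hw' : HasAngle B x w') : HasAngle (B \ A) x (w' - w) := by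
  refine (hw'.sub hw).congr fun ε => ?_
  unfold ballRatio
  rw [← sub_div]
  congr 1
  have : Metric.ball x ε ∩ (B \ A) = (Metric.ball x ε ∩ B) \ (Metric.ball x ε ∩ A) := by
    ext y; simp only [Set.mem_inter_iff, Set.mem_sdiff]; tauto
  rw [this, measureReal_sdiff (Set.inter_subset_inter_right _ hAB) (measurableSet_ball.inter hA)
    (measure_ne_top_of_subset Set.inter_subset_left measure_ball_lt_top.ne)]

/-- By Mazur–Ulam, such an isometry is a linear isometry followed by a translation. -/
theorem measurePreserving_isometryEquiv (g : Euc d ≃ᵢ Euc d) :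
    MeasurePreserving g (volume : Measure (Euc d)) volume := by
  have h1 := (g.toRealAffineIsometryEquiv.linearIsometryEquiv).measurePreserving
  have h2 := measurePreserving_add_right (volume : Measure (Euc d)) (g 0)
  have h3 : (g : Euc d → Euc d) =
      (fun x => x + g 0) ∘ g.toRealAffineIsometryEquiv.linearIsometryEquiv := by
    funext y
    have := g.toRealAffineIsometryEquiv.map_vadd (0 : Euc d) y
    simp only [vadd_eq_add, add_zero] at this
    exact this
  rw [h3]
  exact h2.comp h1

theorem volume_image_isometryEquiv (g : Euc d ≃ᵢ Euc d) (s : Set (Euc d)) :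
    volume (g '' s) = volume s := by
  rw [show g '' s = g.symm ⁻¹' s from g.toEquiv.image_eq_preimage_symm s]
  exact (measurePreserving_isometryEquiv g.symm).measure_preimage_emb
    g.symm.toHomeomorph.measurableEmbedding s

theorem HasAngle.image_isometryEquiv (h : HasAngle A x w) (g : Euc d ≃ᵢ Euc d) :
    HasAngle (g '' A) (g x) w := by
  refine Tendsto.congr (fun ε => ?_) h
  unfold ballRatio Measure.real
  rw [← g.image_ball, ← Set.image_inter g.injective, volume_image_isometryEquiv,
    volume_image_isometryEquiv]

/-- The angle at the origin of a set symmetric to `A`. -/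
theorem HasAngle.neg (h : HasAngle A x w) : HasAngle (-A) (-x) w := by
  have := h.image_isometryEquiv (IsometryEquiv.neg (Euc d))
  rwa [show (IsometryEquiv.neg (Euc d)) '' A = -A from Set.image_neg_eq_neg,
    show IsometryEquiv.neg (Euc d) x = -x from rfl] at this

theorem hasAngle_univ (x : Euc d) : HasAngle (Set.univ : Set (Euc d)) x 1 := by
  refine HasAngle.of_eventually ?_
  filter_upwards [self_mem_nhdsWithin] with ε hε
  simp [ballRatio, div_self (volume_real_ball_pos x hε).ne']

end Basic

/-! ### Half-spaces and wedges -/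

theorem MeasurableSet.ofPred_and {α : Type*} [MeasurableSpace α] {p q : α → Prop}
    (hp : MeasurableSet {a | p a}) (hq : MeasurableSet {a | q a}) :
    MeasurableSet {a | p a ∧ q a} :=
  hp.inter hq


section Wedge

open Real

/-- In polar coordinates the indicator is a product of a function of `r` and a function of `φ`. -/
theorem volume_disc_inter_sector (c : ℝ) {A : Set (ℝ × ℝ)} {J : Set ℝ} (hA : MeasurableSet A)
    (hJ : MeasurableSet J)
    (h : ∀ r > 0, ∀ φ ∈ Set.Ioo (-π) π, (r * cos φ, r * sin φ) ∈ A ↔ φ ∈ J) :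
    volume ({p : ℝ × ℝ | p.1 ^ 2 + p.2 ^ 2 < c} ∩ A) =
      (∫⁻ r in Set.Ioi (0 : ℝ), ENNReal.ofReal r * {r : ℝ | r ^ 2 < c}.indicator 1 r) *
        volume (J ∩ Set.Ioo (-π) π) := by
  classical
  have hD : MeasurableSet {p : ℝ × ℝ | p.1 ^ 2 + p.2 ^ 2 < c} :=
    measurableSet_lt (by fun_prop) (by fun_prop)
  have hr : MeasurableSet {r : ℝ | r ^ 2 < c} := measurableSet_lt (by fun_prop) (by fun_prop)
  rw [← lintegral_indicator_one (hD.inter hA), ← lintegral_comp_polarCoord_symm,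
    polarCoord_target, ← Measure.restrict_apply' measurableSet_Ioo,
    ← lintegral_indicator_one hJ, Measure.volume_eq_prod, ← Measure.prod_restrict,
    ← lintegral_prod_mul]
  · rw [Measure.prod_restrict]
    refine setLIntegral_congr_fun (measurableSet_Ioi.prod measurableSet_Ioo) ?_
    rintro ⟨r, φ⟩ ⟨hr0, hφ⟩
    have h1 : (polarCoord.symm (r, φ) ∈ ({p : ℝ × ℝ | p.1 ^ 2 + p.2 ^ 2 < c} ∩ A)) ↔
        (r ^ 2 < c ∧ φ ∈ J) := by
      rw [polarCoord_symm_apply, Set.mem_inter_iff, h r hr0 φ hφ, Set.mem_ofPred_eq]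
      have : (r * cos φ) ^ 2 + (r * sin φ) ^ 2 = r ^ 2 := by
        nlinarith [sin_sq_add_cos_sq φ]
      rw [this]
    beta_reduce
    rw [Set.indicator_apply, Set.indicator_apply, Set.indicator_apply]
    simp only [h1, Set.mem_ofPred_eq, smul_eq_mul]
    by_cases a : r ^ 2 < c <;> by_cases b : φ ∈ J <;> simp [a, b]
  · exact (ENNReal.measurable_ofReal.mul (measurable_one.indicator hr)).aemeasurable
  · exact (measurable_one.indicator hJ).aemeasurable

/-- The map to `ℝ × (ℝ × ℝ)` which separates the last coordinate. -/
theorem exists_measurePreserving_euc_three :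
    ∃ Φ : Euc 3 ≃ᵐ ℝ × (ℝ × ℝ), MeasurePreserving Φ volume volume ∧
      ∀ x, Φ x = (x 2, (x 0, x 1)) := by
  refine ⟨(MeasurableEquiv.toLp 2 (Fin 3 → ℝ)).symm.trans
    ((MeasurableEquiv.piFinSuccAbove (fun _ => ℝ) 2).trans
      ((MeasurableEquiv.refl ℝ).prodCongr MeasurableEquiv.finTwoArrow)), ?_, ?_⟩
  · refine (EuclideanSpace.volume_preserving_symm_measurableEquiv_toLp (Fin 3)).trans
      ((volume_preserving_piFinSuccAbove (fun _ : Fin 3 => ℝ) 2).trans ?_)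
    exact (MeasurePreserving.id _).prod (volume_preserving_finTwoArrow ℝ)
  · intro x
    rfl

/-- The slice at height `t` is a disc of squared radius `ε ^ 2 - t ^ 2`. The factor `G` is the same
for all sectors, so it cancels against the whole ball and need not be computed. -/
theorem exists_volume_ball_inter_sector (ε : ℝ) (hε : 0 < ε) : ∃ G : ENNReal, ∀ (A : Set (ℝ × ℝ))
    (J : Set ℝ), MeasurableSet A → MeasurableSet J →
    (∀ r > 0, ∀ φ ∈ Set.Ioo (-π) π, (r * cos φ, r * sin φ) ∈ A ↔ φ ∈ J) →
    volume (Metric.ball (0 : Euc 3) ε ∩ {x | (x 0, x 1) ∈ A}) =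
      G * volume (J ∩ Set.Ioo (-π) π) := by
  refine ⟨∫⁻ t : ℝ, ∫⁻ r in Set.Ioi (0 : ℝ),
    ENNReal.ofReal r * {r : ℝ | r ^ 2 < ε ^ 2 - t ^ 2}.indicator 1 r, fun A J hA hJ h => ?_⟩
  obtain ⟨Φ, hΦ, hΦx⟩ := exists_measurePreserving_euc_three
  have h1 : Metric.ball (0 : Euc 3) ε ∩ {x | (x 0, x 1) ∈ A} =
      Φ ⁻¹' {p | p.2.1 ^ 2 + p.2.2 ^ 2 < ε ^ 2 - p.1 ^ 2 ∧ p.2 ∈ A} := by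
    ext x
    simp only [Set.mem_inter_iff, mem_ball_zero_iff, Set.mem_ofPred_eq, Set.mem_preimage, hΦx]
    refine and_congr_left fun _ => ?_
    rw [EuclideanSpace.norm_eq, Real.sqrt_lt' hε, Fin.sum_univ_three]
    simp only [Real.norm_eq_abs, sq_abs]
    constructor <;> intro h <;> linarith
  have hm : MeasurableSet {p : ℝ × (ℝ × ℝ) | p.2.1 ^ 2 + p.2.2 ^ 2 < ε ^ 2 - p.1 ^ 2 ∧ p.2 ∈ A} :=
    MeasurableSet.ofPred_and (measurableSet_lt (by fun_prop) (by fun_prop)) (measurable_snd hA)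
  rw [h1, hΦ.measure_preimage_equiv, Measure.volume_eq_prod, Measure.prod_apply hm]
  have h2 : ∀ t : ℝ, (Prod.mk t ⁻¹' {p : ℝ × (ℝ × ℝ) | p.2.1 ^ 2 + p.2.2 ^ 2 < ε ^ 2 - p.1 ^ 2 ∧
      p.2 ∈ A}) = {p : ℝ × ℝ | p.1 ^ 2 + p.2 ^ 2 < ε ^ 2 - t ^ 2} ∩ A := fun t => rfl
  simp only [h2, volume_disc_inter_sector _ hA hJ h]
  refine lintegral_mul_const' _ _ ?_
  exact (measure_lt_top_of_subset Set.inter_subset_right (by simp)).ne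

/-- The inequalities read `sin φ ≥ 0` and `sin (φ - ψ) ≥ 0`, that is `ψ ≤ φ < π` on the polar chart.
-/
theorem hasAngle_standard_wedge {ψ : ℝ} (h0 : 0 < ψ) (hπ : ψ < π) :
    HasAngle {x : Euc 3 | 0 ≤ x 1 ∧ 0 ≤ cos ψ * x 1 - sin ψ * x 0} 0 ((π - ψ) / (2 * π)) := by
  refine HasAngle.of_eventually ?_
  filter_upwards [self_mem_nhdsWithin] with ε hε
  obtain ⟨G, hG⟩ := exists_volume_ball_inter_sector ε hε
  have h1 := hG Set.univ Set.univ MeasurableSet.univ MeasurableSet.univ (by simp)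
  have h2 := hG {p | 0 ≤ p.2 ∧ 0 ≤ cos ψ * p.2 - sin ψ * p.1} (Set.Ico ψ π)
    (MeasurableSet.ofPred_and (measurableSet_le (by fun_prop) (by fun_prop))
      (measurableSet_le (by fun_prop) (by fun_prop))) measurableSet_Ico (by
      intro r hr φ hφ
      have e : cos ψ * (r * sin φ) - sin ψ * (r * cos φ) = r * sin (φ - ψ) := by
        rw [sin_sub]; ring
      simp only [Set.mem_ofPred_eq, Set.mem_Ico, e, mul_nonneg_iff_of_pos_left hr]
      constructor
      · rintro ⟨a, b⟩
        refine ⟨?_, hφ.2⟩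
        by_contra hlt
        push Not at hlt
        have hφ0 : 0 ≤ φ := by
          by_contra hneg
          push Not at hneg
          exact absurd (sin_neg_of_neg_of_neg_pi_lt hneg hφ.1) (not_lt.2 a)
        exact absurd (sin_neg_of_neg_of_neg_pi_lt (by linarith) (by linarith)) (not_lt.2 b)
      · rintro ⟨a, b⟩
        exact ⟨sin_nonneg_of_nonneg_of_le_pi (by linarith) (by linarith),
          sin_nonneg_of_nonneg_of_le_pi (by linarith) (by linarith)⟩)
  have hJ : Set.Ico ψ π ∩ Set.Ioo (-π) π = Set.Ico ψ π :=
    Set.inter_eq_left.2 fun t ht => ⟨by linarith [ht.1, pi_pos], ht.2⟩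
  simp only [Set.mem_univ, Set.ofPred_true, Set.inter_univ, Set.univ_inter, volume_Ioo] at h1
  rw [hJ, volume_Ico] at h2
  have hpos := volume_real_ball_pos (0 : Euc 3) hε
  unfold ballRatio
  have h1' : volume.real (Metric.ball (0 : Euc 3) ε) = G.toReal * (2 * π) := by
    rw [Measure.real, h1, ENNReal.toReal_mul, ENNReal.toReal_ofReal (by linarith)]; ring
  have h2' : volume.real (Metric.ball (0 : Euc 3) ε ∩
      {x : Euc 3 | 0 ≤ x 1 ∧ 0 ≤ cos ψ * x 1 - sin ψ * x 0}) = G.toReal * (π - ψ) := by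
    rw [Measure.real, show {x : Euc 3 | 0 ≤ x 1 ∧ 0 ≤ cos ψ * x 1 - sin ψ * x 0} =
      {x : Euc 3 | (x 0, x 1) ∈ {p : ℝ × ℝ | 0 ≤ p.2 ∧ 0 ≤ cos ψ * p.2 - sin ψ * p.1}} from rfl,
      h2, ENNReal.toReal_mul, ENNReal.toReal_ofReal (by linarith)]
  rw [h1'] at hpos ⊢
  rw [h2']
  have : G.toReal ≠ 0 := by
    rintro h; rw [h] at hpos; simp at hpos
  rw [mul_div_mul_left _ _ this]

/-- The solid angle of a wedge is its dihedral angle over `2π`. -/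
theorem hasAngle_wedge {m n : Euc 3} (hm : m ≠ 0) (hn : n ≠ 0)
    (h0 : 0 < InnerProductGeometry.angle m n) (hπ : InnerProductGeometry.angle m n < π) :
    HasAngle {x : Euc 3 | 0 ≤ ⟪m, x⟫ ∧ 0 ≤ ⟪n, x⟫} 0
      ((π - InnerProductGeometry.angle m n) / (2 * π)) := by
  set ψ := InnerProductGeometry.angle m n with hψ
  have hs : 0 < sin ψ := sin_pos_of_pos_of_lt_pi h0 hπ
  have hm' : 0 < ‖m‖ := norm_pos_iff.2 hm
  have hn' : 0 < ‖n‖ := norm_pos_iff.2 hn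
  have hc : ⟪m, n⟫ = cos ψ * (‖m‖ * ‖n‖) := (InnerProductGeometry.cos_angle_mul_norm_mul_norm m n).symm
  -- In the orthonormal pair `v`, `u` the normals become `m / ‖m‖ = u` and `n / ‖n‖ = cos ψ u - sin
  -- ψ v`. With `v` and `u` as axes 0 and 1 this is the standard wedge.
  obtain ⟨u, hu⟩ : ∃ u : Euc 3, u = ‖m‖⁻¹ • m := ⟨_, rfl⟩
  obtain ⟨v, hv⟩ : ∃ v : Euc 3, v = (sin ψ)⁻¹ • (cos ψ • u - ‖n‖⁻¹ • n) := ⟨_, rfl⟩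
  have huu : ⟪u, u⟫ = 1 := by
    rw [hu, real_inner_smul_left, real_inner_smul_right, real_inner_self_eq_norm_sq]; field_simp
  have hun : ⟪u, n⟫ = cos ψ * ‖n‖ := by
    rw [hu, real_inner_smul_left, hc]; field_simp
  have hvx : ∀ x, ⟪v, x⟫ = (sin ψ)⁻¹ * (cos ψ * ⟪u, x⟫ - ‖n‖⁻¹ * ⟪n, x⟫) := fun x => by
    rw [hv, real_inner_smul_left, inner_sub_left, real_inner_smul_left, real_inner_smul_left]
  have hvu : ⟪v, u⟫ = 0 := by
    rw [hvx, huu, real_inner_comm, hun]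
    field_simp; ring
  have hvv : ⟪v, v⟫ = 1 := by
    rw [hvx, real_inner_comm, hvu, real_inner_comm, hvx, hun, real_inner_self_eq_norm_sq]
    field_simp
    nlinarith [sin_sq_add_cos_sq ψ]
  have hon : Orthonormal ℝ (({0, 1} : Set (Fin 3)).domRestrict ![v, u, 0]) := by
    have h1 : ‖v‖ = 1 := by rw [← sq_eq_sq₀ (norm_nonneg _) one_pos.le, ← real_inner_self_eq_norm_sq, hvv, one_pow]
    have h2 : ‖u‖ = 1 := by rw [← sq_eq_sq₀ (norm_nonneg _) one_pos.le, ← real_inner_self_eq_norm_sq, huu, one_pow]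
    constructor
    · rintro ⟨i, hi⟩
      rcases hi with hi | hi <;> subst hi <;> simpa
    · rintro ⟨i, hi⟩ ⟨j, hj⟩ hij
      rcases hi with hi | hi <;> rcases hj with hj | hj <;> subst hi <;> subst hj
      · exact absurd rfl hij
      · exact hvu
      · exact (real_inner_comm _ _).trans hvu
      · exact absurd rfl hij
  obtain ⟨b, hb⟩ := hon.exists_orthonormalBasis_extension_of_card_eq (by simp)
  have hb0 : b 0 = v := by simpa using hb 0 (by simp)
  have hb1 : b 1 = u := by simpa using hb 1 (by simp)
  have key := (hasAngle_standard_wedge h0 hπ).image_isometryEquiv b.repr.symm.toIsometryEquiv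
  have hz : b.repr.symm.toIsometryEquiv 0 = 0 := map_zero b.repr.symm
  rw [hz] at key
  refine key.congr_ball one_pos fun y _ => ?_
  have hy0 : b.repr y 0 = ⟪v, y⟫ := by rw [b.repr_apply_apply, hb0]
  have hy1 : b.repr y 1 = ⟪u, y⟫ := by rw [b.repr_apply_apply, hb1]
  have e1 : ⟪m, y⟫ = ‖m‖ * ⟪u, y⟫ := by
    rw [hu, real_inner_smul_left]; field_simp
  have e2 : ⟪n, y⟫ = ‖n‖ * (cos ψ * ⟪u, y⟫ - sin ψ * ⟪v, y⟫) := by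
    rw [hvx]
    field_simp; ring
  rw [Set.mem_ofPred_eq, e1, e2, mul_nonneg_iff_of_pos_left hm', mul_nonneg_iff_of_pos_left hn',
    ← hy0, ← hy1]
  constructor
  · rintro ⟨z, hz, rfl⟩
    have : b.repr (b.repr.symm.toIsometryEquiv z) = z := b.repr.apply_symm_apply z
    rw [this]; exact hz
  · intro h
    exact ⟨b.repr y, h, b.repr.symm_apply_apply y⟩

end Wedge

theorem volume_hyperplane_eq_zero {d : ℕ} {n : Euc d} (hn : n ≠ 0) (c : ℝ) :
    volume {x : Euc d | ⟪n, x⟫ = c} = 0 := by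
  by_cases hne : ∃ x₀ : Euc d, ⟪n, x₀⟫ = c
  · obtain ⟨x₀, hx₀⟩ := hne
    have h1 : {x : Euc d | ⟪n, x⟫ = c} = (fun x => x - x₀) ⁻¹' ((LinearMap.ker (innerₛₗ ℝ n) :
        Submodule ℝ (Euc d)) : Set (Euc d)) := by
      ext x
      simp [inner_sub_right, hx₀, sub_eq_zero]
    rw [h1, (measurePreserving_sub_right volume x₀).measure_preimage
      (Submodule.closed_of_finiteDimensional _).measurableSet.nullMeasurableSet]
    refine Measure.addHaar_submodule _ _ fun htop => hn ?_
    have : n ∈ (LinearMap.ker (innerₛₗ ℝ n)) := htop ▸ Submodule.mem_top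
    simpa using this
  · have : {x : Euc d | ⟪n, x⟫ = c} = ∅ := by
      ext x; simp only [Set.mem_ofPred_eq, Set.mem_empty_iff_false, iff_false]
      exact fun h => hne ⟨x, h⟩
    rw [this, measure_empty]

theorem ae_inner_ne {d : ℕ} {n : Euc d} (hn : n ≠ 0) (c : ℝ) : ∀ᵐ x : Euc d, ⟪n, x⟫ ≠ c := by
  rw [ae_iff]
  simpa using volume_hyperplane_eq_zero hn c

theorem isClosed_halfSpace {d : ℕ} (n : Euc d) (c : ℝ) : IsClosed {x : Euc d | 0 ≤ ⟪n, x⟫ + c} :=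
  isClosed_le continuous_const (by fun_prop)

theorem convex_halfSpace {d : ℕ} (n : Euc d) (c : ℝ) : Convex ℝ {x : Euc d | 0 ≤ ⟪n, x⟫ + c} := by
  intro x hx y hy a b ha hb hab
  simp only [Set.mem_ofPred_eq] at *
  rw [inner_add_right, real_inner_smul_right, real_inner_smul_right]
  have : c = a * c + b * c := by rw [← add_mul, hab, one_mul]
  nlinarith [mul_nonneg ha hx, mul_nonneg hb hy]

/-- The half-space and its reflection have equal angles and cover almost every point once. -/
theorem hasAngle_halfSpace {d : ℕ} {n : Euc d} (hn : n ≠ 0) :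
    HasAngle {x : Euc d | 0 ≤ ⟪n, x⟫} 0 (1 / 2) := by
  have hc : IsClosed {x : Euc d | 0 ≤ ⟪n, x⟫} := by simpa using isClosed_halfSpace n 0
  have h1 := Convex.hasAngle_solidAngle (by simpa using convex_halfSpace n 0) hc 0
  have h2 := h1.neg
  rw [neg_zero] at h2
  have h3 := sum_mul_hasAngle_eq (x := (0 : Euc d)) (Finset.univ : Finset Bool)
    (fun b => bif b then {x : Euc d | 0 ≤ ⟪n, x⟫} else -{x : Euc d | 0 ≤ ⟪n, x⟫}) (fun _ => 1)
    (fun _ => solidAngle {x : Euc d | 0 ≤ ⟪n, x⟫} 0) 1 one_pos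
    (by rintro (_ | _) _; exacts [hc.measurableSet.neg, hc.measurableSet])
    (by rintro (_ | _) _; exacts [h2, h1])
    (by
      filter_upwards [ae_inner_ne hn 0] with y hy _
      rcases lt_or_gt_of_ne hy with h | h
      · simp [h.le, not_le.2 h]
      · simp [h.le, not_le.2 h])
  simp only [Finset.sum_const, one_mul, Finset.card_univ, Fintype.card_bool,
    nsmul_eq_mul] at h3
  convert h1 using 1
  push_cast at h3
  linarith

/-! ### The Dehn functional of a multitiler vanishes -/

section Averaging

variable {d : ℕ} {A : Set (Euc d)} {ι : Type*} {g : ι → Euc d ≃ᵢ Euc d} {k : ℕ}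

theorem sum_indicator_eq_ncard (J : Finset ι) (F : ι → Set (Euc d)) (x : Euc d) :
    ∑ i ∈ J, (F i).indicator (1 : Euc d → ℝ) x = ({i | i ∈ J ∧ x ∈ F i} : Set ι).ncard := by
  classical
  have : ({i | i ∈ J ∧ x ∈ F i} : Set ι) = (J.filter fun i => x ∈ F i : Finset ι) := by
    ext i; simp
  rw [this, Set.ncard_coe_finset, Finset.card_filter]
  push_cast
  exact Finset.sum_congr rfl fun i _ => by simp [Set.indicator_apply]

theorem measurableSet_image_isometryEquiv (hm : MeasurableSet A) (g : Euc d ≃ᵢ Euc d) :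
    MeasurableSet (g '' A) :=
  g.toHomeomorph.measurableEmbedding.measurableSet_image.2 hm

theorem setIntegral_sum_indicator (hm : MeasurableSet A) (hA : volume A ≠ ⊤) (J : Finset ι)
    (B : Set (Euc d)) :
    ∫ x in B, ∑ i ∈ J, (g i '' A).indicator (1 : Euc d → ℝ) x =
      ∑ i ∈ J, volume.real (g i '' A ∩ B) := by
  rw [integral_finsetSum]
  · refine Finset.sum_congr rfl fun i _ => ?_
    have hi := measurableSet_image_isometryEquiv hm (g i)
    rw [integral_indicator_one hi, measureReal_restrict_apply hi]
  · intro i _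
    refine Integrable.integrableOn ?_
    rw [integrable_indicator_iff (measurableSet_image_isometryEquiv hm (g i))]
    exact integrableOn_const (by rwa [volume_image_isometryEquiv])

/-- Packing bound: almost every point of the ball is covered at most `k` times. It yields local
finiteness of the family. -/
theorem card_mul_volume_le (hm : MeasurableSet A) (hA : volume A ≠ ⊤)
    (hg : ∀ᵐ x : Euc d, {i | x ∈ g i '' A}.encard = k) {r : ℝ} (J : Finset ι)
    (hJ : ∀ i ∈ J, g i '' A ⊆ Metric.ball 0 r) :
    J.card * volume.real A ≤ k * volume.real (Metric.ball (0 : Euc d) r) := by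
  have h1 := setIntegral_sum_indicator (g := g) hm hA J (Metric.ball 0 r)
  have h2 : ∑ i ∈ J, volume.real (g i '' A ∩ Metric.ball 0 r) = J.card * volume.real A := by
    rw [Finset.sum_congr rfl fun i hi => by
      rw [Set.inter_eq_left.2 (hJ i hi), Measure.real, volume_image_isometryEquiv]]
    simp [Measure.real]
  have hi : IntegrableOn (fun _ : Euc d => (k : ℝ)) (Metric.ball (0 : Euc d) r) volume :=
    integrableOn_const measure_ball_lt_top.ne
  rw [← h2, ← h1]
  have h3 : ∫ _x in Metric.ball (0 : Euc d) r, (k : ℝ) = k * volume.real (Metric.ball (0 : Euc d) r) := by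
    simp [mul_comm]
  rw [← h3]
  refine integral_mono_of_nonneg (Eventually.of_forall fun x => ?_) hi ?_
  · exact Finset.sum_nonneg fun i _ => Set.indicator_nonneg (fun _ _ => zero_le_one) _
  · refine ae_restrict_of_ae ?_
    filter_upwards [hg] with x hx
    rw [sum_indicator_eq_ncard]
    have hfin : {i | x ∈ g i '' A}.Finite := Set.finite_of_encard_eq_coe hx
    have : ({i | i ∈ J ∧ x ∈ g i '' A} : Set ι).ncard ≤ {i | x ∈ g i '' A}.ncard :=
      Set.ncard_le_ncard (fun i hi => hi.2) hfin
    have h4 : {i | x ∈ g i '' A}.ncard = k := by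
      rw [Set.ncard, hx]; rfl
    rw [h4] at this
    exact_mod_cast this

/-- Covering counterpart: with the packing bound, the number of copies near a ball of large radius
`R` is of order `R ^ d`. -/
theorem le_card_mul_volume (hm : MeasurableSet A) (hA : volume A ≠ ⊤)
    (hg : ∀ᵐ x : Euc d, {i | x ∈ g i '' A}.encard = k) {r : ℝ} (J : Finset ι)
    (hJ : ∀ i, (g i '' A ∩ Metric.ball 0 r).Nonempty → i ∈ J) :
    k * volume.real (Metric.ball (0 : Euc d) r) ≤ J.card * volume.real A := by
  have h1 := setIntegral_sum_indicator (g := g) hm hA J (Metric.ball 0 r)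
  have h2 : ∑ i ∈ J, volume.real (g i '' A ∩ Metric.ball 0 r) ≤ J.card * volume.real A := by
    have : ∀ i ∈ J, volume.real (g i '' A ∩ Metric.ball 0 r) ≤ volume.real A := fun i _ => by
      rw [show volume.real A = volume.real (g i '' A) by
        rw [Measure.real, Measure.real, volume_image_isometryEquiv]]
      exact measureReal_mono Set.inter_subset_left (by rwa [volume_image_isometryEquiv])
    simpa using Finset.sum_le_sum this
  refine le_trans (le_of_eq ?_) h2
  rw [← h1, setIntegral_congr_ae (g := fun _ => (k : ℝ)) measurableSet_ball]
  · simp [mul_comm]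
  · filter_upwards [hg] with x hx hxr
    rw [sum_indicator_eq_ncard]
    have : ({i | i ∈ J ∧ x ∈ g i '' A} : Set ι) = {i | x ∈ g i '' A} := by
      ext i; exact ⟨fun h => h.2, fun h => ⟨hJ i ⟨x, h, hxr⟩, h⟩⟩
    rw [this, Set.ncard, hx]; rfl

/-- A linear function on the reals which kills `1`, applied to the solid angle and integrated with
respect to the length, gives zero for every set whose congruent copies multitile the space. -/
theorem integral_angle_eq_zero_of_tiling (hm : MeasurableSet A) (hb : Bornology.IsBounded A)
    (hv : volume A ≠ 0) {w : Euc d → ℝ} (hw : ∀ x, HasAngle A x (w x)) (f : ℝ →ₗ[ℚ] ℚ)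
    (hf : f 1 = 0) (hint : Integrable (fun x => (f (w x) : ℝ)) (μH[1] : Measure (Euc d)))
    (hk : 1 ≤ k) (hg : ∀ᵐ x : Euc d, {i | x ∈ g i '' A}.encard = k) :
    ∫ x, (f (w x) : ℝ) ∂(μH[1] : Measure (Euc d)) = 0 := by
  classical
  have hA : volume A ≠ ⊤ := hb.measure_lt_top.ne
  have hvpos : 0 < volume.real A := ENNReal.toReal_pos hv hA
  obtain ⟨a, ha⟩ : A.Nonempty := nonempty_of_measure_ne_zero hv
  obtain ⟨δ, hδ⟩ := hb.closure.subset_ball a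
  have hδ0 : 0 < δ := Metric.pos_of_mem_ball (hδ (subset_closure ha))
  have hδA : ∀ i, ∀ x ∈ g i '' A, dist x (g i a) < δ := by
    rintro i _ ⟨y, hy, rfl⟩
    rw [(g i).dist_eq]; exact hδ (subset_closure hy)
  have hsub : ∀ R : ℝ, ∀ i, dist (g i a) 0 ≤ R → g i '' A ⊆ Metric.ball 0 (R + δ) :=
    fun R i hi x hx => by
      have := dist_triangle x (g i a) 0
      have := hδA i x hx
      rw [Metric.mem_ball]; linarith
  -- Too many base points `g i a` within distance `R` would violate the packing bound in radius `R +
  -- δ`.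
  have hfin : ∀ R : ℝ, {i | dist (g i a) 0 ≤ R}.Finite := by
    intro R
    by_contra hinf
    obtain ⟨n, hn⟩ := exists_nat_gt (k * volume.real (Metric.ball (0 : Euc d) (R + δ)) / volume.real A)
    obtain ⟨J, hJ, hJn⟩ := Set.Infinite.exists_subset_card_eq hinf n
    have := card_mul_volume_le hm hA hg J fun i hi => hsub R i (hJ hi)
    rw [hJn, ← le_div_iff₀ hvpos] at this
    linarith
  set I : ℝ → Finset ι := fun R => (hfin R).toFinset with hI
  have hImem : ∀ R i, i ∈ I R ↔ dist (g i a) 0 ≤ R := fun R i => by simp [hI]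
  have hhit : ∀ R : ℝ, ∀ i, (g i '' A ∩ Metric.ball 0 R).Nonempty → i ∈ I (R + δ) := by
    rintro R i ⟨x, hx, hxR⟩
    rw [hImem]
    have := dist_triangle_left (g i a) 0 x
    have := hδA i x hx
    rw [Metric.mem_ball] at hxR
    linarith
  have hwi : ∀ i x, HasAngle (g i '' A) x (w ((g i).symm x)) := fun i x => by
    simpa using (hw ((g i).symm x)).image_isometryEquiv (g i)
  set h : Euc d → ℝ := fun x => (f (w x) : ℝ) with hh
  have hsupp : ∀ x, h x ≠ 0 → dist x a < δ := by
    intro x hx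
    by_contra hlt
    refine hx ?_
    have : w x = 0 := (hw x).unique
      (hasAngle_of_notMem_closure fun hmem => hlt (hδ hmem))
    simp [hh, this]
  -- The angles at `x` add up to `k`, and `f k = 0`. In the index, `1` makes room for the unit ball
  -- around `x` and `δ` for the extent of a copy.
  have hzero : ∀ R : ℝ, ∀ x : Euc d, ‖x‖ ≤ R → ∑ i ∈ I (R + 1 + δ), h ((g i).symm x) = 0 := by
    intro R x hx
    have h1 := sum_mul_hasAngle_eq (x := x) (I (R + 1 + δ)) (fun i => g i '' A) (fun _ => 1)
      (fun i => w ((g i).symm x)) k one_pos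
      (fun i _ => measurableSet_image_isometryEquiv hm (g i)) (fun i _ => hwi i x)
      (by
        filter_upwards [hg] with y hy hyx
        simp only [one_mul]
        rw [sum_indicator_eq_ncard]
        have : ({i | i ∈ I (R + 1 + δ) ∧ y ∈ g i '' A} : Set ι) = {i | y ∈ g i '' A} := by
          ext i
          refine ⟨fun h => h.2, fun h => ⟨hhit (R + 1) i ⟨y, h, ?_⟩, h⟩⟩
          rw [mem_ball_zero_iff]
          rw [mem_ball_iff_norm] at hyx
          have := norm_le_norm_add_norm_sub x y
          rw [norm_sub_rev] at this
          linarith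
        rw [this, Set.ncard, hy]; rfl)
    simp only [one_mul] at h1
    have h2 : f (∑ i ∈ I (R + 1 + δ), w ((g i).symm x)) = 0 := by
      rw [h1, show (k : ℝ) = k • (1 : ℝ) by simp, map_nsmul, hf, smul_zero]
    rw [map_sum] at h2
    simp only [hh]
    exact_mod_cast h2
  set D : ℝ := ∫ x, h x ∂(μH[1] : Measure (Euc d)) with hD
  set M : ℝ := ∫ x, |h x| ∂(μH[1] : Measure (Euc d)) with hM
  have hM0 : 0 ≤ M := integral_nonneg fun x => abs_nonneg _
  -- the estimate with a cut-off function at distance `R`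
  have hest : ∀ R : ℝ, 0 < R →
      (I (R / 2)).card * |D| ≤ 2 * ((I (R + 1 + δ)).card * (δ / R * M)) := by
    intro R hR
    -- This cut-off is `1 / R`-Lipschitz. On a copy it differs from its value at `g i a` by at most
    -- `δ / R`, so no separate treatment of the copies meeting the boundary sphere is needed.
    set φ : Euc d → ℝ := fun x => max 0 (1 - ‖x‖ / R) with hφ
    have hφc : Continuous φ := by fun_prop
    have hφ0 : ∀ x, 0 ≤ φ x := fun x => le_max_left _ _
    have hφ1 : ∀ x, φ x ≤ 1 := fun x => max_le zero_le_one (by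
      have : 0 ≤ ‖x‖ / R := by positivity
      linarith)
    have hφL : ∀ x y, |φ x - φ y| ≤ dist x y / R := by
      intro x y
      refine (abs_max_sub_max_le_max 0 (1 - ‖x‖ / R) 0 (1 - ‖y‖ / R)).trans (max_le ?_ ?_)
      · rw [sub_self, abs_zero]; positivity
      · rw [show (1 - ‖x‖ / R) - (1 - ‖y‖ / R) = (‖y‖ - ‖x‖) / R by ring, abs_div, abs_of_pos hR,
          dist_comm, dist_eq_norm]
        gcongr
        exact abs_norm_sub_norm_le _ _
    have hintg : ∀ i, Integrable (fun y => φ (g i y) * h y) (μH[1] : Measure (Euc d)) := by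
      intro i
      refine hint.bdd_mul (c := 1) (hφc.comp (g i).continuous).aestronglyMeasurable
        (Eventually.of_forall fun y => ?_)
      rw [Real.norm_eq_abs, abs_of_nonneg (hφ0 _)]; exact hφ1 _
    have hchange : ∀ i, ∫ x, φ x * h ((g i).symm x) ∂(μH[1] : Measure (Euc d)) =
        ∫ y, φ (g i y) * h y ∂(μH[1] : Measure (Euc d)) := by
      intro i
      have := ((g i).measurePreserving_hausdorffMeasure 1).integral_comp
        (g i).toHomeomorph.measurableEmbedding (fun x => φ x * h ((g i).symm x))
      simpa using this.symm
    have hintg' : ∀ i, Integrable (fun x => φ x * h ((g i).symm x)) (μH[1] : Measure (Euc d)) := by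
      intro i
      have := ((g i).measurePreserving_hausdorffMeasure 1).integrable_comp_emb
        (g i).toHomeomorph.measurableEmbedding (g := fun x => φ x * h ((g i).symm x))
      refine this.1 ((hintg i).congr (Eventually.of_forall fun y => ?_))
      simp
    have hsum : ∑ i ∈ I (R + 1 + δ), ∫ y, φ (g i y) * h y ∂(μH[1] : Measure (Euc d)) = 0 := by
      rw [← Finset.sum_congr rfl fun i _ => hchange i, ← integral_finsetSum _ fun i _ => hintg' i]
      rw [integral_congr_ae (g := fun _ => 0), integral_zero]
      refine Eventually.of_forall fun x => ?_
      simp only [← Finset.mul_sum]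
      by_cases hx : ‖x‖ ≤ R
      · rw [hzero R x hx, mul_zero]
      · have : φ x = 0 := max_eq_left (by
          rw [sub_nonpos, one_le_div hR]; linarith)
        rw [this, zero_mul]
    have hdiff : ∀ i, |φ (g i a) * D - ∫ y, φ (g i y) * h y ∂(μH[1] : Measure (Euc d))| ≤
        δ / R * M := by
      intro i
      rw [hD, ← integral_const_mul, ← integral_sub (hint.const_mul _) (hintg i), hM,
        ← integral_const_mul]
      refine (abs_integral_le_integral_abs).trans
        (integral_mono_of_nonneg (Eventually.of_forall fun _ => abs_nonneg _)
          (hint.abs.const_mul _) (Eventually.of_forall fun y => ?_))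
      simp only [← sub_mul, abs_mul]
      by_cases hy : h y = 0
      · simp [hy]
      · refine mul_le_mul_of_nonneg_right ((hφL _ _).trans ?_) (abs_nonneg _)
        rw [(g i).dist_eq, dist_comm]
        exact div_le_div_of_nonneg_right (hsupp y hy).le hR.le
    have hupper : (∑ i ∈ I (R + 1 + δ), φ (g i a)) * |D| ≤ (I (R + 1 + δ)).card * (δ / R * M) := by
      have e1 : (∑ i ∈ I (R + 1 + δ), φ (g i a)) * D = ∑ i ∈ I (R + 1 + δ),
          (φ (g i a) * D - ∫ y, φ (g i y) * h y ∂(μH[1] : Measure (Euc d))) := by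
        rw [Finset.sum_sub_distrib, hsum, sub_zero, Finset.sum_mul]
      rw [← abs_of_nonneg (Finset.sum_nonneg fun i (_ : i ∈ I (R + 1 + δ)) => hφ0 (g i a)),
        ← abs_mul, e1]
      refine (Finset.abs_sum_le_sum_abs _ _).trans ?_
      simpa using Finset.sum_le_sum fun i (_ : i ∈ I (R + 1 + δ)) => hdiff i
    have hlower : ((I (R / 2)).card : ℝ) / 2 ≤ ∑ i ∈ I (R + 1 + δ), φ (g i a) := by
      have hss : I (R / 2) ⊆ I (R + 1 + δ) := fun i hi => by
        rw [hImem] at hi ⊢; linarith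
      refine le_trans ?_ (Finset.sum_le_sum_of_subset_of_nonneg hss fun i _ _ => hφ0 _)
      have : ∀ i ∈ I (R / 2), (1 / 2 : ℝ) ≤ φ (g i a) := by
        intro i hi
        rw [hImem, dist_zero_right] at hi
        refine le_trans ?_ (le_max_right _ _)
        have : ‖g i a‖ / R ≤ 1 / 2 := by
          rw [div_le_iff₀ hR]; linarith
        linarith
      have := Finset.sum_le_sum this
      simp only [Finset.sum_const, nsmul_eq_mul] at this
      linarith
    have := mul_le_mul_of_nonneg_right hlower (abs_nonneg D)
    linarith
  -- comparison of the numbers of copies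
  have hball : ∀ r : ℝ, 0 < r → volume.real (Metric.ball (0 : Euc d) r) =
      r ^ d * volume.real (Metric.ball (0 : Euc d) 1) := by
    intro r hr
    rw [Measure.real, Measure.addHaar_ball_of_pos _ _ hr, ENNReal.toReal_mul,
      ENNReal.toReal_ofReal (by positivity), finrank_euclideanSpace_fin, Measure.real]
  have hc0 := volume_real_ball_pos (0 : Euc d) one_pos
  -- The condition gives `R / 2 - δ ≥ R / 4` and `R + 1 + 2 * δ ≤ 2 * R`. The ratio of the radii `2
  -- * R` and `R / 4` is the `8`; the powers of `R` cancel and the Lipschitz constant leaves `1 /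
  -- R`.
  have hbound : ∀ R : ℝ, 4 * δ + 1 ≤ R → |D| ≤ 2 * 8 ^ d * (δ * M) / R := by
    intro R hR
    have hR0 : 0 < R := by linarith
    have h1 := hest R hR0
    have h2 := le_card_mul_volume hm hA hg (r := R / 2 - δ) (I (R / 2)) fun i hi => by
      simpa using hhit _ i hi
    have h3 := card_mul_volume_le hm hA hg (r := R + 1 + δ + δ) (I (R + 1 + δ))
      fun i hi => hsub _ i ((hImem _ _).1 hi)
    rw [hball _ (by linarith)] at h2 h3
    set c := volume.real (Metric.ball (0 : Euc d) 1)
    set v := volume.real A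
    have hk' : (0 : ℝ) < k := by exact_mod_cast hk
    have h4 : (k : ℝ) * ((R / 4) ^ d * c) ≤ (I (R / 2)).card * v := by
      refine le_trans ?_ h2
      gcongr; linarith
    have h5 : ((I (R + 1 + δ)).card : ℝ) * v ≤ k * ((2 * R) ^ d * c) := by
      refine h3.trans ?_
      gcongr; linarith
    have h6 : (k : ℝ) * ((R / 4) ^ d * c) * |D| ≤
        2 * (k * ((2 * R) ^ d * c)) * (δ / R * M) := by
      calc (k : ℝ) * ((R / 4) ^ d * c) * |D| ≤ (I (R / 2)).card * v * |D| :=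
            mul_le_mul_of_nonneg_right h4 (abs_nonneg _)
        _ = v * ((I (R / 2)).card * |D|) := by ring
        _ ≤ v * (2 * ((I (R + 1 + δ)).card * (δ / R * M))) :=
            mul_le_mul_of_nonneg_left h1 hvpos.le
        _ = 2 * ((I (R + 1 + δ)).card * v) * (δ / R * M) := by ring
        _ ≤ _ := by
            refine mul_le_mul_of_nonneg_right ?_ (by positivity)
            linarith
    have e : (2 * R) ^ d = 8 ^ d * (R / 4) ^ d := by
      rw [← mul_pow]; congr 1; ring
    rw [e] at h6
    have hp : 0 < (k : ℝ) * ((R / 4) ^ d * c) := by positivity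
    refine le_of_mul_le_mul_left (h6.trans (le_of_eq ?_)) hp
    ring
  have hlim : Tendsto (fun R : ℝ => 2 * 8 ^ d * (δ * M) / R) atTop (𝓝 0) :=
    tendsto_const_nhds.div_atTop tendsto_id
  have : |D| ≤ 0 := ge_of_tendsto hlim (by
    filter_upwards [eventually_ge_atTop (4 * δ + 1)] with R hR
    exact hbound R hR)
  exact abs_eq_zero.1 (le_antisymm this (abs_nonneg _))

end Averaging

/-! ### Polyhedra -/

/-- The polyhedron with the inequalities `0 ≤ ⟪n i, x⟫ + c i`. -/
def polyhedron {d : ℕ} {ι : Type*} (n : ι → Euc d) (c : ι → ℝ) : Set (Euc d) :=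
  {x | ∀ i, 0 ≤ ⟪n i, x⟫ + c i}

/-- The cone with the inequalities `0 ≤ ⟪n i, x⟫`, `i ∈ I`. -/
def normalCone {d : ℕ} {ι : Type*} (n : ι → Euc d) (I : Set ι) : Set (Euc d) :=
  {x | ∀ i ∈ I, 0 ≤ ⟪n i, x⟫}

section Polyhedron

variable {d : ℕ} {ι : Type*} (n : ι → Euc d) (c : ι → ℝ)

theorem convex_polyhedron : Convex ℝ (polyhedron n c) := by
  rw [polyhedron, Set.ofPred_forall]
  exact convex_iInter fun i => convex_halfSpace _ _

theorem isClosed_polyhedron : IsClosed (polyhedron n c) := by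
  rw [polyhedron, Set.ofPred_forall]
  exact isClosed_iInter fun i => isClosed_halfSpace _ _

theorem normalCone_eq (I : Set ι) :
    normalCone n I = polyhedron (fun i : I => n i) fun _ => 0 := by
  ext x; simp [normalCone, polyhedron]

theorem hasAngle_normalCone (I : Set ι) :
    HasAngle (normalCone n I) 0 (solidAngle (normalCone n I) 0) := by
  rw [normalCone_eq]
  exact (convex_polyhedron _ _).hasAngle_solidAngle (isClosed_polyhedron _ _) 0

/-- The inactive inequalities are strict near `x`, so locally the set is the cone of the active ones
translated to `x`. -/
theorem hasAngle_polyhedron [Finite ι] {x : Euc d} (hx : x ∈ polyhedron n c) :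
    HasAngle (polyhedron n c) x (solidAngle (normalCone n {i | ⟪n i, x⟫ + c i = 0}) 0) := by
  have h1 := (hasAngle_normalCone n {i | ⟪n i, x⟫ + c i = 0}).image_isometryEquiv
    (IsometryEquiv.addRight x)
  rw [IsometryEquiv.addRight_apply, zero_add] at h1
  have h2 : ∀ᶠ y in 𝓝 x, ∀ i, ⟪n i, x⟫ + c i ≠ 0 → 0 ≤ ⟪n i, y⟫ + c i := by
    refine eventually_all.2 fun i => ?_
    by_cases h : ⟪n i, x⟫ + c i = 0
    · simp [h]
    · have h3 : 0 < ⟪n i, x⟫ + c i := lt_of_le_of_ne (hx i) (Ne.symm h)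
      have h4 : Continuous fun y => ⟪n i, y⟫ + c i := by fun_prop
      filter_upwards [h4.continuousAt.eventually_const_lt h3] with y hy _ using hy.le
  obtain ⟨δ, hδ, hb⟩ := Metric.eventually_nhds_iff_ball.1 h2
  refine h1.congr_ball hδ fun y hy => ?_
  have h3 : y ∈ IsometryEquiv.addRight x '' normalCone n {i | ⟪n i, x⟫ + c i = 0} ↔
      ∀ i, ⟪n i, x⟫ + c i = 0 → 0 ≤ ⟪n i, y⟫ + c i := by
    rw [← IsometryEquiv.coe_toEquiv, Equiv.image_eq_preimage_symm, Set.mem_preimage]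
    simp only [normalCone, Set.mem_ofPred_eq]
    refine forall₂_congr fun i hi => ?_
    have : (IsometryEquiv.addRight x).toEquiv.symm y = y - x := by
      rw [sub_eq_add_neg]; rfl
    rw [this, inner_sub_right]
    constructor <;> intro h <;> linarith
  rw [h3]
  refine ⟨fun h i => ?_, fun h i _ => h i⟩
  by_cases hi : ⟪n i, x⟫ + c i = 0
  · exact h i hi
  · exact hb y hy i hi

theorem solidAngle_polyhedron [Finite ι] {x : Euc d} (hx : x ∈ polyhedron n c) :
    solidAngle (polyhedron n c) x = solidAngle (normalCone n {i | ⟪n i, x⟫ + c i = 0}) 0 :=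
  (hasAngle_polyhedron n c hx).solidAngle_eq

theorem solidAngle_eq_zero_of_notMem {A : Set (Euc d)} (hA : IsClosed A) {x : Euc d} (hx : x ∉ A) :
    solidAngle A x = 0 :=
  (hasAngle_of_notMem_closure (by rwa [hA.closure_eq])).solidAngle_eq

variable {n} in
/-- When the normals are multiples of one vector, the solid angle is `0`, `1 / 2` or `1`. -/
theorem map_solidAngle_normalCone_eq_zero {I : Set ι} {m : Euc d}
    (h : ∀ i ∈ I, ∃ t : ℝ, n i = t • m) (f : ℝ →ₗ[ℚ] ℚ) (hf : f 1 = 0) :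
    f (solidAngle (normalCone n I) 0) = 0 := by
  have hhalf : f (1 / 2) = 0 := by
    have := map_nsmul f 2 (1 / 2 : ℝ)
    norm_num [hf] at this
    simpa using this
  by_cases hm : m = 0
  · have : normalCone n I = Set.univ := by
      ext x
      simp only [normalCone, Set.mem_ofPred_eq, Set.mem_univ, iff_true]
      intro i hi
      obtain ⟨t, ht⟩ := h i hi
      simp [ht, hm]
    rw [this, (hasAngle_univ 0).solidAngle_eq, hf]
  choose! t ht using h
  have hI : normalCone n I = {x | ∀ i ∈ I, 0 ≤ t i * ⟪m, x⟫} := by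
    ext x
    refine forall₂_congr fun i hi => ?_
    rw [ht i hi, real_inner_smul_left]
  by_cases hp : ∃ i ∈ I, 0 < t i
  · obtain ⟨i, hi, hip⟩ := hp
    by_cases hq : ∃ j ∈ I, t j < 0
    · obtain ⟨j, hj, hjn⟩ := hq
      -- Opposite normals confine the cone to a hyperplane, a null set.
      have : HasAngle (normalCone n I) 0 0 := by
        refine (hasAngle_empty 0).congr_ae one_pos ?_
        filter_upwards [ae_inner_ne hm 0] with y hy _
        rw [hI]
        simp only [Set.mem_empty_iff_false, false_iff]
        intro h
        exact hy (le_antisymm (nonpos_of_mul_nonneg_right (h j hj) hjn)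
          (nonneg_of_mul_nonneg_right (h i hi) hip))
      rw [this.solidAngle_eq, map_zero]
    · push Not at hq
      have : normalCone n I = {x | 0 ≤ ⟪m, x⟫} := by
        rw [hI]; ext x
        exact ⟨fun h => nonneg_of_mul_nonneg_right (h i hi) hip, fun h j hj => mul_nonneg (hq j hj) h⟩
      rw [this, (hasAngle_halfSpace hm).solidAngle_eq, hhalf]
  · push Not at hp
    by_cases hq : ∃ j ∈ I, t j < 0
    · obtain ⟨j, hj, hjn⟩ := hq
      have : normalCone n I = {x | 0 ≤ ⟪-m, x⟫} := by
        rw [hI]; ext x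
        rw [Set.mem_ofPred_eq, Set.mem_ofPred_eq, inner_neg_left, neg_nonneg]
        exact ⟨fun h => nonpos_of_mul_nonneg_right (h j hj) hjn,
          fun h i hi => mul_nonneg_of_nonpos_of_nonpos (hp i hi) h⟩
      rw [this, (hasAngle_halfSpace (neg_ne_zero.2 hm)).solidAngle_eq, hhalf]
    · push Not at hq
      have : normalCone n I = Set.univ := by
        rw [hI]; ext x
        simp only [Set.mem_ofPred_eq, Set.mem_univ, iff_true]
        intro i hi
        rw [le_antisymm (hp i hi) (hq i hi), zero_mul]
      rw [this, (hasAngle_univ 0).solidAngle_eq, hf]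

end Polyhedron

/-! ### Integrability of the Dehn density -/

section Edges

variable {ι : Type*}

theorem exists_direction_of_linearIndependent {m n : Euc 3} (h : LinearIndependent ℝ ![m, n]) :
    ∃ u : Euc 3, ∀ y, ⟪m, y⟫ = 0 → ⟪n, y⟫ = 0 → ∃ t : ℝ, y = t • u := by
  have h1 : Module.finrank ℝ (Submodule.span ℝ (Set.range ![m, n])) = 2 := by
    rw [finrank_span_eq_card h]; simp
  have h2 := (Submodule.span ℝ (Set.range ![m, n])).finrank_add_finrank_orthogonal
  rw [h1, finrank_euclideanSpace_fin] at h2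
  have h3 : Module.finrank ℝ (Submodule.span ℝ (Set.range ![m, n]))ᗮ = 1 := by omega
  obtain ⟨u, -, hu⟩ := finrank_eq_one_iff'.1 h3
  refine ⟨u, fun y hm hn => ?_⟩
  have hy : y ∈ (Submodule.span ℝ (Set.range ![m, n]))ᗮ := by
    rw [Submodule.mem_orthogonal]
    intro z hz
    refine Submodule.span_induction (p := fun z _ => ⟪z, y⟫ = 0) ?_ ?_ ?_ ?_ hz
    · rintro _ ⟨i, rfl⟩
      fin_cases i
      exacts [hm, hn]
    · simp
    · intro a b _ _ ha hb; rw [inner_add_left, ha, hb, add_zero]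
    · intro t a _ ha; rw [real_inner_smul_left, ha, mul_zero]
  obtain ⟨t, ht⟩ := hu ⟨y, hy⟩
  exact ⟨t, (congrArg Subtype.val ht).symm⟩

theorem hausdorffMeasure_line_lt_top {T : Set (Euc 3)} (hT : Bornology.IsBounded T) (u : Euc 3)
    (h : ∀ x ∈ T, ∀ y ∈ T, ∃ t : ℝ, y - x = t • u) : μH[1] T < ⊤ := by
  rcases T.eq_empty_or_nonempty with rfl | ⟨x, hx⟩
  · simp
  obtain ⟨R, hR⟩ := hT.subset_ball x
  by_cases hu : u = 0
  · have : T ⊆ {x} := fun y hy => by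
      obtain ⟨t, ht⟩ := h x hx y hy
      rw [hu, smul_zero, sub_eq_zero] at ht
      exact ht
    refine (measure_mono this).trans_lt ?_
    have := Measure.nullSingletonClass_hausdorff (Euc 3) (one_pos : (0 : ℝ) < 1)
    simp
  have hu' : 0 < ‖u‖ := norm_pos_iff.2 hu
  have hsub : T ⊆ segment ℝ (x - (R / ‖u‖) • u) (x + (R / ‖u‖) • u) := by
    intro y hy
    obtain ⟨t, ht⟩ := h x hx y hy
    have hy' := hR hy
    rw [mem_ball_iff_norm, ht, norm_smul, Real.norm_eq_abs, ← lt_div_iff₀ hu', abs_lt] at hy'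
    have hR0 : 0 < R / ‖u‖ := by linarith [hy'.1, hy'.2]
    rw [show y = x + t • u by rw [← ht]; abel]
    refine ⟨(1 - t / (R / ‖u‖)) / 2, (1 + t / (R / ‖u‖)) / 2, ?_, ?_, by ring, ?_⟩
    · have : t / (R / ‖u‖) ≤ 1 := (div_le_one hR0).2 hy'.2.le
      linarith
    · have : -1 ≤ t / (R / ‖u‖) := by rw [le_div_iff₀ hR0]; linarith
      linarith
    · generalize R / ‖u‖ = r at hR0
      match_scalars <;> field_simp <;> ring
  refine (measure_mono hsub).trans_lt ?_
  rw [hausdorffMeasure_segment]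
  exact edist_lt_top _ _

/-- The density of the Dehn functional of a bounded polyhedron is integrable. -/
theorem integrable_map_solidAngle_polyhedron [Finite ι] (n : ι → Euc 3) (c : ι → ℝ)
    (hb : Bornology.IsBounded (polyhedron n c)) (f : ℝ →ₗ[ℚ] ℚ) (hf : f 1 = 0) :
    Integrable (fun x => (f (solidAngle (polyhedron n c) x) : ℝ)) (μH[1] : Measure (Euc 3)) := by
  classical
  have := Fintype.ofFinite ι
  -- Strata by the exact set of active inequalities; the solid angle is constant on each.
  set T : Finset ι → Set (Euc 3) := fun I =>
    {x | x ∈ polyhedron n c ∧ ∀ i, i ∈ I ↔ ⟪n i, x⟫ + c i = 0} with hT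
  have hTm : ∀ I, MeasurableSet (T I) := by
    intro I
    refine MeasurableSet.ofPred_and (isClosed_polyhedron n c).measurableSet ?_
    rw [Set.ofPred_forall]
    refine MeasurableSet.iInter fun i => ?_
    have hm : MeasurableSet {x : Euc 3 | ⟪n i, x⟫ + c i = 0} :=
      (isClosed_eq (by fun_prop) continuous_const).measurableSet
    by_cases hi : i ∈ I
    · simpa [hi] using hm
    · have h2 : {x : Euc 3 | i ∈ I ↔ ⟪n i, x⟫ + c i = 0} = {x : Euc 3 | ⟪n i, x⟫ + c i = 0}ᶜ := by
        ext x; simp [hi]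
      rw [h2]
      exact hm.compl
  have hfun : (fun x => (f (solidAngle (polyhedron n c) x) : ℝ)) = fun x => ∑ I : Finset ι,
      (T I).indicator (fun _ => (f (solidAngle (normalCone n I) 0) : ℝ)) x := by
    funext x
    by_cases hx : x ∈ polyhedron n c
    · rw [Finset.sum_eq_single (Finset.univ.filter fun i => ⟪n i, x⟫ + c i = 0)]
      · rw [Set.indicator_of_mem, solidAngle_polyhedron n c hx]
        · simp
        · exact ⟨hx, by simp⟩
      · intro I _ hI
        refine Set.indicator_of_notMem (fun hxI => hI ?_) _
        ext i
        rw [hxI.2 i]; simp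
      · simp
    · rw [solidAngle_eq_zero_of_notMem (isClosed_polyhedron n c) hx, map_zero, Rat.cast_zero,
        Finset.sum_eq_zero]
      exact fun I _ => Set.indicator_of_notMem (fun hxI => hx hxI.1) _
  rw [hfun]
  refine integrable_finsetSum _ fun I _ => ?_
  by_cases hz : f (solidAngle (normalCone n I) 0) = 0
  · simp [hz]
  rw [integrable_indicator_iff (hTm I)]
  refine integrableOn_const (ne_of_lt ?_)
  -- If `f` does not kill the angle of the stratum, two of its normals are independent. The stratum
  -- is then a bounded part of a line, hence of finite length.
  obtain ⟨i, hi, hi0⟩ : ∃ i ∈ I, n i ≠ 0 := by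
    by_contra! hall
    exact hz (map_solidAngle_normalCone_eq_zero (m := 0) (fun i hi => ⟨0, by
      rw [hall i hi, smul_zero]⟩) f hf)
  obtain ⟨j, hj, hij⟩ : ∃ j ∈ I, ∀ t : ℝ, n j ≠ t • n i := by
    by_contra! hall
    exact hz (map_solidAngle_normalCone_eq_zero (m := n i) hall f hf)
  have hli : LinearIndependent ℝ ![n i, n j] :=
    (LinearIndependent.pair_iff' hi0).2 fun t => (hij t).symm
  obtain ⟨u, hu⟩ := exists_direction_of_linearIndependent hli
  refine hausdorffMeasure_line_lt_top (hb.subset fun x hx => hx.1) u fun x hx y hy => hu _ ?_ ?_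
  · have h1 := (hx.2 i).1 hi
    have h2 := (hy.2 i).1 hi
    rw [inner_sub_right]; linarith
  · have h1 := (hx.2 j).1 hj
    have h2 := (hy.2 j).1 hj
    rw [inner_sub_right]; linarith

end Edges

/-! ### Fourier–Motzkin elimination -/

section Elimination

/-- Each `a j > 0` bounds `t` below by `-b j / a j`, each `a j < 0` bounds it above, and `h1` says
that no lower bound exceeds an upper one. -/
theorem exists_forall_nonneg_mul_add {J : Type*} [Finite J] (a b : J → ℝ)
    (h0 : ∀ j, a j = 0 → 0 ≤ b j)
    (h1 : ∀ j k, 0 < a j → a k < 0 → 0 ≤ a j * b k - a k * b j) :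
    ∃ t : ℝ, ∀ j, 0 ≤ a j * t + b j := by
  set L : Set ℝ := (fun j => -b j / a j) '' {j | 0 < a j}
  set U : Set ℝ := (fun j => -b j / a j) '' {j | a j < 0}
  have hLU : ∀ l ∈ L, ∀ u ∈ U, l ≤ u := by
    rintro _ ⟨j, hj, rfl⟩ _ ⟨k, hk, rfl⟩
    have hj' : 0 < a j := hj
    have hk' : a k < 0 := hk
    have := h1 j k hj hk
    beta_reduce
    rw [show -b k / a k = b k / -a k by rw [div_neg, neg_div],
      div_le_div_iff₀ hj' (neg_pos.2 hk')]
    linarith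
  obtain ⟨t, htL, htU⟩ : ∃ t, (∀ l ∈ L, l ≤ t) ∧ ∀ u ∈ U, t ≤ u := by
    rcases L.eq_empty_or_nonempty with hL | hL
    · obtain ⟨t, ht⟩ := (Set.toFinite U).bddBelow
      exact ⟨t, by simp [hL], fun u hu => ht hu⟩
    · exact ⟨sSup L, fun l hl => le_csSup (Set.toFinite L).bddAbove hl,
        fun u hu => csSup_le hL fun l hl => hLU l hl u hu⟩
  refine ⟨t, fun j => ?_⟩
  rcases lt_trichotomy (a j) 0 with hj | hj | hj
  · have := htU _ ⟨j, hj, rfl⟩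
    beta_reduce at this
    rw [show -b j / a j = b j / -a j by rw [div_neg, neg_div], le_div_iff₀ (neg_pos.2 hj)] at this
    linarith
  · rw [hj]; simpa using h0 j hj
  · have := htL _ ⟨j, hj, rfl⟩
    beta_reduce at this
    rw [div_le_iff₀ hj] at this
    linarith

/-- A finite intersection of half-spaces. -/
def IsPolyhedron {d : ℕ} (S : Set (Euc d)) : Prop :=
  ∃ (ι : Type) (_ : Finite ι) (n : ι → Euc d) (c : ι → ℝ), S = polyhedron n c

variable {d : ℕ} {S : Set (Euc d)}

theorem IsPolyhedron.convex (h : IsPolyhedron S) : Convex ℝ S := by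
  obtain ⟨ι, _, n, c, rfl⟩ := h
  exact convex_polyhedron n c

theorem IsPolyhedron.isClosed (h : IsPolyhedron S) : IsClosed S := by
  obtain ⟨ι, _, n, c, rfl⟩ := h
  exact isClosed_polyhedron n c

theorem IsPolyhedron.hasAngle (h : IsPolyhedron S) (x : Euc d) : HasAngle S x (solidAngle S x) :=
  h.convex.hasAngle_solidAngle h.isClosed x

theorem IsPolyhedron.integrable {S : Set (Euc 3)} (h : IsPolyhedron S)
    (hb : Bornology.IsBounded S) (f : ℝ →ₗ[ℚ] ℚ) (hf : f 1 = 0) :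
    Integrable (fun x => (f (solidAngle S x) : ℝ)) (μH[1] : Measure (Euc 3)) := by
  obtain ⟨ι, _, n, c, rfl⟩ := h
  exact integrable_map_solidAngle_polyhedron n c hb f hf

theorem mem_add_segment_iff {S : Set (Euc d)} {v x : Euc d} :
    x ∈ S + segment ℝ 0 v ↔ ∃ t : ℝ, 0 ≤ t ∧ t ≤ 1 ∧ x - t • v ∈ S := by
  rw [Set.mem_add]
  simp only [segment_eq_image', sub_zero, zero_add, Set.mem_image, Set.mem_Icc]
  constructor
  · rintro ⟨s, hs, _, ⟨t, ht, rfl⟩, rfl⟩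
    exact ⟨t, ht.1, ht.2, by simpa using hs⟩
  · rintro ⟨t, h0, h1, ht⟩
    exact ⟨_, ht, _, ⟨t, ⟨h0, h1⟩, rfl⟩, by simp⟩

/-- The projection of a polyhedron along a line is a polyhedron. -/
theorem isPolyhedron_of_exists {J : Type} [Finite J] (a e : J → ℝ) (m : J → Euc d)
    (h : ∀ x, x ∈ S ↔ ∃ t : ℝ, ∀ j, 0 ≤ a j * t + (⟪m j, x⟫ + e j)) : IsPolyhedron S := by
  refine ⟨{j // a j = 0} ⊕ ({j // 0 < a j} × {k // a k < 0}), inferInstance,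
    Sum.elim (fun j => m j) (fun p => a p.1 • m p.2 - a p.2 • m p.1),
    Sum.elim (fun j => e j) (fun p => a p.1 * e p.2 - a p.2 * e p.1), ?_⟩
  ext x
  rw [h]
  simp only [polyhedron, Set.mem_ofPred_eq, Sum.forall, Sum.elim_inl, Sum.elim_inr, Prod.forall,
    Subtype.forall, inner_sub_left, real_inner_smul_left]
  constructor
  · rintro ⟨t, ht⟩
    refine ⟨fun j hj => by simpa [hj] using ht j, fun j hj k hk => ?_⟩
    have h1 := mul_nonneg hj.le (ht k)
    have h2 := mul_nonneg (neg_nonneg.2 hk.le) (ht j)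
    linarith
  · rintro ⟨h0, h1⟩
    refine exists_forall_nonneg_mul_add a _ h0 fun j k hj hk => ?_
    linarith [h1 j hj k hk]

/-- The parameter `t` is eliminated from `x - t • v ∈ S`, `0 ≤ t ≤ 1`. The index `true` carries `0 ≤
t`, the index `false` carries `t ≤ 1`. -/
theorem IsPolyhedron.add_segment (h : IsPolyhedron S) (v : Euc d) :
    IsPolyhedron (S + segment ℝ 0 v) := by
  obtain ⟨ι, _, n, c, rfl⟩ := h
  refine isPolyhedron_of_exists (J := ι ⊕ Bool)
    (Sum.elim (fun i => -⟪n i, v⟫) fun b => bif b then 1 else -1)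
    (Sum.elim c fun b => bif b then 0 else 1) (Sum.elim n fun _ => 0) fun x => ?_
  rw [mem_add_segment_iff]
  refine exists_congr fun t => ?_
  simp only [Sum.forall, Bool.forall_bool, Sum.elim_inl, Sum.elim_inr, cond_true,
    cond_false, inner_zero_left, polyhedron, Set.mem_ofPred_eq, inner_sub_right,
    real_inner_smul_right]
  constructor
  · rintro ⟨h0, h1, h2⟩
    exact ⟨fun i => by linarith [h2 i], by linarith, by linarith⟩
  · rintro ⟨h2, h1, h0⟩
    exact ⟨by linarith, by linarith, fun i => by linarith [h2 i]⟩

end Elimination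

/-! ### Sums of solid angles over the integer lattice -/

/-- Each coset of the image of `φ` contributes `1`. The sum of ones is the index; its value is never
needed, since it only serves to compare two sums. -/
theorem tsum_eq_tsum_quotient {G K : Type*} [AddCommGroup G] [AddCommGroup K] (φ : K →+ G)
    (hφ : Function.Injective φ) (h : G → ℝ≥0∞) (hh : ∀ r, ∑' k, h (r + φ k) = 1) :
    ∑' z, h z = ∑' _ : G ⧸ φ.range, 1 := by
  have hb : Function.Bijective fun p : (G ⧸ φ.range) × K => Quotient.out p.1 + φ p.2 := by
    constructor
    · rintro ⟨q, k⟩ ⟨q', k'⟩ hqk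
      have hqk' : Quotient.out q + φ k = Quotient.out q' + φ k' := hqk
      have hq : q = q' := by
        rw [← QuotientAddGroup.out_eq' q, ← QuotientAddGroup.out_eq' q', QuotientAddGroup.eq]
        refine ⟨k - k', ?_⟩
        rw [map_sub, neg_add_eq_sub, sub_eq_sub_iff_add_eq_add, add_comm, hqk', add_comm]
      subst hq
      exact Prod.ext rfl (hφ (add_left_cancel hqk'))
    · intro z
      have h1 : ((Quotient.out (z : G ⧸ φ.range) : G) : G ⧸ φ.range) = (z : G ⧸ φ.range) :=
        QuotientAddGroup.out_eq' _
      rw [QuotientAddGroup.eq] at h1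
      obtain ⟨k, hk⟩ := h1
      exact ⟨((z : G ⧸ φ.range), k), by simp only [hk]; abel⟩
  rw [← (Equiv.ofBijective _ hb).tsum_eq, ENNReal.tsum_prod']
  exact tsum_congr fun q => hh (Quotient.out q)

/-- The integer lattice as a group. -/
abbrev latticeGroup (d : ℕ) : AddSubgroup (Euc d) :=
  (Submodule.span ℤ (Set.range (EuclideanSpace.basisFun (Fin d) ℝ).toBasis)).toAddSubgroup

theorem mem_latticeGroup {d : ℕ} {x : Euc d} : x ∈ latticeGroup d ↔ x ∈ integerLattice d := by
  rw [latticeGroup, Submodule.mem_toAddSubgroup, Module.Basis.mem_span_iff_repr_mem]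
  refine forall_congr' fun i => ?_
  simp [eq_comm]

theorem tsum_lintegral_lattice {d : ℕ} {f : Euc d → ℝ≥0∞} (hf : Measurable f) :
    ∫⁻ x, f x = ∫⁻ x in ZSpan.fundamentalDomain (EuclideanSpace.basisFun (Fin d) ℝ).toBasis,
      ∑' z : latticeGroup d, f (z + x) := by
  have h := ZSpan.isAddFundamentalDomain' (EuclideanSpace.basisFun (Fin d) ℝ).toBasis
    (volume : Measure (Euc d))
  have : Countable (latticeGroup d) :=
    inferInstanceAs (Countable (Submodule.span ℤ (Set.range (EuclideanSpace.basisFun (Fin d) ℝ).toBasis)))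
  rw [h.lintegral_eq_tsum'', ← lintegral_tsum]
  · rfl
  · exact fun z => (hf.comp (measurable_const_add _)).aemeasurable

theorem volume_fundamentalDomain_basisFun (d : ℕ) :
    volume (ZSpan.fundamentalDomain (EuclideanSpace.basisFun (Fin d) ℝ).toBasis) = 1 := by
  have h := measure_congr (ZSpan.fundamentalDomain_ae_parallelepiped
    (EuclideanSpace.basisFun (Fin d) ℝ).toBasis (volume : Measure (Euc d)))
  rw [h, OrthonormalBasis.coe_toBasis]
  exact OrthonormalBasis.volume_parallelepiped _

/-! ### Angle sums in a multitiling -/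

section Tiling

variable {d : ℕ} {A : Set (Euc d)} {ι : Type*} {g : ι → Euc d ≃ᵢ Euc d} {k : ℕ}

/-- The solid angles of the copies of a multitiler at any point add up to the multiplicity. -/
theorem tsum_angle_of_tiling (hm : MeasurableSet A) (hb : Bornology.IsBounded A)
    (hv : volume A ≠ 0) {w : Euc d → ℝ} (hw : ∀ x, HasAngle A x (w x)) (hw0 : ∀ x, 0 ≤ w x)
    (hg : ∀ᵐ x : Euc d, {i | x ∈ g i '' A}.encard = k) (x : Euc d) :
    ∑' i, ENNReal.ofReal (w ((g i).symm x)) = k := by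
  classical
  have hA : volume A ≠ ⊤ := hb.measure_lt_top.ne
  have hvpos : 0 < volume.real A := ENNReal.toReal_pos hv hA
  have hsub : ∀ i, (g i '' A ∩ Metric.ball x 1).Nonempty →
      g i '' A ⊆ Metric.ball 0 (Metric.diam A + 2 + ‖x‖) := by
    rintro i ⟨_, ⟨a, ha, rfl⟩, hax⟩ _ ⟨b, hb', rfl⟩
    have h1 : dist (g i b) (g i a) ≤ Metric.diam A := by
      rw [(g i).dist_eq]; exact Metric.dist_le_diam_of_mem hb hb' ha
    have h2 := dist_triangle (g i b) (g i a) x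
    have h3 := dist_triangle (g i b) x 0
    rw [dist_zero_right x] at h3
    rw [Metric.mem_ball] at hax ⊢
    linarith
  -- Copies that meet the unit ball at `x` lie in one fixed ball, so the packing bound applies; all
  -- others have angle `0` at `x`.
  have hfin : {i | (g i '' A ∩ Metric.ball x 1).Nonempty}.Finite := by
    by_contra hinf
    obtain ⟨n, hn⟩ := exists_nat_gt
      (k * volume.real (Metric.ball (0 : Euc d) (Metric.diam A + 2 + ‖x‖)) / volume.real A)
    obtain ⟨J, hJ, hJn⟩ := Set.Infinite.exists_subset_card_eq hinf n
    have := card_mul_volume_le hm hA hg J fun i hi => hsub i (hJ hi)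
    rw [hJn, ← le_div_iff₀ hvpos] at this
    linarith
  have hwi : ∀ i, HasAngle (g i '' A) x (w ((g i).symm x)) := fun i => by
    simpa using (hw ((g i).symm x)).image_isometryEquiv (g i)
  have h1 := sum_mul_hasAngle_eq (x := x) hfin.toFinset (fun i => g i '' A) (fun _ => 1)
    (fun i => w ((g i).symm x)) k one_pos
    (fun i _ => measurableSet_image_isometryEquiv hm (g i)) (fun i _ => hwi i)
    (by
      filter_upwards [hg] with y hy hyx
      simp only [one_mul]
      rw [sum_indicator_eq_ncard]
      have : ({i | i ∈ hfin.toFinset ∧ y ∈ g i '' A} : Set ι) = {i | y ∈ g i '' A} := by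
        ext i
        refine ⟨fun h => h.2, fun h => ⟨?_, h⟩⟩
        rw [Set.Finite.mem_toFinset]
        exact ⟨y, h, hyx⟩
      rw [this, Set.ncard, hy]; rfl)
  simp only [one_mul] at h1
  rw [tsum_eq_sum (s := hfin.toFinset), ← ENNReal.ofReal_sum_of_nonneg fun i _ => hw0 _, h1,
    ENNReal.ofReal_natCast]
  intro i hi
  have h2 : HasAngle (g i '' A) x 0 := by
    refine hasAngle_of_notMem_closure fun hc => hi ?_
    rw [Set.Finite.mem_toFinset]
    obtain ⟨y, hy, hyA⟩ := mem_closure_iff.1 hc _ Metric.isOpen_ball (Metric.mem_ball_self one_pos)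
    exact ⟨y, hyA, hy⟩
  rw [(hwi i).unique h2, ENNReal.ofReal_zero]

end Tiling

/-! ### Tilings by translates of a set and of its point reflection -/

section PointSymmetric

variable {d : ℕ} {A : Set (Euc d)} {K : Type} [AddCommGroup K] {κ : Euc d}
  {φ : K →+ latticeGroup d}

/-- The isometries `x ↦ x - φ m` and `x ↦ κ - φ m - x`. -/
noncomputable def tilingIsometry (κ : Euc d) (φ : K →+ latticeGroup d) (i : Bool × K) :
    Euc d ≃ᵢ Euc d :=
  bif i.1 then IsometryEquiv.subRight (φ i.2 : Euc d) else IsometryEquiv.subLeft (κ - φ i.2)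

theorem tilingIsometry_symm_true (m : K) (x : Euc d) :
    (tilingIsometry κ φ (true, m)).symm x = x + φ m := rfl

theorem tilingIsometry_symm_false (m : K) (x : Euc d) :
    (tilingIsometry κ φ (false, m)).symm x = κ - (x + φ m) := by
  rw [IsometryEquiv.symm_apply_eq]
  simp [tilingIsometry]

theorem mem_image_tilingIsometry {i : Bool × K} {x : Euc d} :
    x ∈ tilingIsometry κ φ i '' A ↔ (tilingIsometry κ φ i).symm x ∈ A := by
  constructor
  · rintro ⟨y, hy, rfl⟩; simpa
  · exact fun h => ⟨_, h, by simp⟩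

/-- When `A` and `κ - A` tile the space together, by translations from a sublattice of the integer
lattice, the solid angles of `A` at the integer points add up to its volume. -/
theorem tsum_angle_eq_volume (hm : MeasurableSet A) (hb : Bornology.IsBounded A)
    {w : Euc d → ℝ} (hw : ∀ x, HasAngle A x (w x)) (hw0 : ∀ x, 0 ≤ w x)
    (hκ : κ ∈ integerLattice d) (hφ : Function.Injective φ) [Countable K]
    (hg : ∀ᵐ x : Euc d, ∃! i : Bool × K, (tilingIsometry κ φ i).symm x ∈ A) :
    volume A ≠ 0 ∧ ∑' z : latticeGroup d, ENNReal.ofReal (w z) = volume A := by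
  have hv : volume A ≠ 0 := by
    intro h0
    have h1 : ∀ i : Bool × K, ∀ᵐ x : Euc d, x ∉ tilingIsometry κ φ i '' A := fun i => by
      rw [← measure_eq_zero_iff_ae_notMem, volume_image_isometryEquiv, h0]
    have h2 : ∀ᵐ _x : Euc d, False := by
      filter_upwards [hg, ae_all_iff.2 h1] with x hx hx'
      obtain ⟨i, hi, -⟩ := hx
      exact hx' i (mem_image_tilingIsometry.2 hi)
    rw [eventually_false_iff_eq_bot, ae_eq_bot] at h2
    exact NeZero.ne _ h2
  refine ⟨hv, ?_⟩
  have hg' : ∀ᵐ x : Euc d, {i | x ∈ tilingIsometry κ φ i '' A}.encard = (1 : ℕ) := by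
    filter_upwards [hg] with x hx
    rw [Nat.cast_one, Set.encard_eq_one]
    obtain ⟨i, hi, hu⟩ := hx
    refine ⟨i, Set.eq_singleton_iff_unique_mem.2 ⟨mem_image_tilingIsometry.2 hi, fun j hj =>
      hu j (mem_image_tilingIsometry.1 hj)⟩⟩
  have hκ' : κ ∈ latticeGroup d := mem_latticeGroup.2 hκ
  -- the sum over the lattice of a function and its reflection
  have hrefl : ∀ F : Euc d → ℝ≥0∞, ∑' z : latticeGroup d, F (κ - z) = ∑' z : latticeGroup d, F z :=
    fun F => (Equiv.subLeft (⟨κ, hκ'⟩ : latticeGroup d)).tsum_eq (fun z : latticeGroup d => F z)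
  have hsplit : ∀ F : Bool × K → ℝ≥0∞, ∑' i, F i = ∑' m, (F (true, m) + F (false, m)) := by
    intro F
    rw [ENNReal.tsum_prod', tsum_bool, ENNReal.tsum_add, add_comm]
  -- The index of the translation lattice in `ℤ^d`. Evaluating the tiling at integer points shows
  -- that twice the angle sum is `N`; integrating it over a fundamental domain of `ℤ^d` shows that
  -- twice the volume is `N`.
  set N : ℝ≥0∞ := ∑' _ : latticeGroup d ⧸ φ.range, 1
  have hangle : 2 * ∑' z : latticeGroup d, ENNReal.ofReal (w z) = N := by
    have h1 := hrefl fun x => ENNReal.ofReal (w x)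
    rw [two_mul]
    nth_rw 2 [← h1]
    rw [← ENNReal.tsum_add]
    refine tsum_eq_tsum_quotient φ hφ (fun z => ENNReal.ofReal (w z) + ENNReal.ofReal (w (κ - z)))
      fun r => ?_
    have := tsum_angle_of_tiling hm hb hv hw hw0 hg' r
    rw [hsplit, Nat.cast_one] at this
    simp only [tilingIsometry_symm_true, tilingIsometry_symm_false] at this
    exact this
  have hvol : 2 * volume A = N := by
    have h1 : Measurable (A.indicator (1 : Euc d → ℝ≥0∞)) := measurable_one.indicator hm
    have h2 : volume A = ∫⁻ x, A.indicator (1 : Euc d → ℝ≥0∞) x :=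
      (lintegral_indicator_one hm).symm
    have h3 : volume A = ∫⁻ x, A.indicator (1 : Euc d → ℝ≥0∞) (κ - x) := by
      rw [h2]
      exact (lintegral_sub_left_eq_self _ κ).symm
    have h4 : 2 * volume A = ∫⁻ x, (A.indicator (1 : Euc d → ℝ≥0∞) x +
        A.indicator (1 : Euc d → ℝ≥0∞) (κ - x)) := by
      rw [lintegral_add_left h1, ← h2, ← h3, two_mul]
    have h5 : Measurable fun x => A.indicator (1 : Euc d → ℝ≥0∞) x +
        A.indicator (1 : Euc d → ℝ≥0∞) (κ - x) := h1.add (h1.comp (measurable_const_sub κ))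
    rw [h4, tsum_lintegral_lattice h5]
    rw [← mul_one N, ← volume_fundamentalDomain_basisFun d, ← setLIntegral_const]
    have : Countable (latticeGroup d) := inferInstanceAs (Countable
      (Submodule.span ℤ (Set.range (EuclideanSpace.basisFun (Fin d) ℝ).toBasis)))
    have hall : ∀ᵐ x : Euc d, ∀ r : latticeGroup d,
        ∃! i : Bool × K, (tilingIsometry κ φ i).symm (r + x) ∈ A :=
      ae_all_iff.2 fun r => (measurePreserving_add_left volume (r : Euc d)).quasiMeasurePreserving.ae hg
    refine lintegral_congr_ae (ae_restrict_of_ae ?_)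
    filter_upwards [hall] with x hx
    refine tsum_eq_tsum_quotient φ hφ (fun z => A.indicator (1 : Euc d → ℝ≥0∞) (z + x) +
        A.indicator (1 : Euc d → ℝ≥0∞) (κ - (z + x))) fun r => ?_
    have hs := hsplit fun i => A.indicator (1 : Euc d → ℝ≥0∞) ((tilingIsometry κ φ i).symm (r + x))
    simp only [tilingIsometry_symm_true, tilingIsometry_symm_false] at hs
    have e : ∀ m : K, ((r + φ m : latticeGroup d) : Euc d) + x = r + x + φ m := fun m => by
      push_cast; abel
    simp only [e]
    rw [← hs]
    obtain ⟨i, hi, hu⟩ := hx r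
    rw [tsum_eq_single i fun j hj => Set.indicator_of_notMem (fun hjA => hj (hu j hjA)) _,
      Set.indicator_of_mem hi]
    rfl
  have := hangle.trans hvol.symm
  exact (ENNReal.mul_right_inj two_ne_zero ENNReal.ofNat_ne_top).1 this

end PointSymmetric

/-! ### The discrete volume as a sum over the whole lattice -/

section DiscreteVolume

variable {d : ℕ} {S : Set (Euc d)}

theorem solidAngle_nonneg (hS : IsPolyhedron S) (x : Euc d) : 0 ≤ solidAngle S x :=
  ge_of_tendsto' (hS.hasAngle x) fun _ => div_nonneg measureReal_nonneg measureReal_nonneg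

theorem finite_inter_integerLattice (hb : Bornology.IsBounded S) :
    (S ∩ integerLattice d).Finite := by
  have := ZSpan.setFinite_inter (EuclideanSpace.basisFun (Fin d) ℝ).toBasis hb
  refine this.subset fun x hx => ⟨hx.1, ?_⟩
  exact mem_latticeGroup.2 hx.2

/-- Off the closed set `S` the angle vanishes, so the sum may run over all lattice points and be
added or reindexed freely. -/
theorem tsum_solidAngle (hS : IsPolyhedron S) (hb : Bornology.IsBounded S) :
    ∑' z : latticeGroup d, ENNReal.ofReal (solidAngle S z) =
      ENNReal.ofReal (discreteVolume S) := by
  have hfin := finite_inter_integerLattice hb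
  have h1 : ∑' z : latticeGroup d, ENNReal.ofReal (solidAngle S z) =
      ∑' z : Euc d, (integerLattice d).indicator (fun z => ENNReal.ofReal (solidAngle S z)) z := by
    rw [← tsum_subtype]
    exact (Equiv.setCongr (Set.ext fun x => mem_latticeGroup)).tsum_eq
      (fun z : integerLattice d => ENNReal.ofReal (solidAngle S z))
  rw [h1, tsum_eq_sum (s := hfin.toFinset), discreteVolume,
    finsum_mem_eq_finite_toFinset_sum _ hfin, ENNReal.ofReal_sum_of_nonneg]
  · refine Finset.sum_congr rfl fun x hx => ?_
    rw [Set.indicator_of_mem]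
    exact ((Set.Finite.mem_toFinset _).1 hx).2
  · exact fun x _ => solidAngle_nonneg hS x
  · intro x hx
    by_cases h : x ∈ integerLattice d
    · rw [Set.indicator_of_mem h, solidAngle_eq_zero_of_notMem hS.isClosed, ENNReal.ofReal_zero]
      exact fun hxS => hx ((Set.Finite.mem_toFinset _).2 ⟨hxS, h⟩)
    · rw [Set.indicator_of_notMem h]

theorem discreteVolume_nonneg (hS : IsPolyhedron S) : 0 ≤ discreteVolume S :=
  finsum_nonneg fun x => finsum_nonneg fun _ => solidAngle_nonneg hS x

end DiscreteVolume

/-! ### Adding a segment to a polytope -/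

section AddSegment

variable {S : Set (Euc 3)} {v κ : Euc 3} {K : Type} [AddCommGroup K] [Countable K]
  {φ : K →+ latticeGroup 3}

theorem subset_add_segment {d : ℕ} {S : Set (Euc d)} {v : Euc d} : S ⊆ S + segment ℝ 0 v :=
  fun x hx => ⟨x, hx, 0, left_mem_segment _ _ _, add_zero x⟩

theorem isBounded_add_segment {d : ℕ} {S : Set (Euc d)} {v : Euc d} (hb : Bornology.IsBounded S) :
    Bornology.IsBounded (S + segment ℝ 0 v) :=
  hb.add (by
    rw [← convexHull_pair]
    exact isBounded_convexHull.2 (Set.toFinite _).isBounded)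

/-- Adding a segment preserves concreteness and the Dehn functional when the difference tiles. -/
theorem add_segment_of_tiling (hS : IsPolyhedron S) (hb : Bornology.IsBounded S)
    (hκ : κ ∈ integerLattice 3) (hφ : Function.Injective φ)
    (hg : ∀ᵐ x : Euc 3, ∃! i : Bool × K, (tilingIsometry κ φ i).symm x ∈ (S + segment ℝ 0 v) \ S) :
    (IsConcrete S → IsConcrete (S + segment ℝ 0 v)) ∧
    ∀ f : ℝ →ₗ[ℚ] ℚ, f 1 = 0 → ∫ x, (f (solidAngle (S + segment ℝ 0 v) x) : ℝ) ∂μH[1] =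
      ∫ x, (f (solidAngle S x) : ℝ) ∂μH[1] := by
  have hS' := hS.add_segment v
  have hb' := isBounded_add_segment (v := v) hb
  have hsub : S ⊆ S + segment ℝ 0 v := subset_add_segment
  have hm : MeasurableSet ((S + segment ℝ 0 v) \ S) :=
    hS'.isClosed.measurableSet.diff hS.isClosed.measurableSet
  have hbE : Bornology.IsBounded ((S + segment ℝ 0 v) \ S) := hb'.subset Set.sdiff_subset
  have hw : ∀ x, HasAngle ((S + segment ℝ 0 v) \ S) x
      (solidAngle (S + segment ℝ 0 v) x - solidAngle S x) := fun x =>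
    hasAngle_diff hS.isClosed.measurableSet hsub (hS.hasAngle x) (hS'.hasAngle x)
  have hw0 : ∀ x, 0 ≤ solidAngle (S + segment ℝ 0 v) x - solidAngle S x := fun x =>
    ge_of_tendsto' (hw x) fun _ => div_nonneg measureReal_nonneg measureReal_nonneg
  -- The increases of the volume and of the discrete volume agree.
  obtain ⟨hv, hsum⟩ := tsum_angle_eq_volume hm hbE hw hw0 hκ hφ hg
  constructor
  · intro hc
    have h1 : ENNReal.ofReal (discreteVolume (S + segment ℝ 0 v)) =
        ENNReal.ofReal (discreteVolume S) + volume ((S + segment ℝ 0 v) \ S) := by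
      rw [← tsum_solidAngle hS' hb', ← tsum_solidAngle hS hb, ← hsum, ← ENNReal.tsum_add]
      refine tsum_congr fun z => ?_
      rw [← ENNReal.ofReal_add (solidAngle_nonneg hS _) (hw0 _), add_sub_cancel]
    have h2 := congrArg ENNReal.toReal h1
    rw [ENNReal.toReal_ofReal (discreteVolume_nonneg hS'),
      ENNReal.toReal_add ENNReal.ofReal_ne_top hbE.measure_lt_top.ne,
      ENNReal.toReal_ofReal (discreteVolume_nonneg hS), hc] at h2
    rw [IsConcrete, h2]
    have h3 := measureReal_sdiff (μ := volume) hsub hS.isClosed.measurableSet hb'.measure_lt_top.ne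
    rw [Measure.real] at h3
    rw [h3]; ring
  · intro f hf
    have i1 := hS.integrable hb f hf
    have i2 := hS'.integrable hb' f hf
    have hsub' : ∀ x, (f (solidAngle (S + segment ℝ 0 v) x - solidAngle S x) : ℝ) =
        f (solidAngle (S + segment ℝ 0 v) x) - f (solidAngle S x) := fun x => by
      rw [map_sub]; push_cast; rfl
    -- The difference itself tiles with multiplicity one, so it adds nothing to the Dehn functional.
    have h1 := integral_angle_eq_zero_of_tiling (g := tilingIsometry κ φ) (k := 1) hm hbE hv hw f hf
      (by simp only [hsub']; exact i2.sub i1) le_rfl (by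
        filter_upwards [hg] with x hx
        rw [Nat.cast_one, Set.encard_eq_one]
        obtain ⟨i, hi, hu⟩ := hx
        exact ⟨i, Set.eq_singleton_iff_unique_mem.2 ⟨mem_image_tilingIsometry.2 hi, fun j hj =>
          hu j (mem_image_tilingIsometry.1 hj)⟩⟩)
    simp only [hsub'] at h1
    rw [integral_sub i2 i1] at h1
    linarith

end AddSegment

/-! ### The pyramid and the zonotopes -/

section LinearFunctional

variable {d : ℕ}

theorem exists_inner_eq (L : Euc d →ₗ[ℝ] ℝ) : ∃ n : Euc d, ∀ x, ⟪n, x⟫ = L x :=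
  ⟨(InnerProductSpace.toDual ℝ (Euc d)).symm (LinearMap.toContinuousLinearMap L), fun x => by simp⟩

theorem ae_linearMap_ne {L : Euc d →ₗ[ℝ] ℝ} {y : Euc d} (hy : L y ≠ 0) (c : ℝ) :
    ∀ᵐ x : Euc d, L x ≠ c := by
  obtain ⟨n, hn⟩ := exists_inner_eq L
  have : n ≠ 0 := by
    rintro rfl
    exact hy (by rw [← hn, inner_zero_left])
  simpa only [hn] using ae_inner_ne this c

theorem isPolyhedron_of_linearMap {ι : Type} [Finite ι] (L : ι → Euc d →ₗ[ℝ] ℝ) (c : ι → ℝ) :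
    IsPolyhedron {x | ∀ i, 0 ≤ L i x + c i} := by
  choose n hn using fun i => exists_inner_eq (L i)
  exact ⟨ι, inferInstance, n, c, by ext x; simp [polyhedron, hn]⟩

end LinearFunctional

/-- The parameters of the points `b ≤ t` of a line which are translated out of a convex set. -/
theorem exists_mem_add_segment_diff_iff {d : ℕ} {S : Set (Euc d)} (hc : IsClosed S)
    (hS : Convex ℝ S) (hb : Bornology.IsBounded S) {v : Euc d} (hv : v ≠ 0) {x : Euc d}
    (hx : ∃ t : ℝ, x + t • v ∈ S) :
    ∃ b : ℝ, ∀ t : ℝ, x + t • v ∈ (S + segment ℝ 0 v) \ S ↔ b < t ∧ t ≤ b + 1 := by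
  set T : Set ℝ := {t | x + t • v ∈ S} with hT
  have hTc : IsClosed T := hc.preimage (by fun_prop)
  have hTb : BddAbove T := by
    obtain ⟨R, hR⟩ := hb.subset_ball x
    refine ⟨R / ‖v‖, fun t ht => ?_⟩
    have h1 := hR ht
    rw [mem_ball_iff_norm, add_sub_cancel_left, norm_smul] at h1
    rw [le_div_iff₀ (norm_pos_iff.2 hv)]
    exact (mul_le_mul_of_nonneg_right (le_abs_self t) (norm_nonneg v)).trans h1.le
  have hmem : sSup T ∈ T := hTc.csSup_mem hx hTb
  have hle : ∀ t ∈ T, t ≤ sSup T := fun t ht => le_csSup hTb ht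
  have hconv : ∀ s ∈ T, ∀ t, s ≤ t → t ≤ sSup T → t ∈ T := by
    intro s hs t hst htb
    have hTconv : Convex ℝ T := by
      have : T = (AffineMap.lineMap x (x + v)) ⁻¹' S := by
        ext t; simp [hT, AffineMap.lineMap_apply, add_comm]
      rw [this]
      exact hS.affine_preimage _
    exact hTconv.ordConnected.out hs hmem ⟨hst, htb⟩
  -- `T` is a compact interval and `sSup T` is where the line leaves `S`. Moving `T` forward by up
  -- to one unit adds exactly the next half-open unit interval.
  refine ⟨sSup T, fun t => ?_⟩
  rw [Set.mem_sdiff, mem_add_segment_iff]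
  have e : ∀ s : ℝ, x + t • v - s • v = x + (t - s) • v := fun s => by rw [sub_smul]; abel
  constructor
  · rintro ⟨⟨s, h0, h1, h2⟩, h3⟩
    rw [e] at h2
    have h4 := hle _ h2
    refine ⟨?_, by linarith⟩
    by_contra hlt
    exact h3 (hconv _ h2 t (by linarith) (not_lt.1 hlt))
  · rintro ⟨h1, h2⟩
    refine ⟨⟨t - sSup T, by linarith, by linarith, ?_⟩, fun h => absurd (hle t h) (not_le.2 h1)⟩
    rw [e, sub_sub_cancel]
    exact hmem

section Coordinates

/-- The coordinate `p` of `p e₃ + y b + q c`, where `b = (-1, 2, 1)` and `c = (-1, -1, 1)`. -/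
noncomputable def coordP : Euc 3 →ₗ[ℝ] ℝ where
  toFun x := x 0 + x 2
  map_add' x y := by simp only [PiLp.add_apply]; ring
  map_smul' t x := by simp only [PiLp.smul_apply, smul_eq_mul, RingHom.id_apply]; ring

/-- The coordinate `y` of `p e₃ + y b + q c`. -/
noncomputable def coordY : Euc 3 →ₗ[ℝ] ℝ where
  toFun x := (x 1 - x 0) / 3
  map_add' x y := by simp only [PiLp.add_apply]; ring
  map_smul' t x := by simp only [PiLp.smul_apply, smul_eq_mul, RingHom.id_apply]; ring

/-- The coordinate `q` of `p e₃ + y b + q c`. -/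
noncomputable def coordQ : Euc 3 →ₗ[ℝ] ℝ where
  toFun x := -(2 * x 0 + x 1) / 3
  map_add' x y := by simp only [PiLp.add_apply]; ring
  map_smul' t x := by simp only [PiLp.smul_apply, smul_eq_mul, RingHom.id_apply]; ring

theorem coordP_apply (x : Euc 3) : coordP x = x 0 + x 2 := rfl
theorem coordY_apply (x : Euc 3) : coordY x = (x 1 - x 0) / 3 := rfl
theorem coordQ_apply (x : Euc 3) : coordQ x = -(2 * x 0 + x 1) / 3 := rfl

/-- The point with the coordinates `p`, `y`, `q`. -/
noncomputable def point (p y q : ℝ) : Euc 3 := !₂[-y - q, 2 * y - q, p + y + q]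

@[simp] theorem coordP_point (p y q : ℝ) : coordP (point p y q) = p := by
  simp [coordP_apply, point]

@[simp] theorem coordY_point (p y q : ℝ) : coordY (point p y q) = y := by
  simp [coordY_apply, point]; ring

@[simp] theorem coordQ_point (p y q : ℝ) : coordQ (point p y q) = q := by
  simp [coordQ_apply, point]; ring

theorem point_coord (x : Euc 3) : point (coordP x) (coordY x) (coordQ x) = x := by
  ext i
  fin_cases i <;> simp [coordP_apply, coordY_apply, coordQ_apply, point] <;> ring

theorem ext_coord {x y : Euc 3} (hp : coordP x = coordP y) (hy : coordY x = coordY y)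
    (hq : coordQ x = coordQ y) : x = y := by
  rw [← point_coord x, ← point_coord y, hp, hy, hq]

/-- The converse fails: `e₃`, `b`, `c` have determinant 3 and span a sublattice of index 3. -/
theorem point_mem_integerLattice (p y q : ℤ) : point p y q ∈ integerLattice 3 := by
  intro i
  fin_cases i
  · exact ⟨-y - q, by simp [point]⟩
  · exact ⟨2 * y - q, by simp [point]⟩
  · exact ⟨p + y + q, by simp [point]⟩

theorem continuous_point {α : Type*} [TopologicalSpace α] {p y q : α → ℝ} (hp : Continuous p)
    (hy : Continuous y) (hq : Continuous q) : Continuous fun a => point (p a) (y a) (q a) := by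
  refine (PiLp.continuous_toLp 2 _).comp (continuous_pi fun i => ?_)
  fin_cases i
  · exact hy.neg.sub hq
  · exact (hy.const_mul 2).sub hq
  · exact (hp.add hy).add hq

theorem isBounded_of_coord {S : Set (Euc 3)} (R : ℝ) (hp : ∀ x ∈ S, |coordP x| ≤ R)
    (hy : ∀ x ∈ S, |coordY x| ≤ R) (hq : ∀ x ∈ S, |coordQ x| ≤ R) : Bornology.IsBounded S := by
  have hK : IsCompact ((fun a : ℝ × ℝ × ℝ => point a.1 a.2.1 a.2.2) ''
      (Set.Icc (-R) R ×ˢ Set.Icc (-R) R ×ˢ Set.Icc (-R) R)) :=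
    (isCompact_Icc.prod (isCompact_Icc.prod isCompact_Icc)).image
      (continuous_point continuous_fst (continuous_fst.comp continuous_snd)
        (continuous_snd.comp continuous_snd))
  refine hK.isBounded.subset fun x hx => ⟨(coordP x, coordY x, coordQ x), ?_, point_coord x⟩
  exact ⟨abs_le.1 (hp x hx), abs_le.1 (hy x hx), abs_le.1 (hq x hx)⟩

end Coordinates

section Pyramid

/-- A pyramid over a quadrilateral in the plane `y = 0`, with the apex `b`. -/
def pyramid : Set (Euc 3) :=
  {x | 0 ≤ coordP x ∧ 0 ≤ coordY x ∧ 0 ≤ coordQ x ∧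
    coordP x / 3 + coordY x + coordQ x / 5 ≤ 1 ∧ 1 ≤ coordP x / 2 + coordY x + coordQ x}

theorem isPolyhedron_pyramid : IsPolyhedron pyramid := by
  have := isPolyhedron_of_linearMap (ι := Fin 5)
    ![coordP, coordY, coordQ, -((1 / 3 : ℝ) • coordP + coordY + (1 / 5 : ℝ) • coordQ),
      (1 / 2 : ℝ) • coordP + coordY + coordQ] ![0, 0, 0, 1, -1]
  convert this using 1
  ext x
  simp [pyramid, Fin.forall_fin_succ]
  refine fun _ _ _ => ⟨fun h => ⟨?_, ?_⟩, fun h => ⟨?_, ?_⟩⟩ <;> linarith [h.1, h.2]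

theorem isBounded_pyramid : Bornology.IsBounded pyramid := by
  refine isBounded_of_coord 5 ?_ ?_ ?_ <;>
  · rintro x ⟨h1, h2, h3, h4, h5⟩
    rw [abs_le]
    constructor <;> linarith

/-- The edges of the zonotopes. -/
noncomputable def zoneVector (j : ℕ) : Euc 3 := point 1 0 j

theorem coordP_zoneVector (j : ℕ) : coordP (zoneVector j) = 1 := by simp [zoneVector]
theorem coordY_zoneVector (j : ℕ) : coordY (zoneVector j) = 0 := by simp [zoneVector]
theorem coordQ_zoneVector (j : ℕ) : coordQ (zoneVector j) = j := by simp [zoneVector]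

theorem zoneVector_ne_zero (j : ℕ) : zoneVector j ≠ 0 := by
  intro h
  have := coordP_zoneVector j
  rw [h, map_zero] at this
  exact zero_ne_one this

/-- The sum of the pyramid and the zonotope with the edges `zoneVector j`, `j < n`. -/
noncomputable def pyramidSum : ℕ → Set (Euc 3)
  | 0 => pyramid
  | n + 1 => pyramidSum n + segment ℝ 0 (zoneVector n)

theorem isPolyhedron_pyramidSum (n : ℕ) : IsPolyhedron (pyramidSum n) := by
  induction n with
  | zero => exact isPolyhedron_pyramid
  | succ n ih => exact ih.add_segment _

theorem isBounded_pyramidSum (n : ℕ) : Bornology.IsBounded (pyramidSum n) := by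
  induction n with
  | zero => exact isBounded_pyramid
  | succ n ih => exact isBounded_add_segment ih

/-- Both `coordY` and `coordQ - n * coordP` are constant along `zoneVector n`, so this bounds the
shadow in that direction. On the pyramid the extremes at height `y` come from `(0, y, 5 (1 - y))`
and, for the lower side, `(3 (1 - y), y, 0)`. The edge `zoneVector i` changes the second form by `i
- n ≤ 0`, so it moves only the lower bound. -/
theorem bounds_of_mem_pyramidSum {n j : ℕ} (hj : j ≤ n) {x : Euc 3} (hx : x ∈ pyramidSum j) :
    0 ≤ coordY x ∧ coordY x ≤ 1 ∧
      -(3 * n * (1 - coordY x)) - ∑ i ∈ Finset.range j, ((n : ℝ) - i) ≤ coordQ x - n * coordP x ∧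
      coordQ x - n * coordP x ≤ 5 * (1 - coordY x) := by
  induction j generalizing x with
  | zero =>
    obtain ⟨h1, h2, h3, h4, h5⟩ := hx
    have hn : (0 : ℝ) ≤ n := n.cast_nonneg
    refine ⟨h2, by linarith, ?_, ?_⟩
    · have : n * coordP x ≤ n * (3 * (1 - coordY x)) :=
        mul_le_mul_of_nonneg_left (by linarith) hn
      simp only [Finset.range_zero, Finset.sum_empty]
      linarith
    · have := mul_nonneg hn h1
      linarith
  | succ j ih =>
    obtain ⟨t, h0, h1, hz⟩ := mem_add_segment_iff.1 hx
    have h := ih (by omega) hz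
    simp only [map_sub, map_smul, smul_eq_mul, coordP_zoneVector, coordY_zoneVector,
      coordQ_zoneVector, mul_zero, sub_zero, mul_one] at h
    obtain ⟨h2, h3, h4, h5⟩ := h
    have hjn : (0 : ℝ) ≤ n - j := by
      rw [sub_nonneg]; exact_mod_cast (by omega : j ≤ n)
    have h6 : 0 ≤ t * ((n : ℝ) - j) := mul_nonneg h0 hjn
    have h7 : t * ((n : ℝ) - j) ≤ 1 * (n - j) := mul_le_mul_of_nonneg_right h1 hjn
    rw [Finset.sum_range_succ]
    exact ⟨h2, h3, by linarith, by linarith⟩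

theorem add_smul_sum_mem_pyramidSum {x : Euc 3} (hx : x ∈ pyramid) {t : ℝ} (h0 : 0 ≤ t)
    (h1 : t ≤ 1) (n : ℕ) : x + t • ∑ i ∈ Finset.range n, zoneVector i ∈ pyramidSum n := by
  induction n with
  | zero =>
    rw [Finset.range_zero, Finset.sum_empty, smul_zero, add_zero]
    exact hx
  | succ n ih =>
    refine mem_add_segment_iff.2 ⟨t, h0, h1, ?_⟩
    rw [Finset.sum_range_succ, smul_add]
    convert ih using 1
    abel

theorem exists_add_smul_mem_pyramidSum_iff (n : ℕ) (x : Euc 3) :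
    (∃ t : ℝ, x + t • zoneVector n ∈ pyramidSum n) ↔
      0 ≤ coordY x ∧ coordY x ≤ 1 ∧
      -(3 * n * (1 - coordY x)) - ∑ i ∈ Finset.range n, ((n : ℝ) - i) ≤ coordQ x - n * coordP x ∧
      coordQ x - n * coordP x ≤ 5 * (1 - coordY x) := by
  constructor
  · rintro ⟨t, ht⟩
    have h := bounds_of_mem_pyramidSum le_rfl ht
    simp only [map_add, map_smul, smul_eq_mul, coordP_zoneVector, coordY_zoneVector,
      coordQ_zoneVector, mul_zero, add_zero, mul_one] at h
    have e : coordQ x + t * n - n * (coordP x + t) = coordQ x - n * coordP x := by ring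
    rwa [e] at h
  · rintro ⟨h1, h2, h3, h4⟩
    obtain ⟨m, hm⟩ : ∃ m, m = ∑ i ∈ Finset.range n, ((n : ℝ) - i) := ⟨_, rfl⟩
    have hm0 : 0 ≤ m := by
      rw [hm]
      refine Finset.sum_nonneg fun i hi => ?_
      rw [sub_nonneg]; exact_mod_cast (Finset.mem_range.1 hi).le
    rw [← hm] at h3
    have hn : (0 : ℝ) ≤ n := n.cast_nonneg
    have hy : 0 ≤ 1 - coordY x := by linarith
    -- `θ` interpolates between the two ends of the shadow at this height: `θ = 1` is the upper end,
    -- and `θ = 0` is the lower end, with all earlier edges added in full. A slice of width zero is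
    -- split off to avoid dividing by zero.
    obtain ⟨θ, h0, h1', hθ⟩ : ∃ θ : ℝ, 0 ≤ θ ∧ θ ≤ 1 ∧ coordQ x - n * coordP x =
        (1 - coordY x) * (5 * θ - 3 * n * (1 - θ)) - (1 - θ) * m := by
      rcases (add_nonneg (mul_nonneg (add_nonneg (by norm_num : (0 : ℝ) ≤ 5)
        (mul_nonneg (by norm_num : (0 : ℝ) ≤ 3) hn)) hy) hm0).eq_or_lt with h | h
      · exact ⟨0, le_rfl, zero_le_one, by linarith⟩
      · refine ⟨(coordQ x - n * coordP x - (-(3 * n * (1 - coordY x)) - m)) /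
          ((5 + 3 * n) * (1 - coordY x) + m), div_nonneg (by linarith) h.le,
          (div_le_one h).2 (by linarith), ?_⟩
        linear_combination -div_mul_cancel₀
          (coordQ x - n * coordP x - (-(3 * n * (1 - coordY x)) - m)) h.ne'
    have hP : point (3 * (1 - coordY x) * (1 - θ)) (coordY x) (5 * (1 - coordY x) * θ) ∈ pyramid := by
      have a1 := mul_nonneg hy h0
      have a2 := mul_nonneg hy (sub_nonneg.2 h1')
      simp only [pyramid, Set.mem_ofPred_eq, coordP_point, coordY_point, coordQ_point]
      refine ⟨by linarith, h1, by linarith, by linarith, by linarith⟩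
    have hsum := add_smul_sum_mem_pyramidSum hP (sub_nonneg.2 h1') (by linarith : 1 - θ ≤ 1) n
    refine ⟨3 * (1 - coordY x) * (1 - θ) + (1 - θ) * n - coordP x, ?_⟩
    have hmn : m = n * n - ∑ i ∈ Finset.range n, (i : ℝ) := by
      rw [hm, Finset.sum_sub_distrib]; simp
    convert hsum using 1
    refine ext_coord ?_ ?_ ?_
    · simp [map_sum, coordP_zoneVector]
    · simp [map_sum, coordY_zoneVector]
    · simp only [map_add, map_smul, map_sum, coordQ_zoneVector, coordQ_point, smul_eq_mul]
      have : ∑ i ∈ Finset.range n, (i : ℝ) = n * n - m := by linarith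
      rw [this]
      linear_combination hθ

end Pyramid

/-! ### The tiling by the difference and its reflection -/

section Tiling

/-- The width of the strip which is tiled. -/
def stripWidth (n : ℕ) : ℤ := 5 + 3 * n + 2 * ∑ i ∈ Finset.range n, ((n : ℤ) - i)

theorem sum_sub_nonneg (n : ℕ) : (0 : ℝ) ≤ ∑ i ∈ Finset.range n, ((n : ℝ) - i) := by
  refine Finset.sum_nonneg fun i hi => ?_
  rw [sub_nonneg]; exact_mod_cast (Finset.mem_range.1 hi).le

theorem cast_stripWidth (n : ℕ) :
    (stripWidth n : ℝ) = 5 + 3 * n + 2 * ∑ i ∈ Finset.range n, ((n : ℝ) - i) := by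
  simp [stripWidth]

/-- The lattice of translations of the tiling. -/
noncomputable def tilingHom (n : ℕ) : ℤ × ℤ × ℤ →+ latticeGroup 3 where
  toFun a := ⟨point a.1 a.2.2 (n * a.1 + stripWidth n * a.2.1), mem_latticeGroup.2 (by
    have := point_mem_integerLattice a.1 a.2.2 (n * a.1 + stripWidth n * a.2.1)
    push_cast at this
    exact this)⟩
  map_zero' := by
    refine Subtype.ext (ext_coord ?_ ?_ ?_) <;> simp
  map_add' a b := by
    refine Subtype.ext (ext_coord ?_ ?_ ?_) <;> simp
    ring

theorem tilingHom_apply (n : ℕ) (a : ℤ × ℤ × ℤ) :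
    (tilingHom n a : Euc 3) = point a.1 a.2.2 (n * a.1 + stripWidth n * a.2.1) := rfl

theorem stripWidth_pos (n : ℕ) : (0 : ℝ) < stripWidth n := by
  rw [cast_stripWidth]
  have := sum_sub_nonneg n
  positivity

theorem tilingHom_injective (n : ℕ) : Function.Injective (tilingHom n) := by
  rintro ⟨i, j, k⟩ ⟨i', j', k'⟩ h
  have h' : (tilingHom n (i, j, k) : Euc 3) = tilingHom n (i', j', k') := congrArg Subtype.val h
  rw [tilingHom_apply, tilingHom_apply] at h'
  have hi := congrArg coordP h'
  have hk := congrArg coordY h'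
  have hj := congrArg coordQ h'
  simp only [coordP_point, coordY_point, coordQ_point] at hi hj hk
  rw [hi, add_right_inj, mul_right_inj' (stripWidth_pos n).ne'] at hj
  norm_cast at hi hj hk
  rw [hi, hj, hk]

/-- With `ℓ = q - n p`, the shadow of the difference is `0 ≤ y ≤ 1`, `-(3 n (1 - y)) - m ≤ ℓ ≤ 5 (1
- y)`. Reflection by `point 0 1 5` sends `(y, ℓ)` to `(1 - y, 5 - ℓ)` and the shadow to `5 (1 - y) ≤
ℓ ≤ 5 + 3 n y + m`. The two share a side and fill a parallelogram of width `5 + 3 n + 2 m`, which is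
`stripWidth n`. The lattice shifts `y` by 1, `ℓ` by this width, and the half-open fibres by
`zoneVector n`. -/
theorem existsUnique_tiling (n : ℕ) : ∀ᵐ x : Euc 3, ∃! i : Bool × ℤ × ℤ × ℤ,
    (tilingIsometry (point 0 1 5) (tilingHom n) i).symm x ∈ pyramidSum (n + 1) \ pyramidSum n := by
  set m := ∑ i ∈ Finset.range n, ((n : ℝ) - i) with hm
  have hm0 : 0 ≤ m := sum_sub_nonneg n
  have hn : (0 : ℝ) ≤ n := n.cast_nonneg
  -- Generic points: those whose shadow avoids the boundary lines of all translated pieces.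
  have g1 : ∀ᵐ x : Euc 3, ∀ k : ℤ, coordY x ≠ k :=
    ae_all_iff.2 fun k => ae_linearMap_ne (y := point 0 1 0) (by simp) _
  have g2 : ∀ᵐ x : Euc 3, ∀ j k : ℤ, (coordQ - (n : ℝ) • coordP + (5 : ℝ) • coordY) x ≠
      5 * (1 - k) - stripWidth n * j :=
    ae_all_iff.2 fun j => ae_all_iff.2 fun k => ae_linearMap_ne (y := point 0 1 0) (by simp) _
  have g3 : ∀ᵐ x : Euc 3, ∀ j k : ℤ, (coordQ - (n : ℝ) • coordP - (3 * n : ℝ) • coordY) x ≠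
      -(3 * n * (1 - k)) - m - stripWidth n * j :=
    ae_all_iff.2 fun j => ae_all_iff.2 fun k => ae_linearMap_ne (y := point 0 0 1) (by simp) _
  filter_upwards [g1, g2, g3] with x hx1 hx2 hx3
  simp only [LinearMap.add_apply, LinearMap.sub_apply, LinearMap.smul_apply, smul_eq_mul] at hx2 hx3
  have hWpos := stripWidth_pos n
  have hW := cast_stripWidth n
  rw [← hm] at hW
  obtain ⟨W, hWW⟩ : ∃ W : ℝ, W = stripWidth n := ⟨_, rfl⟩
  rw [← hWW] at hWpos hW hx2 hx3
  -- the coordinates of a translate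
  have hY : ∀ a, coordY (x + tilingHom n a) = coordY x + a.2.2 := fun a => by
    rw [tilingHom_apply, map_add, coordY_point]
  have hL : ∀ a, coordQ (x + tilingHom n a) - n * coordP (x + tilingHom n a) =
      coordQ x - n * coordP x + W * a.2.1 := fun a => by
    rw [tilingHom_apply, map_add, map_add, coordQ_point, coordP_point, hWW]; ring
  obtain ⟨ℓ, hℓ⟩ : ∃ ℓ, ℓ = coordQ x - n * coordP x := ⟨_, rfl⟩
  obtain ⟨y, hy⟩ : ∃ y, y = coordY x := ⟨_, rfl⟩
  rw [← hℓ] at hL hx2 hx3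
  rw [← hy] at hY hx1 hx2 hx3
  -- a point of the difference lies in the strip
  have hsub : ∀ z, z ∈ pyramidSum (n + 1) \ pyramidSum n →
      ∃ t : ℝ, z + t • zoneVector n ∈ pyramidSum n := by
    rintro z ⟨hz, -⟩
    obtain ⟨t, -, -, ht⟩ := mem_add_segment_iff.1 hz
    exact ⟨-t, by rwa [neg_smul, ← sub_eq_add_neg]⟩
  have hstrip := fun z hz => (exists_add_smul_mem_pyramidSum_iff n z).1 (hsub z hz)
  rw [← hm] at hstrip
  obtain ⟨k₀, hk₀⟩ : ∃ k₀ : ℤ, k₀ = -⌊y⌋ := ⟨_, rfl⟩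
  obtain ⟨y', hy'⟩ : ∃ y', y' = y + k₀ := ⟨_, rfl⟩
  have hy0 : 0 < y' := by
    have h1 := Int.floor_le y
    have h2 := hx1 ⌊y⌋
    have h3 := lt_of_le_of_ne h1 (Ne.symm h2)
    rw [hy', hk₀]; push_cast; linarith
  have hy1 : y' < 1 := by
    have h1 := Int.lt_floor_add_one y
    rw [hy', hk₀]; push_cast; linarith
  have hk : ∀ k : ℤ, 0 ≤ y + k → y + k ≤ 1 → k = k₀ := by
    intro k h1 h2
    have h3 : (k : ℝ) - k₀ < 1 := by linarith
    have h4 : (-1 : ℝ) < k - k₀ := by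
      rcases h1.lt_or_eq with h | h
      · linarith
      · exact absurd (by push_cast; linarith : y = (-k : ℤ)) (hx1 _)
    have h5 : k - k₀ < 1 := by exact_mod_cast h3
    have h6 : -1 < k - k₀ := by exact_mod_cast h4
    omega
  -- The shifts `k₀` and `j₀` bring the shadow of the point into the parallelogram; the side of `ℓ =
  -- 5 (1 - y')` on which it falls decides between the difference and its reflection.
  obtain ⟨j₀, hj₀, hju⟩ := existsUnique_add_zsmul_mem_Ico hWpos ℓ (-(3 * n * (1 - y')) - m)
  simp only [zsmul_eq_mul, Set.mem_Ico] at hj₀ hju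
  have hne2 : ∀ j : ℤ, ℓ + W * j ≠ 5 * (1 - y') := fun j h => hx2 j k₀ (by
    rw [hy'] at h; linarith)
  have hne3 : ∀ j : ℤ, ℓ + W * j ≠ -(3 * n * (1 - y')) - m := fun j h => hx3 j k₀ (by
    rw [hy'] at h; linarith)
  have hny : 0 ≤ 3 * n * y' := by positivity
  have hny' : 0 ≤ 3 * n * (1 - y') := mul_nonneg (by positivity) (by linarith)
  have htrue : ∀ i j k : ℤ, x + tilingHom n (i, j, k) ∈ pyramidSum (n + 1) \ pyramidSum n →
      k = k₀ ∧ j = j₀ ∧ ℓ + W * j₀ < 5 * (1 - y') := by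
    intro i j k h
    have h' := hstrip _ h
    rw [hY, hL] at h'
    obtain ⟨h1, h2, h3, h4⟩ := h'
    have hkk := hk k h1 h2
    simp only [hkk, ← hy'] at h3 h4
    have hjj : j = j₀ := hju j ⟨by linarith, by linarith⟩
    subst hjj
    exact ⟨hkk, rfl, lt_of_le_of_ne h4 (hne2 _)⟩
  have hfalse : ∀ i j k : ℤ, point 0 1 5 - (x + tilingHom n (i, j, k)) ∈
      pyramidSum (n + 1) \ pyramidSum n → k = k₀ ∧ j = j₀ ∧ 5 * (1 - y') < ℓ + W * j₀ := by
    intro i j k h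
    have h' := hstrip _ h
    have e : ∀ z, coordQ (point 0 1 5 - z) - n * coordP (point 0 1 5 - z) =
        5 - (coordQ z - n * coordP z) := fun z => by
      rw [map_sub, map_sub, coordQ_point, coordP_point]; ring
    rw [e, hL, map_sub, coordY_point, hY] at h'
    obtain ⟨h1, h2, h3, h4⟩ := h'
    have hkk := hk k (by linarith) (by linarith)
    simp only [hkk, ← hy'] at h3 h4
    -- The right edge of the parallelogram is its left edge shifted by `W`, so it is excluded by
    -- genericity at `j - 1`.
    have h5 : ℓ + W * j ≠ -(3 * n * (1 - y')) - m + W := fun h => hne3 (j - 1) (by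
      push_cast; linarith)
    have hjj : j = j₀ := hju j ⟨by linarith, lt_of_le_of_ne (by linarith) fun h => h5 (by linarith)⟩
    subst hjj
    exact ⟨hkk, rfl, lt_of_le_of_ne (by linarith) (hne2 _).symm⟩
  have hint : ∀ b : ℝ, ∃! i : ℤ, b < i ∧ (i : ℝ) ≤ b + 1 := by
    intro b
    have := existsUnique_add_zsmul_mem_Ioc (one_pos : (0 : ℝ) < 1) 0 b
    simpa using this
  have hline := fun z hz => exists_mem_add_segment_diff_iff (isPolyhedron_pyramidSum n).isClosed
    (isPolyhedron_pyramidSum n).convex (isBounded_pyramidSum n) (zoneVector_ne_zero n) (x := z) hz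
  have htrans : ∀ i : ℤ, x + tilingHom n (i, j₀, k₀) =
      (x + tilingHom n (0, j₀, k₀)) + (i : ℝ) • zoneVector n := fun i => by
    rw [tilingHom_apply, tilingHom_apply]
    refine ext_coord ?_ ?_ ?_ <;>
      simp [coordP_zoneVector, coordY_zoneVector, coordQ_zoneVector]
    ring
  rcases lt_or_gt_of_ne (hne2 j₀) with hlt | hgt
  · obtain ⟨b, hb⟩ := hline (x + tilingHom n (0, j₀, k₀))
      ((exists_add_smul_mem_pyramidSum_iff n _).2 (by
        rw [hY, hL, ← hm]
        simp only [← hy']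
        exact ⟨hy0.le, hy1.le, by linarith [hj₀.1], by linarith⟩))
    obtain ⟨i₀, hi₀, hiu⟩ := hint b
    refine ⟨(true, i₀, j₀, k₀), ?_, ?_⟩
    · beta_reduce
      rw [tilingIsometry_symm_true, htrans]
      exact (hb _).2 hi₀
    · rintro ⟨_ | _, i, j, k⟩ h
      · rw [tilingIsometry_symm_false] at h
        exact absurd (hfalse i j k h).2.2 (not_lt.2 hlt.le)
      · rw [tilingIsometry_symm_true] at h
        obtain ⟨hkk, hjj, -⟩ := htrue i j k h
        subst hkk hjj
        rw [htrans] at h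
        rw [hiu i ((hb _).1 h)]
  · obtain ⟨b, hb⟩ := hline (point 0 1 5 - (x + tilingHom n (0, j₀, k₀)))
      ((exists_add_smul_mem_pyramidSum_iff n _).2 (by
        have e : ∀ z, coordQ (point 0 1 5 - z) - n * coordP (point 0 1 5 - z) =
            5 - (coordQ z - n * coordP z) := fun z => by
          rw [map_sub, map_sub, coordQ_point, coordP_point]; ring
        rw [e, hL, map_sub, coordY_point, hY, ← hm]
        simp only [← hy']
        exact ⟨by linarith, by linarith, by linarith [hj₀.2], by linarith⟩))
    have htrans' : ∀ i : ℤ, point 0 1 5 - (x + tilingHom n (i, j₀, k₀)) =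
        (point 0 1 5 - (x + tilingHom n (0, j₀, k₀))) + ((-i : ℤ) : ℝ) • zoneVector n := fun i => by
      rw [htrans i, Int.cast_neg, neg_smul]; abel
    obtain ⟨i₀, hi₀, hiu⟩ := hint b
    -- The reflection reverses the direction of `zoneVector n`, hence the sign.
    refine ⟨(false, -i₀, j₀, k₀), ?_, ?_⟩
    · beta_reduce
      rw [tilingIsometry_symm_false, htrans', neg_neg]
      exact (hb _).2 hi₀
    · rintro ⟨_ | _, i, j, k⟩ h
      · rw [tilingIsometry_symm_false] at h
        obtain ⟨hkk, hjj, -⟩ := hfalse i j k h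
        subst hkk hjj
        rw [htrans'] at h
        rw [← hiu (-i) ((hb _).1 h), neg_neg]
      · rw [tilingIsometry_symm_true] at h
        exact absurd (htrue i j k h).2.2 (not_lt.2 hgt.le)

theorem isConcrete_pyramidSum (h : IsConcrete pyramid) (n : ℕ) : IsConcrete (pyramidSum n) := by
  induction n with
  | zero => exact h
  | succ n ih =>
    have hκ : point 0 1 5 ∈ integerLattice 3 := by exact_mod_cast point_mem_integerLattice 0 1 5
    exact (add_segment_of_tiling (isPolyhedron_pyramidSum n) (isBounded_pyramidSum n) hκ
      (tilingHom_injective n) (existsUnique_tiling n)).1 ih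

theorem integral_pyramidSum (f : ℝ →ₗ[ℚ] ℚ) (hf : f 1 = 0) (n : ℕ) :
    ∫ x, (f (solidAngle (pyramidSum n) x) : ℝ) ∂μH[1] =
      ∫ x, (f (solidAngle pyramid x) : ℝ) ∂μH[1] := by
  induction n with
  | zero => rfl
  | succ n ih =>
    have hκ : point 0 1 5 ∈ integerLattice 3 := by exact_mod_cast point_mem_integerLattice 0 1 5
    rw [← ih]
    exact (add_segment_of_tiling (isPolyhedron_pyramidSum n) (isBounded_pyramidSum n) hκ
      (tilingHom_injective n) (existsUnique_tiling n)).2 f hf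

end Tiling

/-! ### Tetrahedra -/

section VertexAngles

variable {d : ℕ}

theorem measurableSet_normalCone {ι : Type*} (n : ι → Euc d) (I : Set ι) :
    MeasurableSet (normalCone n I) := by
  rw [normalCone_eq]
  exact (isClosed_polyhedron _ _).measurableSet

/-- Pairs minus triples, in `M` and in its complement: `0 + (3 - 1)` for a split into 1 and 3, `1 +
1` for a split into 2 and 2. -/
theorem sum_subset_tetrahedron : ∀ M : Finset (Fin 4), M ≠ ∅ → M ≠ Finset.univ →
    ∑ p ∈ (Finset.univ : Finset Bool) ×ˢ
      (Finset.powersetCard 2 Finset.univ ∪ Finset.powersetCard 3 Finset.univ : Finset (Finset (Fin 4))),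
      (if p.2.card = 2 then (1 : ℤ) else -1) * (if p.2 ⊆ (bif p.1 then M else Mᶜ) then 1 else 0) =
    2 := by
  decide

/-- The sums of the solid angles of a tetrahedron along the edges and at the vertices. -/
theorem sum_solidAngle_tetrahedron (n : Fin 4 → Euc d) (s : Fin 4 → ℝ) (hs : ∀ i, 0 < s i)
    (hn : ∀ i, n i ≠ 0) (hsum : ∑ i, s i • n i = 0) :
    ∑ I ∈ Finset.powersetCard 2 Finset.univ, solidAngle (normalCone n (I : Finset (Fin 4))) 0 -
      ∑ I ∈ Finset.powersetCard 3 Finset.univ, solidAngle (normalCone n (I : Finset (Fin 4))) 0 = 1 := by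
  classical
  have h := sum_mul_hasAngle_eq (x := (0 : Euc d)) ((Finset.univ : Finset Bool) ×ˢ
    (Finset.powersetCard 2 Finset.univ ∪ Finset.powersetCard 3 Finset.univ : Finset (Finset (Fin 4))))
    (fun p => bif p.1 then normalCone n (p.2 : Finset (Fin 4)) else -normalCone n (p.2 : Finset (Fin 4)))
    (fun p => if p.2.card = 2 then 1 else -1)
    (fun p => solidAngle (normalCone n (p.2 : Finset (Fin 4))) 0) 2 one_pos
    (by
      rintro ⟨_ | _, I⟩ _
      exacts [(measurableSet_normalCone n _).neg, measurableSet_normalCone n _])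
    (by
      rintro ⟨_ | _, I⟩ _
      · have := (hasAngle_normalCone n (I : Set (Fin 4))).neg
        rwa [neg_zero] at this
      · exact hasAngle_normalCone n (I : Set (Fin 4)))
    (by
      filter_upwards [ae_all_iff.2 fun i => ae_inner_ne (hn i) 0] with y hy _
      have hy0 : ∑ i, s i * ⟪n i, y⟫ = 0 := by
        have := congrArg (fun z => ⟪z, y⟫) hsum
        simpa [sum_inner, real_inner_smul_left] using this
      -- The sign pattern of a generic direction; the positive relation between the normals forbids
      -- equal signs. Counting `y` and `-y` together gives the constant 2, twice the asserted value.
      set M : Finset (Fin 4) := Finset.univ.filter fun i => 0 < ⟪n i, y⟫ with hM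
      have hM1 : M ≠ ∅ := by
        intro h0
        have : ∀ i, ⟪n i, y⟫ < 0 := fun i => by
          rw [hM, Finset.filter_eq_empty_iff] at h0
          exact lt_of_le_of_ne (not_lt.1 (h0 (Finset.mem_univ i))) (hy i)
        have := Finset.sum_lt_sum_of_nonempty (s := Finset.univ) ⟨0, Finset.mem_univ _⟩
          fun i _ => mul_neg_of_pos_of_neg (hs i) (this i)
        simp [hy0] at this
      have hM2 : M ≠ Finset.univ := by
        intro h0
        have : ∀ i, 0 < ⟪n i, y⟫ := fun i => by
          have := h0 ▸ Finset.mem_univ i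
          exact (Finset.mem_filter.1 this).2
        have := Finset.sum_lt_sum_of_nonempty (s := Finset.univ) ⟨0, Finset.mem_univ _⟩
          fun i _ => mul_pos (hs i) (this i)
        simp [hy0] at this
      rw [← Int.cast_ofNat, ← sum_subset_tetrahedron M hM1 hM2, Int.cast_sum]
      refine Finset.sum_congr rfl ?_
      rintro ⟨b, I⟩ _
      have e1 : y ∈ normalCone n (I : Set (Fin 4)) ↔ I ⊆ M := by
        simp only [normalCone, Set.mem_ofPred_eq, Finset.mem_coe, Finset.subset_iff, hM,
          Finset.mem_filter, Finset.mem_univ, true_and]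
        exact forall₂_congr fun i _ => ⟨fun h => lt_of_le_of_ne h (Ne.symm (hy i)), le_of_lt⟩
      have e2 : y ∈ -normalCone n (I : Set (Fin 4)) ↔ I ⊆ Mᶜ := by
        simp only [Set.mem_neg, normalCone, Set.mem_ofPred_eq, Finset.mem_coe, Finset.subset_iff, hM,
          Finset.mem_compl, Finset.mem_filter, Finset.mem_univ, true_and, inner_neg_right,
          neg_nonneg, not_lt]
      rcases b with _ | _
      · simp only [cond_false, Set.indicator_apply, e2]; push_cast; rfl
      · simp only [cond_true, Set.indicator_apply, e1]; push_cast; rfl)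
  rw [Finset.sum_product, Fintype.sum_bool, Finset.sum_union] at h
  · have h2 : ∀ I ∈ Finset.powersetCard 2 (Finset.univ : Finset (Fin 4)), I.card = 2 :=
      fun I hI => (Finset.mem_powersetCard.1 hI).2
    have h3 : ∀ I ∈ Finset.powersetCard 3 (Finset.univ : Finset (Fin 4)), I.card ≠ 2 :=
      fun I hI => by rw [(Finset.mem_powersetCard.1 hI).2]; norm_num
    rw [Finset.sum_congr rfl fun I hI => by rw [if_pos (h2 I hI), one_mul],
      Finset.sum_congr (s₁ := Finset.powersetCard 3 _) rfl fun I hI => by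
        rw [if_neg (h3 I hI), neg_one_mul], Finset.sum_neg_distrib] at h
    linarith
  · decide

theorem solidAngle_normalCone_empty {ι : Type*} (n : ι → Euc d) :
    solidAngle (normalCone n ∅) 0 = 1 := by
  have : normalCone n ∅ = Set.univ := by ext; simp [normalCone]
  rw [this, (hasAngle_univ 0).solidAngle_eq]

theorem solidAngle_normalCone_singleton {ι : Type*} (n : ι → Euc d) {i : ι} (hi : n i ≠ 0) :
    solidAngle (normalCone n {i}) 0 = 1 / 2 := by
  have : normalCone n {i} = {x | 0 ≤ ⟪n i, x⟫} := by ext; simp [normalCone]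
  rw [this, (hasAngle_halfSpace hi).solidAngle_eq]

theorem solidAngle_normalCone_pair {ι : Type*} (n : ι → Euc 3) {i j : ι} {r : ℝ} (h0 : -1 < r)
    (h1 : r < 1) (hi : n i ≠ 0) (hj : n j ≠ 0) (h : ⟪n i, n j⟫ = r * (‖n i‖ * ‖n j‖)) :
    solidAngle (normalCone n {i, j}) 0 = (Real.pi - Real.arccos r) / (2 * Real.pi) := by
  have hang : InnerProductGeometry.angle (n i) (n j) = Real.arccos r := by
    rw [InnerProductGeometry.angle, h, mul_div_assoc, div_self, mul_one]
    exact mul_ne_zero (norm_ne_zero_iff.2 hi) (norm_ne_zero_iff.2 hj)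
  have hlt : Real.arccos r < Real.pi := by
    refine lt_of_le_of_ne (Real.arccos_le_pi r) fun h => ?_
    exact absurd (Real.arccos_eq_pi.1 h) (not_le.2 h0)
  have : normalCone n {i, j} = {x | 0 ≤ ⟪n i, x⟫ ∧ 0 ≤ ⟪n j, x⟫} := by
    ext; simp [normalCone]
  rw [this, (hasAngle_wedge hi hj (by rw [hang]; exact Real.arccos_pos.2 h1)
    (by rwa [hang])).solidAngle_eq, hang]

end VertexAngles

/-! ### The Dehn functional of a tetrahedron -/

section DehnInvariant

/-- The edge of a tetrahedron on two facets. -/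
theorem tetrahedron_edge_eq (n : Fin 4 → Euc 3) (c : Fin 4 → ℝ) (v : Fin 4 → Euc 3)
    (r : Fin 4 → ℝ) (hr : ∀ i, 0 < r i)
    (hv : ∀ i j, ⟪n i, v j⟫ + c i = if i = j then r i else 0)
    (h1 : ∀ x, ∑ i, (⟪n i, x⟫ + c i) / r i = 1)
    (hx : ∀ x, ∑ i, ((⟪n i, x⟫ + c i) / r i) • v i = x) {i j k l : Fin 4} (hij : i ≠ j)
    (hki : k ≠ i) (hkj : k ≠ j) (hli : l ≠ i) (hlj : l ≠ j) (hkl : k ≠ l)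
    (hall : (Finset.univ : Finset (Fin 4)) = {i, j, k, l}) :
    {x ∈ polyhedron n c | ∀ i' ∈ ({i, j} : Finset (Fin 4)), ⟪n i', x⟫ + c i' = 0} =
      segment ℝ (v k) (v l) := by
  apply Set.Subset.antisymm
  · rintro z ⟨hzp, hz⟩
    have hzi := hz i (by simp)
    have hzj := hz j (by simp)
    -- The quotients `(⟪n m, z⟫ + c m) / r m` are the barycentric coordinates of `z`; those of `v i`
    -- and `v j` vanish.
    have e1 := h1 z
    have e2 := hx z
    rw [hall, Finset.sum_insert (by simp [hij, hki.symm, hli.symm]),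
      Finset.sum_insert (by simp [hkj.symm, hlj.symm]), Finset.sum_pair hkl, hzi, hzj] at e1 e2
    simp only [zero_div, zero_add, zero_smul] at e1 e2
    exact ⟨_, _, div_nonneg (hzp k) (hr k).le, div_nonneg (hzp l) (hr l).le, e1, e2⟩
  · rintro z ⟨s, t, hs, ht, hst, rfl⟩
    have e : ∀ m, ⟪n m, s • v k + t • v l⟫ + c m =
        s * (if m = k then r m else 0) + t * (if m = l then r m else 0) := by
      intro m
      rw [← hv m k, ← hv m l, inner_add_right, real_inner_smul_right, real_inner_smul_right]
      linear_combination -(c m) * hst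
    refine ⟨fun m => ?_, ?_⟩
    · rw [e]
      have := (hr m).le
      refine add_nonneg (mul_nonneg hs ?_) (mul_nonneg ht ?_) <;> split_ifs <;> simp [this]
    · intro m hm
      rw [e]
      rcases Finset.mem_insert.1 hm with rfl | hm
      · simp [hki.symm, hli.symm]
      · rw [Finset.mem_singleton.1 hm]
        simp [hkj.symm, hlj.symm]

/-- The Dehn functional of a tetrahedron is the sum over the edges of the length times the
value at the dihedral angle. -/
theorem integral_map_solidAngle_tetrahedron (n : Fin 4 → Euc 3) (c : Fin 4 → ℝ) (v : Fin 4 → Euc 3)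
    (r : Fin 4 → ℝ) (hr : ∀ i, 0 < r i)
    (hv : ∀ i j, ⟪n i, v j⟫ + c i = if i = j then r i else 0)
    (h1 : ∀ x, ∑ i, (⟪n i, x⟫ + c i) / r i = 1)
    (hx : ∀ x, ∑ i, ((⟪n i, x⟫ + c i) / r i) • v i = x) (f : ℝ →ₗ[ℚ] ℚ) (hf : f 1 = 0) :
    ∫ x, (f (solidAngle (polyhedron n c) x) : ℝ) ∂μH[1] =
      ∑ I ∈ Finset.powersetCard 2 Finset.univ, (f (solidAngle (normalCone n (I : Finset (Fin 4))) 0) : ℝ) *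
        (μH[1] : Measure (Euc 3)).real {x ∈ polyhedron n c | ∀ i ∈ I, ⟪n i, x⟫ + c i = 0} := by
  classical
  have hm : ∀ I : Finset (Fin 4), MeasurableSet {x ∈ polyhedron n c | ∀ i ∈ I, ⟪n i, x⟫ + c i = 0} := by
    intro I
    refine MeasurableSet.ofPred_and (isClosed_polyhedron n c).measurableSet ?_
    have : {x : Euc 3 | ∀ i ∈ I, ⟪n i, x⟫ + c i = 0} = ⋂ i ∈ I, {x | ⟪n i, x⟫ + c i = 0} := by
      ext; simp
    rw [this]
    exact Finset.measurableSet_biInter _ fun i _ =>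
      (isClosed_eq (by fun_prop) continuous_const).measurableSet
  have hfin : ∀ I ∈ Finset.powersetCard 2 (Finset.univ : Finset (Fin 4)),
      μH[1] {x ∈ polyhedron n c | ∀ i ∈ I, ⟪n i, x⟫ + c i = 0} ≠ ⊤ := by
    intro I hI
    obtain ⟨i, j, hij, rfl⟩ := Finset.card_eq_two.1 (Finset.mem_powersetCard.1 hI).2
    obtain ⟨k, l, hkl, hki, hkj, hli, hlj, hall⟩ : ∃ k l, k ≠ l ∧ k ≠ i ∧ k ≠ j ∧ l ≠ i ∧ l ≠ j ∧
        (Finset.univ : Finset (Fin 4)) = {i, j, k, l} := by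
      clear hI hv h1 hx hm
      revert i j; decide
    rw [tetrahedron_edge_eq n c v r hr hv h1 hx hij hki hkj hli hlj hkl hall,
      hausdorffMeasure_segment]
    exact edist_ne_top _ _
  have hae : ∀ᵐ x ∂(μH[1] : Measure (Euc 3)), (f (solidAngle (polyhedron n c) x) : ℝ) =
      ∑ I ∈ Finset.powersetCard 2 Finset.univ,
        {x ∈ polyhedron n c | ∀ i ∈ I, ⟪n i, x⟫ + c i = 0}.indicator
          (fun _ => (f (solidAngle (normalCone n (I : Finset (Fin 4))) 0) : ℝ)) x := by
    have := Measure.nullSingletonClass_hausdorff (Euc 3) (one_pos : (0 : ℝ) < 1)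
    -- Vertices have length zero. Elsewhere at most two facets meet, as three active facets leave
    -- one barycentric coordinate.
    have hvert : ∀ᵐ x ∂(μH[1] : Measure (Euc 3)), x ∉ Set.range v :=
      measure_eq_zero_iff_ae_notMem.1 ((Set.finite_range v).measure_zero _)
    filter_upwards [hvert] with x hxv
    by_cases hxp : x ∈ polyhedron n c
    · set A : Finset (Fin 4) := Finset.univ.filter fun i => ⟪n i, x⟫ + c i = 0 with hA
      have hAmem : ∀ i, i ∈ A ↔ ⟪n i, x⟫ + c i = 0 := fun i => by simp [hA]
      have hAset : {i | ⟪n i, x⟫ + c i = 0} = (A : Set (Fin 4)) := by ext i; simp [hA]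
      have hcard : A.card ≤ 2 := by
        by_contra hlt
        push Not at hlt
        have hc : Aᶜ.card ≤ 1 := by
          rw [Finset.card_compl, Fintype.card_fin]; omega
        obtain ⟨k, hk⟩ : ∃ k, ∀ i, i ≠ k → i ∈ A := by
          rcases Finset.card_le_one_iff_subset_singleton.1 hc with ⟨k, hk⟩
          refine ⟨k, fun i hi => ?_⟩
          by_contra hiA
          exact hi (Finset.mem_singleton.1 (hk (Finset.mem_compl.2 hiA)))
        have h0 : ∀ i, i ≠ k → (⟪n i, x⟫ + c i) / r i = 0 := fun i hi => by
          rw [(hAmem i).1 (hk i hi), zero_div]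
        have e1 := h1 x
        have e2 := hx x
        rw [Finset.sum_eq_single k (fun i _ hi => h0 i hi) (by simp)] at e1
        rw [Finset.sum_eq_single k (fun i _ hi => by rw [h0 i hi, zero_smul]) (by simp), e1,
          one_smul] at e2
        exact hxv ⟨k, e2⟩
      rw [solidAngle_polyhedron n c hxp, hAset]
      have hsubset : ∀ I : Finset (Fin 4), (∀ i ∈ I, ⟪n i, x⟫ + c i = 0) → I ⊆ A :=
        fun I hI i hi => (hAmem i).2 (hI i hi)
      by_cases h2 : A.card = 2
      · rw [Finset.sum_eq_single A]
        · rw [Set.indicator_of_mem]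
          exact ⟨hxp, fun i hi => (hAmem i).1 hi⟩
        · intro I hI hne
          refine Set.indicator_of_notMem (fun hmem => hne ?_) _
          exact Finset.eq_of_subset_of_card_le (hsubset I hmem.2)
            (by rw [h2, (Finset.mem_powersetCard.1 hI).2])
        · exact fun h => (h (Finset.mem_powersetCard.2 ⟨Finset.subset_univ _, h2⟩)).elim
      · have hA1 : A.card ≤ 1 := by omega
        obtain ⟨m, hm'⟩ : ∃ m : Euc 3, ∀ i ∈ (A : Set (Fin 4)), ∃ t : ℝ, n i = t • m := by
          rcases Finset.card_le_one_iff_subset_singleton.1 hA1 with ⟨k, hk⟩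
          refine ⟨n k, fun i hi => ⟨1, ?_⟩⟩
          rw [Finset.mem_singleton.1 (hk hi), one_smul]
        rw [map_solidAngle_normalCone_eq_zero hm' f hf, Rat.cast_zero, Finset.sum_eq_zero]
        intro I hI
        refine Set.indicator_of_notMem (fun hmem => ?_) _
        have := Finset.card_le_card (hsubset I hmem.2)
        rw [(Finset.mem_powersetCard.1 hI).2] at this
        omega
    · rw [solidAngle_eq_zero_of_notMem (isClosed_polyhedron n c) hxp, map_zero, Rat.cast_zero,
        Finset.sum_eq_zero]
      exact fun I _ => Set.indicator_of_notMem (fun hxI => hxp hxI.1) _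
  rw [integral_congr_ae hae, integral_finsetSum]
  · refine Finset.sum_congr rfl fun I _ => ?_
    rw [integral_indicator_const _ (hm I), smul_eq_mul, mul_comm]
  · intro I hI
    rw [integrable_indicator_iff (hm I)]
    exact integrableOn_const (hfin I hI)

end DehnInvariant

/-! ### Volumes of simplices -/

section SimplexVolume

theorem setLIntegral_Icc_ofReal {g : ℝ → ℝ} (hg : Continuous g) {t : ℝ} (ht : 0 ≤ t)
    (h0 : ∀ x ∈ Set.Icc 0 t, 0 ≤ g x) :
    ∫⁻ x in Set.Icc 0 t, ENNReal.ofReal (g x) = ENNReal.ofReal (∫ x in (0 : ℝ)..t, g x) := by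
  rw [intervalIntegral.integral_of_le ht, ← integral_Icc_eq_integral_Ioc,
    ofReal_integral_eq_lintegral_ofReal (hg.integrableOn_Icc)
      ((ae_restrict_iff' measurableSet_Icc).2 (Eventually.of_forall h0))]

theorem volume_triangle (t : ℝ) :
    volume {p : ℝ × ℝ | 0 ≤ p.1 ∧ 0 ≤ p.2 ∧ p.1 + p.2 ≤ t} =
      (Set.Ici (0 : ℝ)).indicator (fun t => ENNReal.ofReal (t ^ 2 / 2)) t := by
  have hm : MeasurableSet {p : ℝ × ℝ | 0 ≤ p.1 ∧ 0 ≤ p.2 ∧ p.1 + p.2 ≤ t} :=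
    MeasurableSet.ofPred_and (measurableSet_le (by fun_prop) (by fun_prop))
      (MeasurableSet.ofPred_and (measurableSet_le (by fun_prop) (by fun_prop))
        (measurableSet_le (by fun_prop) (by fun_prop)))
  rw [Measure.volume_eq_prod, Measure.prod_apply hm]
  have hs : ∀ v : ℝ, volume (Prod.mk v ⁻¹' {p : ℝ × ℝ | 0 ≤ p.1 ∧ 0 ≤ p.2 ∧ p.1 + p.2 ≤ t}) =
      (Set.Icc 0 t).indicator (fun v => ENNReal.ofReal (t - v)) v := by
    intro v
    by_cases hv : v ∈ Set.Icc 0 t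
    · rw [Set.indicator_of_mem hv]
      have : Prod.mk v ⁻¹' {p : ℝ × ℝ | 0 ≤ p.1 ∧ 0 ≤ p.2 ∧ p.1 + p.2 ≤ t} = Set.Icc 0 (t - v) := by
        ext w
        simp only [Set.mem_preimage, Set.mem_ofPred_eq, Set.mem_Icc]
        exact ⟨fun h => ⟨h.2.1, by linarith [h.2.2]⟩, fun h => ⟨hv.1, h.1, by linarith [h.2]⟩⟩
      rw [this, Real.volume_Icc, sub_zero]
    · rw [Set.indicator_of_notMem hv]
      have : Prod.mk v ⁻¹' {p : ℝ × ℝ | 0 ≤ p.1 ∧ 0 ≤ p.2 ∧ p.1 + p.2 ≤ t} = ∅ := by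
        ext w
        simp only [Set.mem_preimage, Set.mem_ofPred_eq, Set.mem_empty_iff_false, iff_false]
        exact fun h => hv ⟨h.1, by linarith [h.2.1, h.2.2]⟩
      rw [this, measure_empty]
  simp only [hs]
  rw [lintegral_indicator measurableSet_Icc]
  by_cases ht : 0 ≤ t
  · rw [Set.indicator_of_mem (Set.mem_Ici.2 ht),
      setLIntegral_Icc_ofReal (by fun_prop) ht fun x hx => by linarith [hx.2]]
    congr 1
    rw [intervalIntegral.integral_sub (by simp) (by simp)]
    simp
    ring
  · rw [Set.indicator_of_notMem (by simpa using ht), Set.Icc_eq_empty ht]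
    simp

theorem volume_standard_simplex :
    volume {x : Euc 3 | 0 ≤ x 0 ∧ 0 ≤ x 1 ∧ 0 ≤ x 2 ∧ x 0 + x 1 + x 2 ≤ 1} =
      ENNReal.ofReal (1 / 6) := by
  obtain ⟨Φ, hΦ, hΦx⟩ := exists_measurePreserving_euc_three
  have h1 : {x : Euc 3 | 0 ≤ x 0 ∧ 0 ≤ x 1 ∧ 0 ≤ x 2 ∧ x 0 + x 1 + x 2 ≤ 1} =
      Φ ⁻¹' {p | 0 ≤ p.1 ∧ 0 ≤ p.2.1 ∧ 0 ≤ p.2.2 ∧ p.2.1 + p.2.2 ≤ 1 - p.1} := by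
    ext x
    simp only [Set.mem_ofPred_eq, Set.mem_preimage, hΦx]
    constructor
    · rintro ⟨a, b, c, d⟩; exact ⟨c, a, b, by linarith⟩
    · rintro ⟨c, a, b, d⟩; exact ⟨a, b, c, by linarith⟩
  have hm : MeasurableSet {p : ℝ × (ℝ × ℝ) | 0 ≤ p.1 ∧ 0 ≤ p.2.1 ∧ 0 ≤ p.2.2 ∧
      p.2.1 + p.2.2 ≤ 1 - p.1} :=
    MeasurableSet.ofPred_and (measurableSet_le (by fun_prop) (by fun_prop))
      (MeasurableSet.ofPred_and (measurableSet_le (by fun_prop) (by fun_prop))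
        (MeasurableSet.ofPred_and (measurableSet_le (by fun_prop) (by fun_prop))
          (measurableSet_le (by fun_prop) (by fun_prop))))
  rw [h1, hΦ.measure_preimage_equiv, Measure.volume_eq_prod, Measure.prod_apply hm]
  have hs : ∀ u : ℝ, volume (Prod.mk u ⁻¹' {p : ℝ × (ℝ × ℝ) | 0 ≤ p.1 ∧ 0 ≤ p.2.1 ∧ 0 ≤ p.2.2 ∧
      p.2.1 + p.2.2 ≤ 1 - p.1}) =
      (Set.Icc 0 1).indicator (fun u => ENNReal.ofReal ((1 - u) ^ 2 / 2)) u := by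
    intro u
    by_cases hu : 0 ≤ u
    · have : Prod.mk u ⁻¹' {p : ℝ × (ℝ × ℝ) | 0 ≤ p.1 ∧ 0 ≤ p.2.1 ∧ 0 ≤ p.2.2 ∧
          p.2.1 + p.2.2 ≤ 1 - p.1} = {p : ℝ × ℝ | 0 ≤ p.1 ∧ 0 ≤ p.2 ∧ p.1 + p.2 ≤ 1 - u} := by
        ext w
        simp [hu]
      rw [this, volume_triangle]
      by_cases hu1 : u ≤ 1
      · rw [Set.indicator_of_mem (by simpa using hu1), Set.indicator_of_mem (Set.mem_Icc.2 ⟨hu, hu1⟩)]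
      · rw [Set.indicator_of_notMem (by simpa using hu1), Set.indicator_of_notMem]
        exact fun h => hu1 h.2
    · rw [Set.indicator_of_notMem fun h => hu h.1]
      have : Prod.mk u ⁻¹' {p : ℝ × (ℝ × ℝ) | 0 ≤ p.1 ∧ 0 ≤ p.2.1 ∧ 0 ≤ p.2.2 ∧
          p.2.1 + p.2.2 ≤ 1 - p.1} = ∅ := by
        ext w
        simp [hu]
      rw [this, measure_empty]
  simp only [hs]
  rw [lintegral_indicator measurableSet_Icc,
    setLIntegral_Icc_ofReal (by fun_prop) zero_le_one fun x hx => by positivity]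
  congr 1
  have : ∀ x : ℝ, (1 - x) ^ 2 / 2 = 1 / 2 - x + x ^ 2 / 2 := fun x => by ring
  simp only [this]
  rw [intervalIntegral.integral_add (Continuous.intervalIntegrable (by fun_prop) _ _)
      (Continuous.intervalIntegrable (by fun_prop) _ _),
    intervalIntegral.integral_sub (Continuous.intervalIntegrable (by fun_prop) _ _)
      (Continuous.intervalIntegrable (by fun_prop) _ _)]
  simp
  norm_num

/-- The volume of a tetrahedron with a vertex at the origin, from the linear forms which vanish on
the facets through the origin. -/
theorem volume_simplex (M : Matrix (Fin 3) (Fin 3) ℝ) (hM : M.det ≠ 0) :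
    volume {x : Euc 3 | (∀ i, 0 ≤ M.mulVec x.ofLp i) ∧ ∑ i, M.mulVec x.ofLp i ≤ 1} =
      ENNReal.ofReal |M.det⁻¹| * ENNReal.ofReal (1 / 6) := by
  set T : Set (Fin 3 → ℝ) := {x | 0 ≤ x 0 ∧ 0 ≤ x 1 ∧ 0 ≤ x 2 ∧ x 0 + x 1 + x 2 ≤ 1}
  have hpres := EuclideanSpace.volume_preserving_symm_measurableEquiv_toLp (Fin 3)
  have hT : volume T = ENNReal.ofReal (1 / 6) := by
    rw [← volume_standard_simplex, ← hpres.measure_preimage_equiv]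
    rfl
  have h1 : {x : Euc 3 | (∀ i, 0 ≤ M.mulVec x.ofLp i) ∧ ∑ i, M.mulVec x.ofLp i ≤ 1} =
      (MeasurableEquiv.toLp 2 (Fin 3 → ℝ)).symm ⁻¹' (Matrix.toLin' M ⁻¹' T) := by
    ext x
    simp only [Set.mem_ofPred_eq, Set.mem_preimage, T, Matrix.toLin'_apply, Fin.forall_fin_succ,
      Fin.sum_univ_three, IsEmpty.forall_iff, and_true]
    simp only [MeasurableEquiv.coe_toLp_symm, and_assoc]
    rfl
  rw [h1, hpres.measure_preimage_equiv, Measure.addHaar_preimage_linearMap volume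
    (by rwa [LinearMap.det_toLin']), LinearMap.det_toLin', hT]

end SimplexVolume

/-! ### Integer normals and integer points -/

section LatticePoints

/-- An integer point. -/
noncomputable def intPoint (z : ℤ × ℤ × ℤ) : Euc 3 := !₂[(z.1 : ℝ), z.2.1, z.2.2]

/-- The inner product of integer vectors. -/
def intDot (y z : ℤ × ℤ × ℤ) : ℤ := y.1 * z.1 + y.2.1 * z.2.1 + y.2.2 * z.2.2

theorem inner_intPoint_left (z : ℤ × ℤ × ℤ) (x : Euc 3) :
    ⟪intPoint z, x⟫ = z.1 * x 0 + z.2.1 * x 1 + z.2.2 * x 2 := by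
  simp [intPoint, PiLp.inner_apply, Fin.sum_univ_three]
  ring

theorem inner_intPoint (y z : ℤ × ℤ × ℤ) : ⟪intPoint y, intPoint z⟫ = intDot y z := by
  rw [inner_intPoint_left]
  simp [intPoint, intDot]

theorem norm_intPoint (z : ℤ × ℤ × ℤ) : ‖intPoint z‖ = √(intDot z z) := by
  rw [← inner_intPoint, real_inner_self_eq_norm_sq, Real.sqrt_sq (norm_nonneg _)]

theorem intPoint_ne_zero {z : ℤ × ℤ × ℤ} (h : 0 < intDot z z) : intPoint z ≠ 0 := by
  rw [← norm_pos_iff, norm_intPoint]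
  exact Real.sqrt_pos.2 (by exact_mod_cast h)

theorem intPoint_injective : Function.Injective intPoint := by
  rintro ⟨a, b, c⟩ ⟨a', b', c'⟩ h
  have h0 := congrArg (fun x : Euc 3 => x 0) h
  have h1 := congrArg (fun x : Euc 3 => x 1) h
  have h2 := congrArg (fun x : Euc 3 => x 2) h
  simp [intPoint] at h0 h1 h2
  rw [h0, h1, h2]

theorem mem_integerLattice_iff {x : Euc 3} : x ∈ integerLattice 3 ↔ ∃ z, intPoint z = x := by
  constructor
  · intro h
    obtain ⟨a, ha⟩ := h 0
    obtain ⟨b, hb⟩ := h 1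
    obtain ⟨c, hc⟩ := h 2
    refine ⟨(a, b, c), ?_⟩
    ext i
    fin_cases i
    exacts [ha.symm, hb.symm, hc.symm]
  · rintro ⟨z, rfl⟩ i
    fin_cases i
    exacts [⟨z.1, rfl⟩, ⟨z.2.1, rfl⟩, ⟨z.2.2, rfl⟩]

/-- The solid angles of a polyhedron at the integer points, by the facets through them. -/
theorem discreteVolume_polyhedron {ι : Type} [Fintype ι] (n : ι → ℤ × ℤ × ℤ) (c : ι → ℤ)
    (B : Finset (ℤ × ℤ × ℤ)) (hB : ∀ z, (∀ i, 0 ≤ intDot (n i) z + c i) → z ∈ B) :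
    discreteVolume (polyhedron (fun i => intPoint (n i)) fun i => (c i : ℝ)) =
      (((B.filter fun z => ∀ i, 0 ≤ intDot (n i) z + c i).val.map fun z =>
        Finset.univ.filter fun i => intDot (n i) z + c i = 0).map fun I : Finset ι =>
          solidAngle (normalCone (fun i => intPoint (n i)) (I : Set ι)) 0).sum := by
  have hmem : ∀ z, intPoint z ∈ polyhedron (fun i => intPoint (n i)) (fun i => (c i : ℝ)) ↔
      ∀ i, 0 ≤ intDot (n i) z + c i := by
    intro z
    refine forall_congr' fun i => ?_
    rw [inner_intPoint]
    beta_reduce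
    exact_mod_cast Iff.rfl
  have hset : polyhedron (fun i => intPoint (n i)) (fun i => (c i : ℝ)) ∩ integerLattice 3 =
      ((B.filter fun z => ∀ i, 0 ≤ intDot (n i) z + c i).map ⟨intPoint, intPoint_injective⟩ :
        Finset (Euc 3)) := by
    ext x
    simp only [Set.mem_inter_iff, mem_integerLattice_iff, Finset.coe_map, Set.mem_image,
      Finset.mem_coe, Finset.mem_filter, Function.Embedding.coeFn_mk]
    constructor
    · rintro ⟨hx, z, rfl⟩
      exact ⟨z, ⟨hB z ((hmem z).1 hx), (hmem z).1 hx⟩, rfl⟩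
    · rintro ⟨z, ⟨-, hz⟩, rfl⟩
      exact ⟨(hmem z).2 hz, z, rfl⟩
  -- The angle at a lattice point depends only on the set of facets through it, so the sum is
  -- encoded by a multiset of index sets, which can be enumerated by `decide`.
  rw [discreteVolume, hset, finsum_mem_coe_finset, Finset.sum_map, Multiset.map_map]
  refine Finset.sum_congr rfl fun z hz => ?_
  rw [Function.Embedding.coeFn_mk, solidAngle_polyhedron _ _ ((hmem z).2 (Finset.mem_filter.1 hz).2)]
  congr 2
  ext i
  simp only [Set.mem_ofPred_eq, Finset.coe_filter, Finset.mem_univ, true_and, inner_intPoint]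
  exact_mod_cast Iff.rfl

theorem solidAngle_intPoint_pair {ι : Type} (n : ι → ℤ × ℤ × ℤ) {i j : ι} {r : ℝ} (h0 : -1 < r)
    (h1 : r < 1) (hi : 0 < intDot (n i) (n i)) (hj : 0 < intDot (n j) (n j))
    (h : intDot (n i) (n j) = r * √(intDot (n i) (n i) * intDot (n j) (n j))) :
    solidAngle (normalCone (fun i => intPoint (n i)) {i, j}) 0 =
      (Real.pi - Real.arccos r) / (2 * Real.pi) := by
  refine solidAngle_normalCone_pair _ h0 h1 (intPoint_ne_zero hi) (intPoint_ne_zero hj) ?_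
  rw [inner_intPoint, norm_intPoint, norm_intPoint, h, Real.sqrt_mul (by exact_mod_cast hi.le)]

end LatticePoints

/-! ### Irrationality of the dihedral angle -/

section Angles

open Real

theorem wedge_eq_quarter : (π - arccos 0) / (2 * π) = 1 / 4 := by
  rw [arccos_zero]; field_simp; norm_num

theorem wedge_eq_sixth : (π - arccos (-1 / 2)) / (2 * π) = 1 / 6 := by
  rw [neg_div, arccos_neg, ← cos_pi_div_three, arccos_cos (by positivity) (by linarith [pi_pos])]
  field_simp; norm_num

theorem wedge_neg (r : ℝ) : (π - arccos (-r)) / (2 * π) = 1 / 2 - (π - arccos r) / (2 * π) := by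
  rw [arccos_neg]; field_simp

/-- Doubling removes the square root: the cosine of twice the angle is `2 / 10 - 1 = -4 / 5`, which
Niven's theorem forbids for a rational multiple of π. -/
theorem wedge_ne_ratCast (q : ℚ) : (π - arccos (1 / √10)) / (2 * π) ≠ q := by
  intro h
  have h10 : (1 : ℝ) ≤ √10 := by rw [Real.one_le_sqrt]; norm_num
  have hc : cos (arccos (1 / √10)) = 1 / √10 :=
    cos_arccos (by have : 0 ≤ 1 / √10 := by positivity
                   linarith) (by rw [div_le_one (by positivity)]; exact h10)
  have h2 : cos (2 * arccos (1 / √10)) = -4 / 5 := by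
    rw [cos_two_mul, hc, div_pow, sq_sqrt (by norm_num)]; norm_num
  have h3 := niven (θ := 2 * arccos (1 / √10)) ⟨2 * (1 - 2 * q), by
    rw [div_eq_iff (by positivity)] at h
    push_cast
    linarith⟩ ⟨-4 / 5, by rw [h2]; norm_num⟩
  rw [h2] at h3
  norm_num at h3

/-- Over `ℚ` the irrational angle lies off the line spanned by `1`, so a linear functional separates
it from that line. -/
theorem exists_linearMap_ne_zero : ∃ f : ℝ →ₗ[ℚ] ℚ, f 1 = 0 ∧
    f ((π - arccos (1 / √10)) / (2 * π)) ≠ 0 := by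
  have hx : (π - arccos (1 / √10)) / (2 * π) ∉ Submodule.span ℚ {(1 : ℝ)} := by
    rw [Submodule.mem_span_singleton]
    rintro ⟨q, hq⟩
    refine wedge_ne_ratCast q ?_
    rw [← hq, Rat.smul_def, mul_one]
  obtain ⟨f, hf, hf'⟩ := Submodule.exists_dual_map_eq_bot_of_notMem hx inferInstance
  refine ⟨f, ?_, hf⟩
  have : f 1 ∈ (Submodule.span ℚ {(1 : ℝ)}).map f :=
    Submodule.mem_map_of_mem (Submodule.mem_span_singleton_self 1)
  rwa [hf', Submodule.mem_bot] at this

end Angles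

/-! ### The two tetrahedra -/

section Tetrahedra

/-- The normals of a tetrahedron whose facets through the origin are `p = 0`, `y = 0`, `q = 0`. -/
def tetraNormal (m : ℤ × ℤ × ℤ) : Fin 4 → ℤ × ℤ × ℤ := ![(1, 0, 1), (-1, 1, 0), (-2, -1, 0), m]

/-- The constants of the inequalities of the tetrahedron. -/
def tetraConst (e : ℤ) : Fin 4 → ℤ := ![0, 0, 0, e]

/-- The tetrahedron with the fourth inequality `0 ≤ ⟪m, x⟫ + e`. -/
noncomputable def tetrahedron (m : ℤ × ℤ × ℤ) (e : ℤ) : Set (Euc 3) :=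
  polyhedron (fun i => intPoint (tetraNormal m i)) fun i => (tetraConst e i : ℝ)

theorem mem_tetrahedron {m : ℤ × ℤ × ℤ} {e : ℤ} {x : Euc 3} :
    x ∈ tetrahedron m e ↔ 0 ≤ coordP x ∧ 0 ≤ coordY x ∧ 0 ≤ coordQ x ∧
      0 ≤ m.1 * x 0 + m.2.1 * x 1 + m.2.2 * x 2 + e := by
  simp only [tetrahedron, polyhedron, Set.mem_ofPred_eq, inner_intPoint_left, Fin.forall_fin_succ,
    tetraNormal, tetraConst, IsEmpty.forall_iff, and_true, coordP_apply, coordY_apply, coordQ_apply]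
  simp
  -- The integer normals of facets 1 and 2 represent `3 * coordY` and `3 * coordQ`.
  refine fun _ => and_congr ?_ (and_congr_left fun _ => ?_)
  · constructor <;> intro h <;> linarith
  · constructor <;> intro h <;> linarith

theorem isPolyhedron_tetrahedron (m : ℤ × ℤ × ℤ) (e : ℤ) : IsPolyhedron (tetrahedron m e) :=
  ⟨Fin 4, inferInstance, _, _, rfl⟩

/-- The box which contains the lattice points. -/
noncomputable def latticeBox : Finset (ℤ × ℤ × ℤ) :=
  Finset.Icc (-5) 0 ×ˢ (Finset.Icc (-5) 2 ×ˢ Finset.Icc 0 5)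

theorem powersetCard_two_fin_four : Finset.powersetCard 2 (Finset.univ : Finset (Fin 4)) =
    {{0, 1}, {0, 2}, {0, 3}, {1, 2}, {1, 3}, {2, 3}} := by decide

theorem powersetCard_three_fin_four : Finset.powersetCard 3 (Finset.univ : Finset (Fin 4)) =
    {{0, 1, 2}, {0, 1, 3}, {0, 2, 3}, {1, 2, 3}} := by decide

theorem sum_powersetCard_two (F : Finset (Fin 4) → ℝ) :
    ∑ I ∈ Finset.powersetCard 2 Finset.univ, F I =
      F {0, 1} + F {0, 2} + F {0, 3} + F {1, 2} + F {1, 3} + F {2, 3} := by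
  rw [powersetCard_two_fin_four]
  repeat rw [Finset.sum_insert (by decide)]
  rw [Finset.sum_singleton]
  ring

theorem sum_powersetCard_three (F : Finset (Fin 4) → ℝ) :
    ∑ I ∈ Finset.powersetCard 3 Finset.univ, F I =
      F {0, 1, 2} + F {0, 1, 3} + F {0, 2, 3} + F {1, 2, 3} := by
  rw [powersetCard_three_fin_four]
  repeat rw [Finset.sum_insert (by decide)]
  rw [Finset.sum_singleton]
  ring

/-- The solid angle of the cone of some facets of the tetrahedron. -/
noncomputable def tetraAngle (m : ℤ × ℤ × ℤ) (I : Finset (Fin 4)) : ℝ :=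
  solidAngle (normalCone (fun i => intPoint (tetraNormal m i)) (I : Set (Fin 4))) 0

theorem tetraAngle_empty (m : ℤ × ℤ × ℤ) : tetraAngle m ∅ = 1 := by
  rw [tetraAngle, Finset.coe_empty, solidAngle_normalCone_empty]

theorem tetraNormal_ne_zero {m : ℤ × ℤ × ℤ} (hm : 0 < intDot m m) (i : Fin 4) :
    intPoint (tetraNormal m i) ≠ 0 := by
  refine intPoint_ne_zero ?_
  fin_cases i
  exacts [show 0 < intDot (1, 0, 1) (1, 0, 1) by decide,
      show 0 < intDot (-1, 1, 0) (-1, 1, 0) by decide,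
      show 0 < intDot (-2, -1, 0) (-2, -1, 0) by decide, hm]

theorem tetraAngle_singleton {m : ℤ × ℤ × ℤ} (hm : 0 < intDot m m) (i : Fin 4) :
    tetraAngle m {i} = 1 / 2 := by
  rw [tetraAngle, Finset.coe_singleton, 
    solidAngle_normalCone_singleton (fun i => intPoint (tetraNormal m i)) (tetraNormal_ne_zero hm i)]

theorem tetraAngle_pair {m : ℤ × ℤ × ℤ} (i j : Fin 4) {r : ℝ} (h0 : -1 < r) (h1 : r < 1)
    (hm : 0 < intDot m m) (a b : ℤ) (hb : intDot (tetraNormal m i) (tetraNormal m i) *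
      intDot (tetraNormal m j) (tetraNormal m j) = b) (ha : intDot (tetraNormal m i) (tetraNormal m j) = a)
    (h : a = r * √b) : tetraAngle m {i, j} = (Real.pi - Real.arccos r) / (2 * Real.pi) := by
  have hpos : ∀ i, 0 < intDot (tetraNormal m i) (tetraNormal m i) := by
    intro i
    fin_cases i
    exacts [show 0 < intDot (1, 0, 1) (1, 0, 1) by decide,
      show 0 < intDot (-1, 1, 0) (-1, 1, 0) by decide,
      show 0 < intDot (-2, -1, 0) (-2, -1, 0) by decide, hm]
  rw [tetraAngle, Finset.coe_pair]
  refine solidAngle_intPoint_pair _ h0 h1 (hpos i) (hpos j) ?_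
  rw [ha, h, ← hb]
  push_cast
  rfl

theorem tetraAngle_sum {m : ℤ × ℤ × ℤ} (hm : 0 < intDot m m) (s : Fin 4 → ℝ) (hs : ∀ i, 0 < s i)
    (hsum : ∑ i, s i • intPoint (tetraNormal m i) = 0) :
    tetraAngle m {0, 1, 2} + tetraAngle m {0, 1, 3} + tetraAngle m {0, 2, 3} +
      tetraAngle m {1, 2, 3} = tetraAngle m {0, 1} + tetraAngle m {0, 2} + tetraAngle m {0, 3} +
      tetraAngle m {1, 2} + tetraAngle m {1, 3} + tetraAngle m {2, 3} - 1 := by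
  have h := sum_solidAngle_tetrahedron _ s hs (tetraNormal_ne_zero hm) hsum
  rw [sum_powersetCard_two, sum_powersetCard_three] at h
  unfold tetraAngle
  linarith

theorem discreteVolume_tetrahedron (m : ℤ × ℤ × ℤ) (e : ℤ)
    (hB : ∀ z, (∀ i, 0 ≤ intDot (tetraNormal m i) z + tetraConst e i) → z ∈ latticeBox) :
    discreteVolume (tetrahedron m e) =
      (((latticeBox.filter fun z => ∀ i, 0 ≤ intDot (tetraNormal m i) z + tetraConst e i).val.map
        fun z => Finset.univ.filter fun i => intDot (tetraNormal m i) z + tetraConst e i = 0).map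
          (tetraAngle m)).sum := by
  unfold tetrahedron
  convert discreteVolume_polyhedron _ _ _ hB
  rfl

/-- The angle of the edges with the cosine `-1 / √10`. -/
noncomputable def angleA : ℝ := (Real.pi - Real.arccos (1 / √10)) / (2 * Real.pi)

/-- The angle of the edges with the cosine `2 / √10`. -/
noncomputable def angleB : ℝ := (Real.pi - Real.arccos (-2 / √10)) / (2 * Real.pi)

theorem three_lt_sqrt_ten : 3 < √10 := by
  rw [Real.lt_sqrt] <;> norm_num

theorem sqrt_ninety : √90 = 3 * √10 := by
  rw [show (90 : ℝ) = 3 ^ 2 * 10 by norm_num, Real.sqrt_mul (by positivity), Real.sqrt_sq (by norm_num)]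

theorem sqrt_ten_pos : 0 < √10 := by positivity

theorem cos_bound_a : -1 < 1 / √10 ∧ 1 / √10 < 1 := by
  have := three_lt_sqrt_ten
  constructor
  · rw [lt_div_iff₀ sqrt_ten_pos]; linarith
  · rw [div_lt_iff₀ sqrt_ten_pos]; linarith

theorem cos_bound_b : -1 < -2 / √10 ∧ -2 / √10 < 1 := by
  have := three_lt_sqrt_ten
  constructor
  · rw [lt_div_iff₀ sqrt_ten_pos]; linarith
  · rw [div_lt_iff₀ sqrt_ten_pos]; linarith

theorem tetraAngle_zero_one {m : ℤ × ℤ × ℤ} (hm : 0 < intDot m m) : tetraAngle m {0, 1} = 1 / 6 := by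
  rw [tetraAngle_pair 0 1 (r := -1 / 2) (by norm_num) (by norm_num) hm (-1) 4 rfl rfl,
    wedge_eq_sixth]
  push_cast
  rw [show (4 : ℝ) = 2 ^ 2 by norm_num, Real.sqrt_sq] <;> norm_num

theorem tetraAngle_zero_two {m : ℤ × ℤ × ℤ} (hm : 0 < intDot m m) : tetraAngle m {0, 2} = angleB := by
  rw [tetraAngle_pair 0 2 cos_bound_b.1 cos_bound_b.2 hm (-2) 10 rfl rfl, angleB]
  push_cast
  rw [div_mul_cancel₀ _ sqrt_ten_pos.ne']

theorem tetraAngle_one_two {m : ℤ × ℤ × ℤ} (hm : 0 < intDot m m) : tetraAngle m {1, 2} = angleA := by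
  rw [tetraAngle_pair 1 2 cos_bound_a.1 cos_bound_a.2 hm 1 10 rfl rfl, angleA]
  push_cast
  rw [div_mul_cancel₀ _ sqrt_ten_pos.ne']

/-- The normal of the fourth facet of the smaller tetrahedron. -/
def smallNormal : ℤ × ℤ × ℤ := (1, 0, -1)

/-- The normal of the fourth facet of the larger tetrahedron. -/
def largeNormal : ℤ × ℤ × ℤ := (2, -4, -5)

theorem smallNormal_pos : 0 < intDot smallNormal smallNormal := by decide
theorem largeNormal_pos : 0 < intDot largeNormal largeNormal := by decide

theorem small_zero_three : tetraAngle smallNormal {0, 3} = 1 / 4 := by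
  rw [tetraAngle_pair 0 3 (r := 0) (by norm_num) (by norm_num) smallNormal_pos 0 4 rfl rfl,
    wedge_eq_quarter]
  simp

theorem small_one_three : tetraAngle smallNormal {1, 3} = 1 / 6 := by
  rw [tetraAngle_pair 1 3 (r := -1 / 2) (by norm_num) (by norm_num) smallNormal_pos (-1) 4
    rfl rfl, wedge_eq_sixth]
  push_cast
  rw [show (4 : ℝ) = 2 ^ 2 by norm_num, Real.sqrt_sq] <;> norm_num

theorem small_two_three : tetraAngle smallNormal {2, 3} = angleB := by
  rw [tetraAngle_pair 2 3 cos_bound_b.1 cos_bound_b.2 smallNormal_pos (-2) 10 rfl rfl, angleB]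
  push_cast
  rw [div_mul_cancel₀ _ sqrt_ten_pos.ne']

theorem large_zero_three : tetraAngle largeNormal {0, 3} = 1 / 2 - angleA := by
  rw [tetraAngle_pair 0 3 (r := -(1 / √10)) (by linarith [cos_bound_a.2])
    (by linarith [cos_bound_a.1]) largeNormal_pos (-3) 90 rfl rfl, wedge_neg, angleA]
  push_cast
  rw [sqrt_ninety]
  have := sqrt_ten_pos.ne'
  field_simp

theorem large_one_three : tetraAngle largeNormal {1, 3} = angleB := by
  rw [tetraAngle_pair 1 3 cos_bound_b.1 cos_bound_b.2 largeNormal_pos (-6) 90 rfl rfl, angleB]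
  push_cast
  rw [sqrt_ninety]
  have := sqrt_ten_pos.ne'
  field_simp
  norm_num

theorem large_two_three : tetraAngle largeNormal {2, 3} = 1 / 4 := by
  rw [tetraAngle_pair 2 3 (r := 0) (by norm_num) (by norm_num) largeNormal_pos 0 225 rfl rfl,
    wedge_eq_quarter]
  simp

/-- Besides the four vertices there is one point inside the edge `{1, 2}` and two inside the edge
`{0, 3}`. -/
theorem small_points : ((latticeBox.filter fun z => ∀ i, 0 ≤ intDot (tetraNormal smallNormal i) z +
    tetraConst 2 i).val.map fun z => Finset.univ.filter fun i : Fin 4 =>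
      intDot (tetraNormal smallNormal i) z + tetraConst 2 i = 0) =
    {{0, 1, 2}, {0, 1, 3}, {0, 2, 3}, {1, 2, 3}, {1, 2}, {0, 3}, {0, 3}} := by
  decide +kernel

/-- The four vertices, six points inside edges, ten inside facets, and one interior point. -/
theorem large_points : ((latticeBox.filter fun z => ∀ i, 0 ≤ intDot (tetraNormal largeNormal i) z +
    tetraConst 15 i).val.map fun z => Finset.univ.filter fun i : Fin 4 =>
      intDot (tetraNormal largeNormal i) z + tetraConst 15 i = 0) =
    {{0, 1, 2}, {0, 1, 3}, {0, 2, 3}, {1, 2, 3}, {1, 2}, {1, 2}, {0, 1}, {0, 1}, {0, 1}, {0, 1},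
      {0}, {0}, {0}, {0}, {0}, {1}, {1}, {1}, {1}, {3}, ∅} := by
  decide +kernel

theorem discreteVolume_small : discreteVolume (tetrahedron smallNormal 2) =
    2 * angleB + 2 * angleA + 1 / 12 := by
  rw [discreteVolume_tetrahedron, small_points]
  -- The weights in the relation between the normals are proportional to `1 / r i`, where `r i` is
  -- the value of the `i`th inequality at the opposite vertex; here `r = (2, 3, 3, 2)`.
  · have h := tetraAngle_sum smallNormal_pos ![3, 2, 2, 3]
      (by intro i; fin_cases i <;> norm_num) (by
        ext i
        fin_cases i <;>
          simp [Fin.sum_univ_four, tetraNormal, smallNormal, intPoint]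
        norm_num)
    simp only [Multiset.insert_eq_cons, Multiset.map_cons, Multiset.sum_cons, Multiset.map_singleton,
      Multiset.sum_singleton]
    rw [tetraAngle_zero_one smallNormal_pos, tetraAngle_zero_two smallNormal_pos,
      tetraAngle_one_two smallNormal_pos, small_zero_three, small_one_three, small_two_three] at h
    rw [tetraAngle_one_two smallNormal_pos, small_zero_three]
    linarith
  · rintro ⟨a, b, c⟩ h
    have h0 := h 0
    have h1 := h 1
    have h2 := h 2
    have h3 := h 3
    simp [tetraNormal, tetraConst, smallNormal, intDot] at h0 h1 h2 h3
    simp only [latticeBox, Finset.mem_product, Finset.mem_Icc]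
    omega

theorem discreteVolume_large : discreteVolume (tetrahedron largeNormal 15) =
    2 * angleB + 2 * angleA + 79 / 12 := by
  rw [discreteVolume_tetrahedron, large_points]
  -- Again proportional to `1 / r i`, with `r = (3, 3, 15, 15)`.
  · have h := tetraAngle_sum largeNormal_pos ![5, 5, 1, 1]
      (by intro i; fin_cases i <;> norm_num) (by
        ext i
        fin_cases i <;>
          simp [Fin.sum_univ_four, tetraNormal, largeNormal, intPoint]
        norm_num)
    simp only [Multiset.insert_eq_cons, Multiset.map_cons, Multiset.sum_cons, Multiset.map_singleton,
      Multiset.sum_singleton]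
    rw [tetraAngle_zero_one largeNormal_pos, tetraAngle_zero_two largeNormal_pos,
      tetraAngle_one_two largeNormal_pos, large_zero_three, large_one_three, large_two_three] at h
    rw [tetraAngle_one_two largeNormal_pos, tetraAngle_zero_one largeNormal_pos, tetraAngle_empty,
      tetraAngle_singleton largeNormal_pos, tetraAngle_singleton largeNormal_pos,
      tetraAngle_singleton largeNormal_pos]
    linarith
  · rintro ⟨a, b, c⟩ h
    have h0 := h 0
    have h1 := h 1
    have h2 := h 2
    have h3 := h 3
    simp [tetraNormal, tetraConst, largeNormal, intDot] at h0 h1 h2 h3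
    simp only [latticeBox, Finset.mem_product, Finset.mem_Icc]
    omega

end Tetrahedra

/-! ### Edge lengths and Dehn functionals of the two tetrahedra -/

section TetrahedronDehn

/-- The vertices of the two tetrahedra: `a e₃`, `b`, `c (-1, -1, 1)` and the origin. -/
noncomputable def tetraVertex (a c : ℤ) : Fin 4 → Euc 3 :=
  fun i => intPoint ((![(0, 0, a), (-1, 2, 1), (-c, -c, c), (0, 0, 0)] : Fin 4 → ℤ × ℤ × ℤ) i)

theorem measureReal_hausdorff_segment (x y : Euc 3) :
    (μH[1] : Measure (Euc 3)).real (segment ℝ x y) = dist x y := by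
  rw [Measure.real, hausdorffMeasure_segment, edist_dist, ENNReal.toReal_ofReal dist_nonneg]

theorem dist_intPoint (y z : ℤ × ℤ × ℤ) :
    dist (intPoint y) (intPoint z) = √(intDot (y - z) (y - z)) := by
  have : intPoint y - intPoint z = intPoint (y - z) := by
    ext i
    fin_cases i <;> simp [intPoint]
  rw [dist_eq_norm, this, norm_intPoint]

theorem integral_tetrahedron {m : ℤ × ℤ × ℤ} {e a c : ℤ} (r : Fin 4 → ℝ) (hr : ∀ i, 0 < r i)
    (hv : ∀ i j, ⟪intPoint (tetraNormal m i), tetraVertex a c j⟫ + (tetraConst e i : ℝ) =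
      if i = j then r i else 0)
    (h1 : ∀ x, ∑ i, (⟪intPoint (tetraNormal m i), x⟫ + (tetraConst e i : ℝ)) / r i = 1)
    (hx : ∀ x, ∑ i, ((⟪intPoint (tetraNormal m i), x⟫ + (tetraConst e i : ℝ)) / r i) •
      tetraVertex a c i = x) (f : ℝ →ₗ[ℚ] ℚ) (hf : f 1 = 0) :
    ∫ x, (f (solidAngle (tetrahedron m e) x) : ℝ) ∂μH[1] =
      f (tetraAngle m {0, 1}) * dist (tetraVertex a c 2) (tetraVertex a c 3) +
      f (tetraAngle m {0, 2}) * dist (tetraVertex a c 1) (tetraVertex a c 3) +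
      f (tetraAngle m {0, 3}) * dist (tetraVertex a c 1) (tetraVertex a c 2) +
      f (tetraAngle m {1, 2}) * dist (tetraVertex a c 0) (tetraVertex a c 3) +
      f (tetraAngle m {1, 3}) * dist (tetraVertex a c 0) (tetraVertex a c 2) +
      f (tetraAngle m {2, 3}) * dist (tetraVertex a c 0) (tetraVertex a c 1) := by
  have hedge := fun i j k l hij hki hkj hli hlj hkl hall =>
    tetrahedron_edge_eq (fun i => intPoint (tetraNormal m i)) (fun i => (tetraConst e i : ℝ))
      (tetraVertex a c) r hr hv h1 hx (i := i) (j := j) (k := k) (l := l) hij hki hkj hli hlj hkl hall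
  rw [tetrahedron, integral_map_solidAngle_tetrahedron _ _ _ r hr hv h1 hx f hf, sum_powersetCard_two,
    hedge 0 1 2 3 (by decide) (by decide) (by decide) (by decide) (by decide) (by decide) (by decide),
    hedge 0 2 1 3 (by decide) (by decide) (by decide) (by decide) (by decide) (by decide) (by decide),
    hedge 0 3 1 2 (by decide) (by decide) (by decide) (by decide) (by decide) (by decide) (by decide),
    hedge 1 2 0 3 (by decide) (by decide) (by decide) (by decide) (by decide) (by decide) (by decide),
    hedge 1 3 0 2 (by decide) (by decide) (by decide) (by decide) (by decide) (by decide) (by decide),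
    hedge 2 3 0 1 (by decide) (by decide) (by decide) (by decide) (by decide) (by decide) (by decide)]
  simp only [measureReal_hausdorff_segment]
  rfl

/-- Rational angles drop out. There remain two edges of length √6 with `angleB` and one of length 2
with `angleA`. -/
theorem integral_small (f : ℝ →ₗ[ℚ] ℚ) (hf : f 1 = 0) :
    ∫ x, (f (solidAngle (tetrahedron smallNormal 2) x) : ℝ) ∂μH[1] =
      2 * √6 * f angleB + 2 * f angleA := by
  have hq : ∀ q : ℚ, f (q : ℝ) = 0 := fun q => by
    rw [← mul_one (q : ℝ), ← Rat.smul_def, map_smul, hf, smul_zero]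
  have h6 : f (1 / 6) = 0 := by simpa using hq (1 / 6)
  have h4 : f (1 / 4) = 0 := by simpa using hq (1 / 4)
  rw [integral_tetrahedron (a := 2) (c := 1) ![2, 3, 3, 2] (by intro i; fin_cases i <;> norm_num) ?_ ?_ ?_
    f hf, tetraAngle_zero_one smallNormal_pos, tetraAngle_zero_two smallNormal_pos, small_zero_three,
    tetraAngle_one_two smallNormal_pos, small_one_three, small_two_three, h6, h4]
  · simp only [tetraVertex, dist_intPoint]
    simp [intDot]
    norm_num
    ring
  · intro i j
    simp only [tetraVertex, inner_intPoint]
    fin_cases i <;> fin_cases j <;> norm_num [intDot, tetraNormal, tetraConst, smallNormal]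
  · intro x
    simp only [inner_intPoint_left]
    simp [Fin.sum_univ_four, tetraNormal, tetraConst, smallNormal]
    ring
  · intro x
    simp only [inner_intPoint_left]
    ext i
    fin_cases i <;>
      simp [Fin.sum_univ_four, tetraNormal, tetraConst, smallNormal, tetraVertex, intPoint] <;> ring

/-- `angleB` occurs on edges of lengths √6 and √54 = 3√6. `angleA` occurs on an edge of length 3,
and its negative modulo `ℚ` on one of length 9, whence `3 - 9 = -6`. -/
theorem integral_large (f : ℝ →ₗ[ℚ] ℚ) (hf : f 1 = 0) :
    ∫ x, (f (solidAngle (tetrahedron largeNormal 15) x) : ℝ) ∂μH[1] =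
      4 * √6 * f angleB - 6 * f angleA := by
  have hq : ∀ q : ℚ, f (q : ℝ) = 0 := fun q => by
    rw [← mul_one (q : ℝ), ← Rat.smul_def, map_smul, hf, smul_zero]
  have h6 : f (1 / 6) = 0 := by simpa using hq (1 / 6)
  have h4 : f (1 / 4) = 0 := by simpa using hq (1 / 4)
  have h2 : f (1 / 2) = 0 := by simpa using hq (1 / 2)
  rw [integral_tetrahedron (a := 3) (c := 5) ![3, 3, 15, 15] (by intro i; fin_cases i <;> norm_num) ?_ ?_ ?_
    f hf, tetraAngle_zero_one largeNormal_pos, tetraAngle_zero_two largeNormal_pos, large_zero_three,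
    tetraAngle_one_two largeNormal_pos, large_one_three, large_two_three, map_sub, h6, h4, h2]
  · simp only [tetraVertex, dist_intPoint]
    simp [intDot]
    norm_num
    rw [show (54 : ℝ) = 3 ^ 2 * 6 by norm_num, Real.sqrt_mul (by positivity), Real.sqrt_sq (by norm_num)]
    ring
  · intro i j
    simp only [tetraVertex, inner_intPoint]
    fin_cases i <;> fin_cases j <;> norm_num [intDot, tetraNormal, tetraConst, largeNormal]
  · intro x
    simp only [inner_intPoint_left]
    simp [Fin.sum_univ_four, tetraNormal, tetraConst, largeNormal]
    ring
  · intro x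
    simp only [inner_intPoint_left]
    ext i
    fin_cases i <;>
      simp [Fin.sum_univ_four, tetraNormal, tetraConst, largeNormal, tetraVertex, intPoint] <;> ring

end TetrahedronDehn

/-! ### The pyramid is concrete and does not multitile -/

section PyramidConcrete

theorem mem_small_iff {x : Euc 3} : x ∈ tetrahedron smallNormal 2 ↔
    0 ≤ coordP x ∧ 0 ≤ coordY x ∧ 0 ≤ coordQ x ∧ coordP x / 2 + coordY x + coordQ x ≤ 1 := by
  rw [mem_tetrahedron]
  refine and_congr_right fun _ => and_congr_right fun _ => and_congr_right fun _ => ?_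
  simp only [smallNormal, coordP_apply, coordY_apply, coordQ_apply]
  push_cast
  constructor <;> intro h <;> linarith

theorem mem_large_iff {x : Euc 3} : x ∈ tetrahedron largeNormal 15 ↔
    0 ≤ coordP x ∧ 0 ≤ coordY x ∧ 0 ≤ coordQ x ∧ coordP x / 3 + coordY x + coordQ x / 5 ≤ 1 := by
  rw [mem_tetrahedron]
  refine and_congr_right fun _ => and_congr_right fun _ => and_congr_right fun _ => ?_
  simp only [largeNormal, coordP_apply, coordY_apply, coordQ_apply]
  push_cast
  constructor <;> intro h <;> linarith

theorem small_subset_large : tetrahedron smallNormal 2 ⊆ tetrahedron largeNormal 15 := by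
  intro x hx
  rw [mem_small_iff] at hx
  rw [mem_large_iff]
  exact ⟨hx.1, hx.2.1, hx.2.2.1, by linarith [hx.1, hx.2.2.1, hx.2.2.2]⟩

theorem isBounded_large : Bornology.IsBounded (tetrahedron largeNormal 15) := by
  refine isBounded_of_coord 5 ?_ ?_ ?_ <;>
  · intro x hx
    rw [mem_large_iff] at hx
    obtain ⟨h1, h2, h3, h4⟩ := hx
    rw [abs_le]
    constructor <;> linarith

theorem isBounded_small : Bornology.IsBounded (tetrahedron smallNormal 2) :=
  isBounded_large.subset small_subset_large

theorem volume_small : volume (tetrahedron smallNormal 2) = 1 := by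
  have hdet : (!![1 / 2, 0, 1 / 2; -1 / 3, 1 / 3, 0; -2 / 3, -1 / 3, 0] :
      Matrix (Fin 3) (Fin 3) ℝ).det = 1 / 6 := by
    simp [Matrix.det_fin_three]; norm_num
  have h := volume_simplex !![1 / 2, 0, 1 / 2; -1 / 3, 1 / 3, 0; -2 / 3, -1 / 3, 0]
    (by rw [hdet]; norm_num)
  rw [hdet, ← ENNReal.ofReal_mul (by positivity)] at h
  rw [show |((1 : ℝ) / 6)⁻¹| * (1 / 6) = 1 by norm_num, ENNReal.ofReal_one] at h
  rw [← h]
  congr 1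
  ext x
  rw [mem_small_iff]
  simp [Fin.forall_fin_succ, Fin.sum_univ_three, Matrix.mulVec, dotProduct, coordP_apply,
    coordY_apply, coordQ_apply]
  constructor
  · rintro ⟨h1, h2, h3, h4⟩
    exact ⟨⟨by linarith, by linarith, by linarith⟩, by linarith⟩
  · rintro ⟨⟨h1, h2, h3⟩, h4⟩
    exact ⟨by linarith, by linarith, by linarith, by linarith⟩

theorem volume_large : volume (tetrahedron largeNormal 15) = ENNReal.ofReal (15 / 2) := by
  have hdet : (!![1 / 3, 0, 1 / 3; -1 / 3, 1 / 3, 0; -2 / 15, -1 / 15, 0] :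
      Matrix (Fin 3) (Fin 3) ℝ).det = 1 / 45 := by
    simp [Matrix.det_fin_three]; norm_num
  have h := volume_simplex !![1 / 3, 0, 1 / 3; -1 / 3, 1 / 3, 0; -2 / 15, -1 / 15, 0]
    (by rw [hdet]; norm_num)
  rw [hdet, ← ENNReal.ofReal_mul (by positivity)] at h
  rw [show |((1 : ℝ) / 45)⁻¹| * (1 / 6) = 15 / 2 by norm_num] at h
  rw [← h]
  congr 1
  ext x
  rw [mem_large_iff]
  simp [Fin.forall_fin_succ, Fin.sum_univ_three, Matrix.mulVec, dotProduct, coordP_apply,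
    coordY_apply, coordQ_apply]
  constructor
  · rintro ⟨h1, h2, h3, h4⟩
    exact ⟨⟨by linarith, by linarith, by linarith⟩, by linarith⟩
  · rintro ⟨⟨h1, h2, h3⟩, h4⟩
    exact ⟨by linarith, by linarith, by linarith, by linarith⟩

theorem ae_mem_pyramid_iff : ∀ᵐ x : Euc 3,
    (x ∈ tetrahedron largeNormal 15 \ tetrahedron smallNormal 2 ↔ x ∈ pyramid) := by
  have h : ∀ᵐ x : Euc 3, ((1 / 2 : ℝ) • coordP + coordY + coordQ) x ≠ 1 :=
    ae_linearMap_ne (y := point 0 1 0) (by simp) 1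
  filter_upwards [h] with x hx
  simp only [LinearMap.add_apply, LinearMap.smul_apply, smul_eq_mul] at hx
  rw [Set.mem_sdiff, mem_small_iff, mem_large_iff]
  constructor
  · rintro ⟨⟨h1, h2, h3, h4⟩, h5⟩
    refine ⟨h1, h2, h3, h4, ?_⟩
    by_contra hlt
    exact h5 ⟨h1, h2, h3, by linarith⟩
  · rintro ⟨h1, h2, h3, h4, h5⟩
    exact ⟨⟨h1, h2, h3, h4⟩, fun h => hx (by linarith [h.2.2.2])⟩

/-- The common face of the pyramid and the small tetrahedron is null, so angles subtract and all
computations reduce to tetrahedra. -/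
theorem solidAngle_pyramid (x : Euc 3) : solidAngle pyramid x =
    solidAngle (tetrahedron largeNormal 15) x - solidAngle (tetrahedron smallNormal 2) x := by
  have h1 := isPolyhedron_tetrahedron smallNormal 2
  have h2 := isPolyhedron_tetrahedron largeNormal 15
  have h := hasAngle_diff h1.isClosed.measurableSet small_subset_large (h1.hasAngle x) (h2.hasAngle x)
  exact (h.congr_ae one_pos (ae_mem_pyramid_iff.mono fun y hy _ => hy)).solidAngle_eq

theorem volume_real_pyramid : volume.real pyramid = 13 / 2 := by
  have h1 := isPolyhedron_tetrahedron smallNormal 2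
  have h : volume.real (tetrahedron largeNormal 15 \ tetrahedron smallNormal 2) =
      volume.real pyramid := by
    refine measureReal_congr ?_
    filter_upwards [ae_mem_pyramid_iff] with x hx using propext hx
  rw [← h, measureReal_sdiff small_subset_large h1.isClosed.measurableSet
    isBounded_large.measure_lt_top.ne, Measure.real, Measure.real, volume_small, volume_large,
    ENNReal.toReal_ofReal (by norm_num)]
  norm_num

/-- The part `2 * angleB + 2 * angleA` is common to both tetrahedra, and `79 / 12 - 1 / 12 = 13 / 2
= 15 / 2 - 1`. -/
theorem isConcrete_pyramid : IsConcrete pyramid := by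
  have h1 := isPolyhedron_tetrahedron smallNormal 2
  have h2 := isPolyhedron_tetrahedron largeNormal 15
  have h : ENNReal.ofReal (discreteVolume (tetrahedron largeNormal 15)) =
      ENNReal.ofReal (discreteVolume pyramid) +
        ENNReal.ofReal (discreteVolume (tetrahedron smallNormal 2)) := by
    rw [← tsum_solidAngle h1 isBounded_small, ← tsum_solidAngle h2 isBounded_large,
      ← tsum_solidAngle isPolyhedron_pyramid isBounded_pyramid, ← ENNReal.tsum_add]
    refine tsum_congr fun z => ?_
    rw [← ENNReal.ofReal_add (solidAngle_nonneg isPolyhedron_pyramid _) (solidAngle_nonneg h1 _),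
      solidAngle_pyramid, sub_add_cancel]
  rw [← ENNReal.ofReal_add (discreteVolume_nonneg isPolyhedron_pyramid) (discreteVolume_nonneg h1),
    ENNReal.ofReal_eq_ofReal_iff (discreteVolume_nonneg h2) (add_nonneg
      (discreteVolume_nonneg isPolyhedron_pyramid) (discreteVolume_nonneg h1)),
    discreteVolume_small, discreteVolume_large] at h
  rw [IsConcrete, volume_real_pyramid]
  linarith

/-- The value is `2 √6 f(angleB) - 8 f(angleA)`. If it were zero, then either `f angleB = 0` and `f
angleA = 0`, or √6 would be a quotient of rationals. -/
theorem integral_pyramid_ne_zero (f : ℝ →ₗ[ℚ] ℚ) (hf : f 1 = 0) (hA : f angleA ≠ 0) :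
    ∫ x, (f (solidAngle pyramid x) : ℝ) ∂μH[1] ≠ 0 := by
  have h1 := (isPolyhedron_tetrahedron smallNormal 2).integrable isBounded_small f hf
  have h2 := (isPolyhedron_tetrahedron largeNormal 15).integrable isBounded_large f hf
  have e : ∀ x, (f (solidAngle pyramid x) : ℝ) = f (solidAngle (tetrahedron largeNormal 15) x) -
      f (solidAngle (tetrahedron smallNormal 2) x) := fun x => by
    rw [solidAngle_pyramid, map_sub]; push_cast; rfl
  simp only [e]
  rw [integral_sub h2 h1, integral_small f hf, integral_large f hf]
  intro h
  have h6 : Irrational √6 := by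
    have : ¬IsSquare 6 := by
      rintro ⟨a, ha⟩
      have : a ≤ 2 := by nlinarith
      interval_cases a <;> omega
    exact_mod_cast irrational_sqrt_natCast_iff.2 this
  by_cases hB : f angleB = 0
  · rw [hB] at h
    have : (f angleA : ℝ) = 0 := by
      push_cast at h; linarith
    exact hA (by exact_mod_cast this)
  · refine h6 ⟨4 * f angleA / f angleB, ?_⟩
    have hB' : (f angleB : ℝ) ≠ 0 := by exact_mod_cast hB
    push_cast
    rw [div_eq_iff hB']
    linarith

theorem not_multitiles_of_integral_ne_zero {S : Set (Euc 3)} (hS : IsPolyhedron S)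
    (hb : Bornology.IsBounded S) (hv : volume S ≠ 0) (f : ℝ →ₗ[ℚ] ℚ) (hf : f 1 = 0)
    (h : ∫ x, (f (solidAngle S x) : ℝ) ∂μH[1] ≠ 0) : ¬ Multitiles S := by
  rintro ⟨k, hk, ι, F, -, hF, hae⟩
  choose g hg using hF
  refine h (integral_angle_eq_zero_of_tiling (g := g) hS.isClosed.measurableSet hb hv hS.hasAngle f hf
    (hS.integrable hb f hf) hk ?_)
  simpa only [hg] using hae

end PyramidConcrete

/-! ### Lattice polytopes and their vertices -/

section LatticePolytope

/-- The convex hull of finitely many integer points. -/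
def IsLatticeHull {d : ℕ} (S : Set (Euc d)) : Prop :=
  ∃ s : Set (Euc d), s.Finite ∧ s ⊆ integerLattice d ∧ S = convexHull ℝ s

variable {d : ℕ} {S T : Set (Euc d)}

theorem IsLatticeHull.isLatticePolytope (h : IsLatticeHull S) : IsLatticePolytope S := by
  obtain ⟨s, hs, hl, rfl⟩ := h
  exact ⟨⟨s, hs, rfl⟩, extremePoints_convexHull_subset.trans hl⟩

/-- Convex hulls commute with Minkowski sums; this is why hulls of lattice points are used in place
of extreme points. -/
theorem IsLatticeHull.add (hS : IsLatticeHull S) (hT : IsLatticeHull T) : IsLatticeHull (S + T) := by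
  obtain ⟨s, hs, hsl, rfl⟩ := hS
  obtain ⟨t, ht, htl, rfl⟩ := hT
  refine ⟨s + t, hs.add ht, ?_, (convexHull_add s t).symm⟩
  rintro _ ⟨x, hx, y, hy, rfl⟩ i
  obtain ⟨a, ha⟩ := hsl hx i
  obtain ⟨b, hb⟩ := htl hy i
  exact ⟨a + b, by simp [ha, hb]⟩

theorem zero_mem_integerLattice : (0 : Euc d) ∈ integerLattice d := fun _ => ⟨0, by simp⟩

theorem isLatticeHull_zero : IsLatticeHull ({0} : Set (Euc d)) :=
  ⟨{0}, Set.finite_singleton _, by simpa using zero_mem_integerLattice, (convexHull_singleton _).symm⟩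

theorem isLatticeHull_segment {v : Euc d} (hv : v ∈ integerLattice d) :
    IsLatticeHull (segment ℝ 0 v) :=
  ⟨{0, v}, Set.toFinite _, by
    rintro _ (rfl | rfl)
    exacts [zero_mem_integerLattice, hv], (convexHull_pair _ _).symm⟩

theorem isLatticeHull_sum_segment {n : ℕ} (v : Fin n → Euc d) (hv : ∀ i, v i ∈ integerLattice d) :
    IsLatticeHull (∑ i, segment ℝ (0 : Euc d) (v i)) := by
  induction n with
  | zero => exact isLatticeHull_zero
  | succ n ih =>
    rw [Fin.sum_univ_castSucc]
    exact (ih _ fun i => hv _).add (isLatticeHull_segment (hv _))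

theorem IsLatticeHull.finite_vertices (h : IsLatticeHull S) : (polytopeVertices S).Finite := by
  obtain ⟨s, hs, -, rfl⟩ := h
  exact hs.subset extremePoints_convexHull_subset

/-- A point which is the only maximizer of a linear function is a vertex. -/
theorem mem_polytopeVertices_of_unique_max {x : Euc d} (hx : x ∈ S) (L : Euc d →ₗ[ℝ] ℝ)
    (h : ∀ y ∈ S, L y ≤ L x ∧ (L y = L x → y = x)) : x ∈ polytopeVertices S := by
  rw [polytopeVertices, mem_extremePoints]
  refine ⟨hx, fun y hy z hz hyz => ?_⟩
  obtain ⟨a, b, ha, hb, hab, hxe⟩ := hyz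
  have e : L x = a * L y + b * L z := by
    rw [← hxe, map_add, map_smul, map_smul, smul_eq_mul, smul_eq_mul]
  have hy1 := (h y hy).1
  have hz1 := (h z hz).1
  have e2 : a * (L x - L y) + b * (L x - L z) = 0 := by
    linear_combination L x * hab + e
  have e3 := mul_nonneg ha.le (sub_nonneg.2 hy1)
  have e4 := mul_nonneg hb.le (sub_nonneg.2 hz1)
  have e5 : a * (L x - L y) = 0 := by linarith
  have e6 : b * (L x - L z) = 0 := by linarith
  refine ⟨(h y hy).2 ?_, (h z hz).2 ?_⟩
  · rcases mul_eq_zero.1 e5 with h0 | h0 <;> linarith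
  · rcases mul_eq_zero.1 e6 with h0 | h0 <;> linarith

end LatticePolytope

/-! ### The sums with zonotopes and their vertices -/

section PyramidSum

/-- The vertices of the pyramid. -/
noncomputable def pyramidVertex : Fin 5 → Euc 3 :=
  ![point 2 0 0, point 0 0 1, point 3 0 0, point 0 0 5, point 0 1 0]

theorem pyramid_eq_convexHull : pyramid = convexHull ℝ (Set.range pyramidVertex) := by
  apply Set.Subset.antisymm
  · rintro x ⟨h1, h2, h3, h4, h5⟩
    have hvert : ∀ i, pyramidVertex i ∈ convexHull ℝ (Set.range pyramidVertex) :=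
      fun i => subset_convexHull ℝ _ ⟨i, rfl⟩
    obtain ⟨p, hp⟩ : ∃ p, p = coordP x := ⟨_, rfl⟩
    obtain ⟨y, hy⟩ : ∃ y, y = coordY x := ⟨_, rfl⟩
    obtain ⟨q, hq⟩ : ∃ q, q = coordQ x := ⟨_, rfl⟩
    have hxe : x = point p y q := by rw [hp, hy, hq, point_coord]
    rw [← hp] at h1 h4 h5
    rw [← hy] at h2 h4 h5
    rw [← hq] at h3 h4 h5
    rcases (add_nonneg (div_nonneg h1 (by norm_num : (0 : ℝ) ≤ 6))
      (mul_nonneg (by norm_num : (0 : ℝ) ≤ 4 / 5) h3)).eq_or_lt with h | h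
    · have hp0 : p = 0 := by linarith
      have hq0 : q = 0 := by linarith
      have hy1 : y = 1 := by rw [hp0, hq0] at h4 h5; linarith
      rw [hxe, hp0, hq0, hy1]
      exact hvert 4
    -- `D` is the sum of the slacks `p / 2 + q - (1 - y)` and `1 - y - p / 3 - q / 5`. The ray from
    -- the axis through `(p, q)` meets the two lines where a slack vanishes, and the point divides
    -- that segment in the ratio of the slacks. `D = 0` occurs only at the apex.
    · obtain ⟨D, hD⟩ : ∃ D, D = p / 6 + 4 / 5 * q := ⟨_, rfl⟩
      rw [← hD] at h
      have hB : 0 ≤ 1 - y - p / 3 - q / 5 := by linarith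
      have hA : 0 ≤ p / 2 + q - (1 - y) := by linarith
      have hconv := (convex_convexHull ℝ (Set.range pyramidVertex)).sum_mem (t := Finset.univ)
        (w := ![p * (1 - y - p / 3 - q / 5) / (2 * D), q * (1 - y - p / 3 - q / 5) / D,
          p * (p / 2 + q - (1 - y)) / (3 * D), q * (p / 2 + q - (1 - y)) / (5 * D), y])
        (z := pyramidVertex) (by
          intro i _
          fin_cases i
          · exact div_nonneg (mul_nonneg h1 hB) (by positivity)
          · exact div_nonneg (mul_nonneg h3 hB) h.le
          · exact div_nonneg (mul_nonneg h1 hA) (by positivity)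
          · exact div_nonneg (mul_nonneg h3 hA) (by positivity)
          · exact h2) (by
          have h' := h.ne'
          simp only [Fin.sum_univ_five]
          simp
          field_simp
          rw [hD]
          ring) fun i _ => hvert i
      convert hconv using 1
      rw [hxe]
      have h' := h.ne'
      refine ext_coord ?_ ?_ ?_
      · simp [Fin.sum_univ_five, pyramidVertex]
        field_simp
        rw [hD]
        ring
      · simp [Fin.sum_univ_five, pyramidVertex]
      · simp [Fin.sum_univ_five, pyramidVertex]
        field_simp
        rw [hD]
        ring
  · refine convexHull_min ?_ isPolyhedron_pyramid.convex
    rintro _ ⟨i, rfl⟩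
    fin_cases i <;> norm_num [pyramidVertex, pyramid]

theorem isLatticeHull_pyramid : IsLatticeHull pyramid := by
  refine ⟨_, Set.finite_range pyramidVertex, ?_, pyramid_eq_convexHull⟩
  rintro _ ⟨i, rfl⟩
  fin_cases i
  · exact_mod_cast point_mem_integerLattice 2 0 0
  · exact_mod_cast point_mem_integerLattice 0 0 1
  · exact_mod_cast point_mem_integerLattice 3 0 0
  · exact_mod_cast point_mem_integerLattice 0 0 5
  · exact_mod_cast point_mem_integerLattice 0 1 0

theorem zoneVector_mem_integerLattice (j : ℕ) : zoneVector j ∈ integerLattice 3 := by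
  exact_mod_cast point_mem_integerLattice 1 0 j

theorem pyramidSum_eq (n : ℕ) :
    pyramidSum n = pyramid + ∑ i : Fin n, segment ℝ (0 : Euc 3) (zoneVector i) := by
  induction n with
  | zero => simp [pyramidSum]
  | succ n ih => rw [pyramidSum, ih, Fin.sum_univ_castSucc, add_assoc]; rfl

theorem isLatticeHull_pyramidSum (n : ℕ) : IsLatticeHull (pyramidSum n) := by
  rw [pyramidSum_eq]
  exact isLatticeHull_pyramid.add
    (isLatticeHull_sum_segment _ fun i => zoneVector_mem_integerLattice _)

theorem pyramid_subset_pyramidSum (n : ℕ) : pyramid ⊆ pyramidSum n := by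
  induction n with
  | zero => exact subset_rfl
  | succ n ih => exact ih.trans subset_add_segment

theorem volume_pyramidSum_ne_zero (n : ℕ) : volume (pyramidSum n) ≠ 0 := by
  intro h
  have h1 := measure_mono_null (pyramid_subset_pyramidSum n) h
  have h2 := volume_real_pyramid
  rw [Measure.real, h1] at h2
  norm_num at h2

/-- A closed convex set with empty interior is its own frontier, hence null. -/
theorem interior_pyramidSum_nonempty (n : ℕ) : (interior (pyramidSum n)).Nonempty := by
  by_contra h
  rw [Set.not_nonempty_iff_eq_empty] at h
  have hS := isPolyhedron_pyramidSum n
  have h1 := hS.convex.addHaar_frontier (volume : Measure (Euc 3))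
  rw [hS.isClosed.frontier_eq, h, Set.sdiff_empty] at h1
  exact volume_pyramidSum_ne_zero n h1

theorem isConcreteNonMultitiler_pyramidSum (n : ℕ) : IsConcreteNonMultitiler (pyramidSum n) := by
  refine ⟨(isLatticeHull_pyramidSum n).isLatticePolytope, interior_pyramidSum_nonempty n,
    isConcrete_pyramidSum isConcrete_pyramid n, ?_⟩
  obtain ⟨f, hf, hA⟩ := exists_linearMap_ne_zero
  refine not_multitiles_of_integral_ne_zero (isPolyhedron_pyramidSum n) (isBounded_pyramidSum n)
    (volume_pyramidSum_ne_zero n) f hf ?_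
  rw [integral_pyramidSum f hf]
  exact integral_pyramid_ne_zero f hf hA

/-- Some vertices of the sums. -/
noncomputable def sumVertex (k : ℕ) : ℕ → Euc 3
  | 0 => point 3 0 0
  | j + 1 => sumVertex k j + if j ≤ k then zoneVector j else 0

theorem sumVertex_mem (k j : ℕ) : sumVertex k j ∈ pyramidSum j := by
  induction j with
  | zero =>
    refine ⟨?_, ?_, ?_, ?_, ?_⟩ <;> norm_num [sumVertex]
  | succ j ih =>
    refine ⟨_, ih, _, ?_, rfl⟩
    beta_reduce
    split_ifs
    · exact right_mem_segment _ _ _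
    · exact left_mem_segment _ _ _

/-- The functional is `k + 1 / 2 - i` on `zoneVector i`: positive for `i ≤ k`, negative for `i > k`,
and never zero thanks to the `1 / 2`. So every summand has a unique maximizer. -/
theorem sumVertex_unique_max (k j : ℕ) : ∀ x ∈ pyramidSum j,
    (((k : ℝ) + 1 / 2) • coordP - coordQ) x ≤ (((k : ℝ) + 1 / 2) • coordP - coordQ) (sumVertex k j) ∧
    ((((k : ℝ) + 1 / 2) • coordP - coordQ) x = (((k : ℝ) + 1 / 2) • coordP - coordQ) (sumVertex k j) →
      x = sumVertex k j) := by
  obtain ⟨L, hL⟩ : ∃ L : Euc 3 →ₗ[ℝ] ℝ, L = ((k : ℝ) + 1 / 2) • coordP - coordQ := ⟨_, rfl⟩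
  rw [← hL]
  have hLx : ∀ x, L x = (k + 1 / 2) * coordP x - coordQ x := fun x => by simp [hL]
  induction j with
  | zero =>
    rintro x ⟨h1, h2, h3, h4, h5⟩
    have hk : (0 : ℝ) ≤ k := k.cast_nonneg
    simp only [sumVertex, hLx, coordP_point, coordQ_point]
    have h6 : (k + 1 / 2) * coordP x ≤ (k + 1 / 2) * (3 - 3 * coordY x - 3 / 5 * coordQ x) :=
      mul_le_mul_of_nonneg_left (by linarith) (by positivity)
    have h7 : 0 ≤ k * coordY x := mul_nonneg hk h2
    have h8 : 0 ≤ k * coordQ x := mul_nonneg hk h3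
    refine ⟨by linarith, fun h => ?_⟩
    have hy : coordY x = 0 := by linarith
    have hq : coordQ x = 0 := by linarith
    have hp : coordP x = 3 := by
      rw [hq] at h
      have : ((k : ℝ) + 1 / 2) ≠ 0 := by positivity
      exact mul_left_cancel₀ this (by linarith)
    rw [← point_coord x, hp, hy, hq]
  | succ j ih =>
    intro x hx
    obtain ⟨t, h0, h1, hz⟩ := mem_add_segment_iff.1 hx
    obtain ⟨h2, h3⟩ := ih _ hz
    have hLv : L (zoneVector j) = k + 1 / 2 - j := by
      rw [hLx, coordP_zoneVector, coordQ_zoneVector, mul_one]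
    rw [map_sub, map_smul, smul_eq_mul] at h2 h3
    rw [sumVertex, map_add]
    split_ifs with hjk
    · have hpos : 0 < L (zoneVector j) := by
        have : (j : ℝ) ≤ k := by exact_mod_cast hjk
        rw [hLv]; linarith
      have h4 := mul_nonneg (sub_nonneg.2 h1) hpos.le
      refine ⟨by linarith, fun h => ?_⟩
      have h5 : (1 - t) * L (zoneVector j) = 0 := by linarith
      have h6 : t = 1 := by
        rcases mul_eq_zero.1 h5 with h7 | h7 <;> linarith
      rw [← h3 (by linarith), h6]
      module
    · have hneg : L (zoneVector j) < 0 := by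
        have : (k : ℝ) + 1 ≤ j := by exact_mod_cast not_le.1 hjk
        rw [hLv]; linarith
      have h4 := mul_nonneg h0 (neg_nonneg.2 hneg.le)
      rw [map_zero, add_zero, add_zero]
      refine ⟨by linarith, fun h => ?_⟩
      have h5 : t * L (zoneVector j) = 0 := by linarith
      have h6 : t = 0 := by
        rcases mul_eq_zero.1 h5 with h7 | h7 <;> linarith
      rw [← h3 (by linarith), h6]
      module

/-- This separates the vertices with `k < j`, for which the minimum is `k + 1`. -/
theorem coordP_sumVertex (k j : ℕ) : coordP (sumVertex k j) = (3 + min (k + 1) j : ℕ) := by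
  induction j with
  | zero => simp [sumVertex]
  | succ j ih =>
    rw [sumVertex, map_add, ih]
    split_ifs with h
    · rw [coordP_zoneVector, min_eq_right (by omega), min_eq_right (by omega)]
      push_cast; ring
    · rw [map_zero, add_zero, min_eq_left (by omega), min_eq_left (by omega)]

theorem le_ncard_vertices_pyramidSum (n : ℕ) : n ≤ (polytopeVertices (pyramidSum n)).ncard := by
  classical
  have hinj : Set.InjOn (fun k => sumVertex k n) (Finset.range n : Set ℕ) := by
    intro k hk l hl h
    have hk' : k < n := by simpa using hk
    have hl' : l < n := by simpa using hl
    have h1 := congrArg coordP h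
    beta_reduce at h1
    rw [coordP_sumVertex, coordP_sumVertex, Nat.cast_inj] at h1
    omega
  have h1 := Finset.card_image_of_injOn hinj
  rw [Finset.card_range] at h1
  refine h1.symm.le.trans ?_
  rw [← Set.ncard_coe_finset]
  refine Set.ncard_le_ncard ?_ (isLatticeHull_pyramidSum n).finite_vertices
  intro x hx
  obtain ⟨k, -, rfl⟩ := Finset.mem_image.1 (Finset.mem_coe.1 hx)
  exact mem_polytopeVertices_of_unique_max (sumVertex_mem k n) _ (sumVertex_unique_max k n)

end PyramidSum

theorem theorem1p2 :
    ∃ P : Set (Euc 3), IsConcreteNonMultitiler P ∧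
      ∀ N : ℕ, ∃ Q : Set (Euc 3), IsLatticeZonotope Q ∧
        IsConcreteNonMultitiler (P + Q) ∧ N < (polytopeVertices (P + Q)).ncard := by
  -- `pyramidSum 0` unfolds to `pyramid`, and `N + 1` segments force at least `N + 1` vertices.
  refine ⟨pyramid, isConcreteNonMultitiler_pyramidSum 0, fun N =>
    ⟨∑ i : Fin (N + 1), segment ℝ (0 : Euc 3) (zoneVector i), ⟨⟨N + 1, 0, fun i => zoneVector i, ?_⟩,
      (isLatticeHull_sum_segment _ fun i => zoneVector_mem_integerLattice _).isLatticePolytope⟩, ?_⟩⟩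
  · rw [Set.singleton_zero, zero_add]
  · rw [← pyramidSum_eq]
    exact ⟨isConcreteNonMultitiler_pyramidSum _, le_ncard_vertices_pyramidSum _⟩
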